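/- Let $K$ be an arbitrary field. A semigroup with zero or an associative (not necessarily unital) $K$-algebra $O$ is nilpotent if for some $c\ge 0$ all products of $c+1$ elements are zero; the least such $c$ is its class. The coclass of a finite nilpotent semigroup (a finite-dimensional nilpotent algebra) is the number of its non-zero elements (its dimension) minus its class. For a semigroup $S$ with zero element $z$ let $KS=K[S]/Kz$ be its contracted semigroup algebra. Let $\mathcal G_{1,K}$ be the directed labelled graph whose vertices are the isomorphism types of algebras $KS$ for finite nilpotent semigroups $S$ of coclass $1$, with an edge $A\to B$ if $B/B^c\cong A$, where $c$ is the class of $B$ (then $A$ is called the parent of $B$), and where the label of $A$ is the number of isomorphism types of semigroups $S$ of coclass $1$ with $KS\cong A$. For a vertex $A$ let $\mathcal T(A)$ be the subgraph consisting of all paths starting at $A$. It is a coclass tree if there is exactly one infinite path starting at $A$; it is a maximal coclass tree if moreover $A$ is a root of the graph (has no parent) or the parent of $A$ lies on more than one infinite path starting at a root. Let $Z_3$ be the zero semigroup with $3$ elements, and let $M_{K,1}=I_K\oplus L_K$, where $I_K$ is the algebra of polynomials in one indeterminate over $K$ with zero constant term and $L_K$ is the one-dimensional algebra with zero multiplication.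 Theorem. (1) $\mathcal G_{1,K}$ is a rooted tree with root $KZ_3$, and $\mathcal T=\mathcal T(KZ_3)$ is its unique maximal coclass tree. Let $A_1\to A_2\to\cdots$, with $A_1=KZ_3$, be the unique infinite path of $\mathcal T$ starting at the root. It is described by $M_{K,1}$: this is an infinite-dimensional, finitely generated, residually nilpotent algebra, $M_{K,1}/M_{K,1}^{\,i}$ has coclass $1$ for all sufficiently large $i$, and $M_{K,1}/M_{K,1}^{\,j+1}\cong A_j$ for all $j\ge 1$. (2) $\mathcal T$ is strongly virtually periodic with strong defect $2$ and strong period $2$, with polynomials of degree at most $1$: there are an isomorphism $\mu:\mathcal T(A_2)\to\mathcal T(A_4)$ of unlabelled directed graphs and, for every vertex $B$ in $\mathcal T(A_2)\setminus\mathcal T(A_4)$, a rational polynomial $f_B$ of degree at most $1$ such that the label of $\mu^i(B)$ is $f_B(i)$ for all $i\ge 0$. Moreover: (a) If $-1$ is a square in $K$, then $\mathcal T(A_2)\setminus\mathcal T(A_4)$ consists of $A_2$, $4$ algebras with $A_2$ as parent, and $3$ algebras with $A_3$ as parent. (b) If $-1$ is not a square in $K$, then $\mathcal T(A_2)\setminus\mathcal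 T(A_4)$ consists of $A_2$, $4$ algebras with $A_2$ as parent, and $4$ algebras with $A_3$ as parent. -/

import Mathlib

open Polynomial Filter

/-! ### Powers, class and coclass of (non-unital) associative algebras

Throughout, an associative `K`-algebra is a non-unital ring `A` with a compatible `K`-module
structure, that is `[NonUnitalRing A] [Module K A] [IsScalarTower K A A] [SMulCommClass K A A]`. -/

section Algebras

universe u v w

/-- Two (non-unital) `K`-algebras are isomorphic. -/
def AlgIso (K : Type u) (A : Type v) (B : Type w) [Field K]
    [NonUnitalRing A] [Module K A] [NonUnitalRing B] [Module K B] : Prop :=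
  ∃ f : A →ₙₐ[K] B, Function.Bijective f

/-- A two-sided ideal of a non-unital `K`-algebra (a subspace closed under multiplication by
arbitrary elements on both sides). -/
structure AlgIdeal (K : Type u) (A : Type v) [Field K] [NonUnitalRing A] [Module K A]
    extends Submodule K A where
  mul_mem_left' : ∀ (a : A) {x : A}, x ∈ toSubmodule → a * x ∈ toSubmodule
  mul_mem_right' : ∀ {x : A} (a : A), x ∈ toSubmodule → x * a ∈ toSubmodule

namespace AlgIdeal

variable {K : Type u} {A : Type v} [Field K] [NonUnitalRing A] [Module K A]

/-- The quotient algebra `A / I`: the quotient vector space with the induced product. -/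
def Quot (I : AlgIdeal K A) : Type v := A ⧸ I.toSubmodule

variable (I : AlgIdeal K A)

instance : AddCommGroup I.Quot := inferInstanceAs (AddCommGroup (A ⧸ I.toSubmodule))
instance : Module K I.Quot := inferInstanceAs (Module K (A ⧸ I.toSubmodule))

/-- The projection `A → A / I`. -/
def proj : A →ₗ[K] I.Quot := I.toSubmodule.mkQ

theorem proj_surjective : Function.Surjective I.proj := Submodule.mkQ_surjective _

theorem proj_eq_proj {x y : A} : I.proj x = I.proj y ↔ x - y ∈ I.toSubmodule :=
  Submodule.Quotient.eq I.toSubmodule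

instance : Mul I.Quot where
  mul := Quotient.map₂ (· * ·) (by
    intro a b hab c d hcd
    have hab' : a - b ∈ I.toSubmodule := (Submodule.quotientRel_def _).1 hab
    have hcd' : c - d ∈ I.toSubmodule := (Submodule.quotientRel_def _).1 hcd
    refine (Submodule.quotientRel_def _).2 ?_
    have h : a * c - b * d = a * (c - d) + (a - b) * d := by rw [mul_sub, sub_mul]; abel
    rw [h]
    exact add_mem (I.mul_mem_left' a hcd') (I.mul_mem_right' d hab'))

theorem proj_mul (x y : A) : I.proj (x * y) = I.proj x * I.proj y := rfl

instance : NonUnitalRing I.Quot :=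
  { (inferInstance : AddCommGroup I.Quot), (inferInstance : Mul I.Quot) with
    left_distrib := by
      intro a b c
      obtain ⟨a, rfl⟩ := I.proj_surjective a
      obtain ⟨b, rfl⟩ := I.proj_surjective b
      obtain ⟨c, rfl⟩ := I.proj_surjective c
      simp only [← map_add, ← proj_mul, mul_add]
    right_distrib := by
      intro a b c
      obtain ⟨a, rfl⟩ := I.proj_surjective a
      obtain ⟨b, rfl⟩ := I.proj_surjective b
      obtain ⟨c, rfl⟩ := I.proj_surjective c
      simp only [← map_add, ← proj_mul, add_mul]
    zero_mul := by
      intro a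
      obtain ⟨a, rfl⟩ := I.proj_surjective a
      rw [← map_zero I.proj, ← proj_mul, zero_mul]
    mul_zero := by
      intro a
      obtain ⟨a, rfl⟩ := I.proj_surjective a
      rw [← map_zero I.proj, ← proj_mul, mul_zero]
    mul_assoc := by
      intro a b c
      obtain ⟨a, rfl⟩ := I.proj_surjective a
      obtain ⟨b, rfl⟩ := I.proj_surjective b
      obtain ⟨c, rfl⟩ := I.proj_surjective c
      simp only [← proj_mul, mul_assoc] }

instance [IsScalarTower K A A] : IsScalarTower K I.Quot I.Quot where
  smul_assoc := by
    intro k a b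
    obtain ⟨a, rfl⟩ := I.proj_surjective a
    obtain ⟨b, rfl⟩ := I.proj_surjective b
    simp only [smul_eq_mul, ← map_smul, ← proj_mul, smul_mul_assoc]

instance [SMulCommClass K A A] : SMulCommClass K I.Quot I.Quot where
  smul_comm := by
    intro k a b
    obtain ⟨a, rfl⟩ := I.proj_surjective a
    obtain ⟨b, rfl⟩ := I.proj_surjective b
    simp only [smul_eq_mul, ← map_smul, ← proj_mul, mul_smul_comm]

end AlgIdeal

/-- The power `A ^ n` of an algebra, for `n ≥ 1`: the span of all products of `n` elements.
(By convention `A ^ 0 = A`.) -/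
def algPow (K : Type u) (A : Type v) [Field K] [NonUnitalRing A] [Module K A] :
    ℕ → Submodule K A
  | 0 => ⊤
  | 1 => ⊤
  | n + 2 => Submodule.span K {z | ∃ x ∈ algPow K A (n + 1), ∃ y : A, z = x * y}

section

variable (K : Type u) (A : Type v) [Field K] [NonUnitalRing A] [Module K A]

theorem algPow_succ_le (n : ℕ) : algPow K A (n + 1) ≤ algPow K A n := by
  induction n with
  | zero => exact le_rfl
  | succ n ih =>
    cases n with
    | zero => exact le_top
    | succ n =>
      refine Submodule.span_mono ?_
      rintro z ⟨x, hx, y, rfl⟩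
      exact ⟨x, ih hx, y, rfl⟩

variable [IsScalarTower K A A] [SMulCommClass K A A]

/-- The power `A ^ n` as a two-sided ideal. -/
def algPowIdeal (n : ℕ) : AlgIdeal K A where
  toSubmodule := algPow K A n
  mul_mem_right' := by
    intro x a hx
    cases n with
    | zero => exact Submodule.mem_top
    | succ n => exact algPow_succ_le K A (n + 1) (Submodule.subset_span ⟨x, hx, a, rfl⟩)
  mul_mem_left' := by
    intro a x hx
    induction n generalizing x with
    | zero => exact Submodule.mem_top
    | succ n ih =>
      cases n with
      | zero => exact Submodule.mem_top
      | succ n =>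
        refine Submodule.span_induction (p := fun x _ => a * x ∈ algPow K A (n + 2))
          ?_ ?_ ?_ ?_ hx
        · rintro _ ⟨x, hx, y, rfl⟩
          exact Submodule.subset_span ⟨a * x, ih hx, y, (mul_assoc a x y).symm⟩
        · rw [mul_zero]; exact zero_mem _
        · intro x y _ _ hx hy
          rw [mul_add]; exact add_mem hx hy
        · intro k x _ hx
          rw [mul_smul_comm]; exact Submodule.smul_mem _ k hx

/-- The quotient algebra `A / A ^ n`. -/
abbrev powQuot (n : ℕ) : Type v := (algPowIdeal K A n).Quot

end

section

variable (K : Type u) (A : Type v) [Field K] [NonUnitalRing A] [Module K A]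

/-- `A` is nilpotent: for some `c` all products of `c + 1` elements vanish. -/
def AlgNilpotent : Prop := ∃ c : ℕ, algPow K A (c + 1) = ⊥

/-- The class of a nilpotent algebra: the least `c` such that all products of `c + 1` elements
vanish. -/
noncomputable def algClass : ℕ := sInf {c : ℕ | algPow K A (c + 1) = ⊥}

/-- `A` is a finite-dimensional nilpotent algebra of coclass `r`, i.e. `dim A - cl A = r`. -/
def HasAlgCoclass (r : ℕ) : Prop :=
  FiniteDimensional K A ∧ AlgNilpotent K A ∧ Module.finrank K A = algClass K A + r

variable [IsScalarTower K A A] [SMulCommClass K A A]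

/-- `A` is an infinite-dimensional algebra of coclass `r`: it is finitely generated and residually
nilpotent and the coclass of `A / A ^ i` tends to (so is eventually equal to) `r`. -/
structure HasInfCoclass (r : ℕ) : Prop where
  infinite : ¬ FiniteDimensional K A
  fg : ∃ s : Finset A, NonUnitalAlgebra.adjoin K (s : Set A) = ⊤
  residuallyNilpotent : ⨅ i : ℕ, algPow K A i = ⊥
  coclass : ∀ᶠ i in atTop, HasAlgCoclass K (powQuot K A i) r

end

/-! ### The algebras `M_{K,r}` -/

/-- `I_K`: the polynomials in one indeterminate with zero constant term. -/
noncomputable def polyIdeal (K : Type u) [Field K] : NonUnitalSubalgebra K K[X] where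
  carrier := {p | p.coeff 0 = 0}
  zero_mem' := by simp
  add_mem' := by
    intro p q (hp : p.coeff 0 = 0) (hq : q.coeff 0 = 0)
    show (p + q).coeff 0 = 0
    rw [coeff_add, hp, hq, add_zero]
  mul_mem' := by
    intro p q (hp : p.coeff 0 = 0) _
    show (p * q).coeff 0 = 0
    rw [mul_coeff_zero, hp, zero_mul]
  smul_mem' := by
    intro k p (hp : p.coeff 0 = 0)
    show (k • p).coeff 0 = 0
    rw [coeff_smul, hp, smul_zero]

/-- `L_K`: the one-dimensional algebra in which all products vanish. -/
def NullAlg (K : Type u) : Type u := K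

namespace NullAlg

variable (K : Type u) [Field K]

instance : AddCommGroup (NullAlg K) := inferInstanceAs (AddCommGroup K)
instance : Module K (NullAlg K) := inferInstanceAs (Module K K)

instance : NonUnitalRing (NullAlg K) :=
  { (inferInstance : AddCommGroup (NullAlg K)) with
    mul := fun _ _ => 0
    left_distrib := fun _ _ _ => (add_zero (0 : NullAlg K)).symm
    right_distrib := fun _ _ _ => (add_zero (0 : NullAlg K)).symm
    zero_mul := fun _ => rfl
    mul_zero := fun _ => rfl
    mul_assoc := fun _ _ _ => rfl }

instance : IsScalarTower K (NullAlg K) (NullAlg K) where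
  smul_assoc := fun k _ _ => (smul_zero k).symm

instance : SMulCommClass K (NullAlg K) (NullAlg K) where
  smul_comm := fun k _ _ => smul_zero k

end NullAlg

/-- `M_{K,r} = I_K ⊕ L_K ⊕ ⋯ ⊕ L_K` with `r` summands `L_K`. -/
abbrev AlgM (K : Type u) [Field K] (r : ℕ) : Type u := polyIdeal K × (Fin r → NullAlg K)

/-! ### Nilpotent semigroups and contracted semigroup algebras -/

/-- The power `S ^ n` of a semigroup, for `n ≥ 1`: the set of all products of `n` elements.
(By convention `S ^ 0 = S`.) -/
def sgpPow (S : Type v) [Mul S] : ℕ → Set S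
  | 0 => Set.univ
  | 1 => Set.univ
  | n + 2 => {z | ∃ x ∈ sgpPow S (n + 1), ∃ y : S, z = x * y}

/-- `S` is nilpotent: for some `c` all products of `c + 1` elements are zero. -/
def SgpNilpotent (S : Type v) [SemigroupWithZero S] : Prop := ∃ c : ℕ, sgpPow S (c + 1) = {0}

/-- The class of a nilpotent semigroup: the least `c` such that all products of `c + 1` elements
are zero. -/
noncomputable def sgpClass (S : Type v) [SemigroupWithZero S] : ℕ :=
  sInf {c : ℕ | sgpPow S (c + 1) = {0}}

/-- The ideal `U` of the semigroup algebra `K[S]` spanned by the zero element of `S`. -/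
noncomputable def zeroIdeal (K : Type u) (S : Type v) [Field K] [SemigroupWithZero S] :
    AlgIdeal K (MonoidAlgebra K S) where
  toSubmodule := Submodule.span K {MonoidAlgebra.single (0 : S) (1 : K)}
  mul_mem_left' := by
    intro a x hx
    obtain ⟨k, rfl⟩ := Submodule.mem_span_singleton.1 hx
    rw [mul_smul_comm]
    refine Submodule.smul_mem _ k ?_
    induction a using MonoidAlgebra.induction_linear with
    | zero => rw [zero_mul]; exact zero_mem _
    | add f g hf hg => rw [add_mul]; exact add_mem hf hg
    | single m c =>
      rw [MonoidAlgebra.single_mul_single, mul_zero, mul_one]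
      exact Submodule.mem_span_singleton.2 ⟨c, by simp [MonoidAlgebra.smul_single]⟩
  mul_mem_right' := by
    intro x a hx
    obtain ⟨k, rfl⟩ := Submodule.mem_span_singleton.1 hx
    rw [smul_mul_assoc]
    refine Submodule.smul_mem _ k ?_
    induction a using MonoidAlgebra.induction_linear with
    | zero => rw [mul_zero]; exact zero_mem _
    | add f g hf hg => rw [mul_add]; exact add_mem hf hg
    | single m c =>
      rw [MonoidAlgebra.single_mul_single, zero_mul, one_mul]
      exact Submodule.mem_span_singleton.2 ⟨c, by simp [MonoidAlgebra.smul_single]⟩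

/-- The contracted semigroup algebra `KS = K[S] / U`. -/
abbrev ContrAlg (K : Type u) (S : Type v) [Field K] [SemigroupWithZero S] : Type (max v u) :=
  (zeroIdeal K S).Quot

/-- `Z_n`: the zero semigroup with `n` elements. -/
def ZeroSgp (n : ℕ) : Type := Fin n

instance (n : ℕ) [NeZero n] : SemigroupWithZero (ZeroSgp n) where
  zero := (0 : Fin n)
  mul := fun _ _ => (0 : Fin n)
  mul_assoc := fun _ _ _ => rfl
  zero_mul := fun _ => rfl
  mul_zero := fun _ => rfl

end Algebras

/-! ### The graph `𝒢_{r,K}` -/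

/-- A finite nilpotent semigroup of coclass `r`, i.e. the number of its non-zero elements minus its
class is `r`. -/
structure NilSgp (r : ℕ) : Type 1 where
  carrier : Type
  [inst : SemigroupWithZero carrier]
  [finite : Finite carrier]
  nilpotent : SgpNilpotent carrier
  coclass : Nat.card {x : carrier // x ≠ 0} = sgpClass carrier + r

attribute [instance] NilSgp.inst NilSgp.finite

section Graph

universe u v

/-- Isomorphism of semigroups. -/
def sgpSetoid (r : ℕ) : Setoid (NilSgp r) where
  r S T := Nonempty (S.carrier ≃* T.carrier)
  iseqv :=
    { refl := fun _ => ⟨MulEquiv.refl _⟩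
      symm := fun ⟨e⟩ => ⟨e.symm⟩
      trans := fun ⟨e⟩ ⟨f⟩ => ⟨e.trans f⟩ }

/-- Isomorphism of the contracted semigroup algebras over `K`. -/
def algSetoid (K : Type u) [Field K] (r : ℕ) : Setoid (NilSgp r) where
  r S T := AlgIso K (ContrAlg K S.carrier) (ContrAlg K T.carrier)
  iseqv :=
    { refl := fun _ => ⟨NonUnitalAlgHom.id K _, Function.bijective_id⟩
      symm := by
        rintro S T ⟨f, hf⟩
        obtain ⟨g, hl, hr⟩ := Function.bijective_iff_has_inverse.1 hf
        exact ⟨f.inverse g hl hr, Function.bijective_iff_has_inverse.2 ⟨f, hr, hl⟩⟩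
      trans := by
        rintro S T U ⟨f, hf⟩ ⟨g, hg⟩
        exact ⟨g.comp f, hg.comp hf⟩ }

/-- The vertices of `𝒢_{r,K}`: the isomorphism types of algebras `KS`, where `S` is a nilpotent
semigroup of coclass `r`. -/
def Vertex (K : Type u) [Field K] (r : ℕ) : Type 1 := Quotient (algSetoid K r)

/-- The vertex given by (the isomorphism type of) `KS`. -/
def NilSgp.vertex {r : ℕ} (S : NilSgp r) (K : Type u) [Field K] : Vertex K r :=
  Quotient.mk (algSetoid K r) S

/-- The vertex `V` is the isomorphism type of the algebra `A`. -/
def Vertex.IsTypeOf {K : Type u} [Field K] {r : ℕ} (V : Vertex K r) (A : Type v)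
    [NonUnitalRing A] [Module K A] : Prop :=
  ∃ S : NilSgp r, S.vertex K = V ∧ AlgIso K A (ContrAlg K S.carrier)

/-- The directed edges `A → B` of `𝒢_{r,K}`: `B / B ^ c ≅ A`, where `c` is the class of `B`.
(The condition `0 < c` excludes the zero algebra `B`, for which `B ^ c` has no meaning; it arises
only for `r = 0`.) -/
def Edge (K : Type u) [Field K] (r : ℕ) (A B : Vertex K r) : Prop :=
  ∃ T : NilSgp r, T.vertex K = B ∧ 0 < algClass K (ContrAlg K T.carrier) ∧
    A.IsTypeOf (powQuot K (ContrAlg K T.carrier) (algClass K (ContrAlg K T.carrier)))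

/-- The label of a vertex `A`: the number of isomorphism types of semigroups `S` of coclass `r`
with `KS ≅ A`. -/
noncomputable def vertexLabel (K : Type u) [Field K] (r : ℕ) (A : Vertex K r) : ℕ∞ :=
  Set.encard {s : Quotient (sgpSetoid r) |
    ∃ S : NilSgp r, Quotient.mk (sgpSetoid r) S = s ∧ S.vertex K = A}

/-- The algebra `M` describes the infinite path `p` (that is `A_1 → A_2 → ⋯` with
`A_{j+1} = p j`) in `𝒢_{r,K}`: it is infinite-dimensional of coclass `r` and, `c` being the class
of `A_1`, it satisfies `M / M ^ (j + c) ≅ A_j` for all `j ≥ 1`. -/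
def DescribesPath (K : Type u) [Field K] (r : ℕ) (p : ℕ → Vertex K r) (M : Type v)
    [NonUnitalRing M] [Module K M] [IsScalarTower K M M] [SMulCommClass K M M] : Prop :=
  HasInfCoclass K M r ∧
    ∃ S : NilSgp r, S.vertex K = p 0 ∧
      ∀ j : ℕ, (p j).IsTypeOf (powQuot K M (j + 1 + algClass K (ContrAlg K S.carrier)))

end Graph

/-! ### Coclass trees and strong virtual periodicity

These notions are formulated for a directed graph with vertex set `V` and edge relation `E`.
Infinite paths `A_1 → A_2 → ⋯` are indexed from zero, that is as `p : ℕ → V` with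
`A_{i+1} = p i`. -/

section Trees

universe u

variable {V : Type u} (E : V → V → Prop)

/-- (The vertex set of) `𝒯(A)`: all vertices on paths starting at `A`. -/
def treeAt (A : V) : Set V := {B | Relation.ReflTransGen E A B}

/-- `A` has no parent. -/
def IsRootVertex (A : V) : Prop := ∀ B, ¬ E B A

/-- The whole graph is a rooted tree with root `A`. -/
structure IsRootedTree (A : V) : Prop where
  root : IsRootVertex E A
  reach : ∀ B, B ∈ treeAt E A
  parent_unique : ∀ B C D, E B D → E C D → B = C

/-- `p` is an infinite path. -/
def IsInfPath (p : ℕ → V) : Prop := ∀ i, E (p i) (p (i + 1))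

/-- `p` is a maximal infinite path of `𝒯(A)`: an infinite path starting at `A`. -/
def IsInfPathFrom (A : V) (p : ℕ → V) : Prop := p 0 = A ∧ IsInfPath E p

/-- `𝒯(A)` is a coclass tree: it contains a unique maximal infinite path. -/
def IsCoclassTree (A : V) : Prop := ∃! p : ℕ → V, IsInfPathFrom E A p

/-- `𝒯(A)` is a maximal coclass tree: a coclass tree such that `A` is a root of the graph or the
parent of `A` lies on more than one maximal infinite path of the graph. -/
def IsMaximalCoclassTree (A : V) : Prop :=
  IsCoclassTree E A ∧
    (IsRootVertex E A ∨
      ∃ P, E P A ∧ ∃ p q : ℕ → V, p ≠ q ∧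
        (IsRootVertex E (p 0) ∧ IsInfPath E p ∧ P ∈ Set.range p) ∧
        (IsRootVertex E (q 0) ∧ IsInfPath E q ∧ P ∈ Set.range q))

variable {E}

theorem IsInfPath.treeAt_subset {p : ℕ → V} (hp : IsInfPath E p) (n k : ℕ) :
    treeAt E (p (n + k)) ⊆ treeAt E (p n) := by
  induction k with
  | zero => exact subset_rfl
  | succ k ih => exact fun B hB => ih (Relation.ReflTransGen.head (hp (n + k)) hB)

/-- An isomorphism `μ : 𝒯(A_l) → 𝒯(A_{l+k})` of directed (unlabelled) graphs, viewed as a map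
from `𝒯(A_l)` to itself. Here `A_{n+1} = p n` and `l = n + 1`. -/
def IsInfPath.shift {p : ℕ → V} (hp : IsInfPath E p) (n k : ℕ)
    (μ : Subrel E (· ∈ treeAt E (p n)) ≃r Subrel E (· ∈ treeAt E (p (n + k)))) :
    treeAt E (p n) → treeAt E (p n) :=
  fun B => Set.inclusion (hp.treeAt_subset n k) (μ B)

/-- The graph isomorphism `μ : 𝒯(A_l) → 𝒯(A_{l+k})` and the rational polynomials `f B` witness that
the labelled tree with maximal infinite path `p` (where `A_{i+1} = p i`) is strongly virtually
periodic with strong defect `l` and strong period `k`: for every vertex `B` of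
`𝒯(A_l) ∖ 𝒯(A_{l+k})` and every `i ≥ 0` the label of `μ^i(B)` is `f B (i)`. -/
structure IsStrongPeriodicity (label : V → ℕ∞) {p : ℕ → V} (hp : IsInfPath E p) (l k : ℕ)
    (μ : Subrel E (· ∈ treeAt E (p (l - 1))) ≃r Subrel E (· ∈ treeAt E (p (l - 1 + k))))
    (f : V → ℚ[X]) : Prop where
  defect_pos : 0 < l
  period_pos : 0 < k
  label_eq : ∀ B : treeAt E (p (l - 1)), (B : V) ∉ treeAt E (p (l - 1 + k)) → ∀ i : ℕ,
    ∃ m : ℕ, label ((hp.shift (l - 1) k μ)^[i] B) = m ∧ (f B).eval (i : ℚ) = m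

end Trees

/-! Everything rests on one multiplication table. In a nilpotent semigroup `S` of coclass 1 call the
elements of `S^n` outside `S^(n+1)` the `n`-th layer. No layer up to the class `c` is empty and
there are `c + 1` non-zero elements, so the first layer has two elements `a`, `b` and every other
layer has one (`ncard_sgpLayer`). For `c ≥ 3` some square lies in the second layer
(`exists_mul_self_mem_sgpLayer`), and then the powers of that generator `a` exhaust all non-zero
elements except `b`. Hence `S` is given by `ab = a^(j+1)`, `ba = a^(k+1)`, `b² = a^(l+1)`, with
associativity conditions on `j`, `k`, `l` (`exists_paramSgp_mulEquiv`).

In `KS` replace `b` by `y = b - a^j`. Then `ay = 0`, while `ya` and `y²` are multiples `q`, `r` of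
the top power `a^c` (`ParamSgp.nonempty_normalForm`). Algebras with equal `c`, `q`, `r` are
isomorphic, and scaling `y` by `t` changes `(q, r)` into `(tq, t²r)`. The pairs that remain are
`(0,0)`, `(0,1)`, `(0,-1)`, `(1,0)`, `(1,1)`, the five values of `AlgKind`; `(0,-1)` arises only in
even class and merges with `(0,1)` if `-1` is a square. Otherwise they are distinct: commutativity
detects `q`, an annihilator condition detects `r = 0`, and `NormalForm.isSquare_neg_one` separates
`r = 1` from `r = -1` (`kindVertex_injective`).

Dividing by the top power kills `q` and `r`. So the parent of a vertex is the algebra with `q = r =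
0` of class one less (`edge_iff`), which is also a quotient of `M_{K,1}`. These algebras form the
only infinite path and all other vertices are leaves. Validity of the kinds depends on the class
only through its parity, which gives period two. In class two there are further algebras, but they
are leaves at the root, so the defect is two. A label counts the triples `(j, k, l)` of a given kind
(`vertexLabel_kindVertex`), and these counts are linear along each orbit of the shift. -/

/-! ### Powers of algebras and their behaviour under isomorphisms. -/

section AlgebraPowers

universe u v w

variable {K : Type u} {A : Type v} {B : Type w} [Field K]
  [NonUnitalRing A] [Module K A] [NonUnitalRing B] [Module K B]

theorem mul_mem_algPow_succ {n : ℕ} (hn : 1 ≤ n) {x : A} (hx : x ∈ algPow K A n) (y : A) :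
    x * y ∈ algPow K A (n + 1) := by
  obtain ⟨m, rfl⟩ := Nat.exists_eq_add_of_le' hn
  exact Submodule.subset_span ⟨x, hx, y, rfl⟩

theorem algPow_antitone : Antitone (algPow K A) :=
  antitone_nat_of_succ_le (algPow_succ_le K A)

theorem mul_mem_algPow_two (x y : A) : x * y ∈ algPow K A 2 :=
  mul_mem_algPow_succ le_rfl (Submodule.mem_top : x ∈ algPow K A 1) y

theorem mem_algPow_of_mul_eq {e : ℕ → A} (he : ∀ i j, e i * e j = e (i + j + 1)) (i : ℕ) :
    e i ∈ algPow K A (i + 1) := by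
  induction i with
  | zero => exact Submodule.mem_top
  | succ i ih =>
    have h := mul_mem_algPow_succ (by omega) ih (e 0)
    rwa [he] at h

/-- The induction starts at exponent 2 because the filtrations `tail` to which this is applied leave
out the second generator from the beginning, so they cannot contain `A^1 = A`. -/
theorem algPow_le_of_mul_mem {W : ℕ → Submodule K A} (h1 : ∀ x y : A, x * y ∈ W 2)
    (h : ∀ n, 2 ≤ n → ∀ x ∈ W n, ∀ y : A, x * y ∈ W (n + 1)) {n : ℕ} (hn : 2 ≤ n) :
    algPow K A n ≤ W n := by
  induction n, hn using Nat.le_induction with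
  | base =>
    refine Submodule.span_le.2 ?_
    rintro _ ⟨x, -, y, rfl⟩
    exact h1 x y
  | succ n hn ih =>
    obtain ⟨m, rfl⟩ := Nat.exists_eq_add_of_le' (show 1 ≤ n by omega)
    refine Submodule.span_le.2 ?_
    rintro _ ⟨x, hx, y, rfl⟩
    exact h _ hn x (ih hx) y

theorem map_algPow (f : A →ₙₐ[K] B) (hf : Function.Surjective f) (n : ℕ) :
    (algPow K A n).map (f : A →ₗ[K] B) = algPow K B n := by
  have htop : (⊤ : Submodule K A).map (f : A →ₗ[K] B) = ⊤ := by
    rw [Submodule.map_top]; exact LinearMap.range_eq_top.2 hf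
  induction n with
  | zero => exact htop
  | succ n ih =>
    cases n with
    | zero => exact htop
    | succ n =>
      simp only [algPow]
      rw [Submodule.map_span]
      congr 1
      ext z
      constructor
      · rintro ⟨_, ⟨x, hx, y, rfl⟩, rfl⟩
        refine ⟨f x, ?_, f y, map_mul f x y⟩
        rw [← ih]; exact Submodule.mem_map_of_mem hx
      · rintro ⟨x, hx, y, rfl⟩
        rw [← ih] at hx
        obtain ⟨x, hx, rfl⟩ := hx
        obtain ⟨y, rfl⟩ := hf y
        exact ⟨x * y, ⟨x, hx, y, rfl⟩, map_mul f x y⟩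

theorem AlgIso.symm (h : AlgIso K A B) : AlgIso K B A := by
  obtain ⟨f, hf⟩ := h
  obtain ⟨g, hl, hr⟩ := Function.bijective_iff_has_inverse.1 hf
  exact ⟨f.inverse g hl hr, Function.bijective_iff_has_inverse.2 ⟨f, hr, hl⟩⟩

theorem AlgIso.algClass_eq (h : AlgIso K A B) : algClass K A = algClass K B := by
  obtain ⟨f, hf⟩ := h
  unfold algClass
  congr 1
  ext c
  rw [Set.mem_ofPred_eq, Set.mem_ofPred_eq, ← map_algPow f hf.2]
  constructor
  · intro h; rw [h, Submodule.map_bot]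
  · intro h
    rw [Submodule.eq_bot_iff] at h ⊢
    intro x hx
    exact hf.1 ((h _ (Submodule.mem_map_of_mem hx)).trans (map_zero f).symm)

theorem algClass_eq_of_algPow {c : ℕ} (h : algPow K A (c + 1) = ⊥)
    (h' : algPow K A c ≠ ⊥) : algClass K A = c := by
  refine le_antisymm (Nat.sInf_le h) (le_csInf ⟨c, h⟩ ?_)
  intro d hd
  by_contra! hlt
  exact h' (eq_bot_iff.2 (hd ▸ algPow_antitone (by omega : d + 1 ≤ c)))

end AlgebraPowers

/-! ### The multiplication table with parameters `c`, `q`, `r`, and its uniqueness. -/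

section NormalForms

universe u v w

/-- A basis `e 0, …, e (c - 1), y` of the algebra `A`, where `e i` is the power with exponent
`i + 1` of `e 0`, with `e 0 * y = 0`, `y * e 0 = q • e (c - 1)` and `y * y = r • e (c - 1)`,
together with its coordinate functionals. -/
structure NormalForm (K : Type u) (A : Type v) [Field K] [NonUnitalRing A] [Module K A]
    (c : ℕ) (q r : K) where
  e : ℕ → A
  y : A
  coord : ℕ → A →ₗ[K] K
  coordY : A →ₗ[K] K
  one_le : 1 ≤ c
  -- For `c = 1` the element `e (c - 1)` is the generator `e 0`, so a non-zero product with `y`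
  -- would spoil nilpotency of class one.
  eq_zero_of_eq_one : c = 1 → q = 0 ∧ r = 0
  mul_e : ∀ i j, e i * e j = e (i + j + 1)
  e_eq_zero : ∀ i, c ≤ i → e i = 0
  e_mul_y : e 0 * y = 0
  y_mul_e : y * e 0 = q • e (c - 1)
  y_mul_y : y * y = r • e (c - 1)
  coord_e : ∀ i j, i < c → coord i (e j) = if i = j then 1 else 0
  coord_y : ∀ i, i < c → coord i y = 0
  coordY_e : ∀ j, coordY (e j) = 0
  coordY_y : coordY y = 1
  expand : ∀ x, x = ∑ i ∈ Finset.range c, coord i x • e i + coordY x • y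

namespace NormalForm

variable {K : Type u} {A : Type v} {B : Type w} [Field K]
  [NonUnitalRing A] [Module K A] [NonUnitalRing B] [Module K B]
  {c : ℕ} {q r : K}

theorem induction (N : NormalForm K A c q r) {p : A → Prop} (he : ∀ i, p (N.e i)) (hy : p N.y)
    (hadd : ∀ x z, p x → p z → p (x + z)) (hsmul : ∀ (k : K) x, p x → p (k • x)) (x : A) :
    p x := by
  have h0 : p 0 := by simpa using hsmul 0 _ hy
  rw [N.expand x]
  refine hadd _ _ ?_ (hsmul _ _ hy)
  exact Finset.sum_induction _ p hadd h0 fun i _ => hsmul _ _ (he i)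

theorem ext_coord (N : NormalForm K A c q r) {x z : A} (h : ∀ i, i < c → N.coord i x = N.coord i z)
    (hY : N.coordY x = N.coordY z) : x = z := by
  rw [N.expand x, N.expand z, hY]
  congr 1
  exact Finset.sum_congr rfl fun i hi => by rw [h i (Finset.mem_range.1 hi)]

/-- Valid for all `j`, since both sides vanish once `c ≤ j`. This allows `e` to be indexed by all of
`ℕ`. -/
theorem sum_coord_e (N : NormalForm K A c q r) {M : Type*} [AddCommGroup M] [Module K M]
    (f : ℕ → M) (hf : ∀ i, c ≤ i → f i = 0) (j : ℕ) :
    ∑ i ∈ Finset.range c, N.coord i (N.e j) • f i = f j := by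
  have h : ∀ i ∈ Finset.range c, N.coord i (N.e j) • f i = if i = j then f i else 0 := by
    intro i hi
    rw [N.coord_e i j (Finset.mem_range.1 hi)]
    split_ifs <;> simp
  rw [Finset.sum_congr rfl h, Finset.sum_ite_eq']
  split_ifs with hj
  · rfl
  · exact (hf j (by simpa using hj)).symm

theorem e_ne_zero (N : NormalForm K A c q r) {i : ℕ} (hi : i < c) : N.e i ≠ 0 := by
  intro h
  have := N.coord_e i i hi
  rw [h, map_zero, if_pos rfl] at this
  exact zero_ne_one this

/-- The linear map that carries the basis of one normal form to that of another one. -/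
noncomputable def toLinear (N : NormalForm K A c q r) (N' : NormalForm K B c q r) : A →ₗ[K] B :=
  ∑ i ∈ Finset.range c, (N.coord i).smulRight (N'.e i) + N.coordY.smulRight N'.y

theorem toLinear_e (N : NormalForm K A c q r) (N' : NormalForm K B c q r) (j : ℕ) :
    N.toLinear N' (N.e j) = N'.e j := by
  simp only [toLinear, LinearMap.add_apply, LinearMap.sum_apply, LinearMap.smulRight_apply,
    N.coordY_e, zero_smul, add_zero]
  exact N.sum_coord_e N'.e N'.e_eq_zero j

theorem toLinear_y (N : NormalForm K A c q r) (N' : NormalForm K B c q r) :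
    N.toLinear N' N.y = N'.y := by
  simp only [toLinear, LinearMap.add_apply, LinearMap.sum_apply, LinearMap.smulRight_apply,
    N.coordY_y, one_smul]
  rw [Finset.sum_eq_zero, zero_add]
  intro i hi
  rw [N.coord_y i (Finset.mem_range.1 hi), zero_smul]

theorem toLinear_toLinear (N : NormalForm K A c q r) (N' : NormalForm K B c q r) (x : A) :
    N'.toLinear N (N.toLinear N' x) = x := by
  induction x using N.induction with
  | he i => rw [toLinear_e, toLinear_e]
  | hy => rw [toLinear_y, toLinear_y]
  | hadd x z hx hz => rw [map_add, map_add, hx, hz]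
  | hsmul k x hx => rw [map_smul, map_smul, hx]

theorem e_mul_y' (N : NormalForm K A c q r) (i : ℕ) : N.e i * N.y = 0 := by
  cases i with
  | zero => exact N.e_mul_y
  | succ i =>
    have h := N.mul_e i 0
    rw [add_zero] at h
    rw [← h, mul_assoc, N.e_mul_y, mul_zero]

theorem of_algIso (N : NormalForm K A c q r) (h : AlgIso K A B) :
    Nonempty (NormalForm K B c q r) := by
  obtain ⟨f, hf⟩ := h
  let E : A ≃ₗ[K] B := LinearEquiv.ofBijective (f : A →ₗ[K] B) hf
  have hE : ∀ x, E x = f x := fun _ => rfl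
  have hE' : ∀ x, E.symm (f x) = x := fun x => E.symm_apply_apply x
  refine ⟨⟨fun i => f (N.e i), f N.y, fun i => N.coord i ∘ₗ E.symm.toLinearMap,
    N.coordY ∘ₗ E.symm.toLinearMap, N.one_le, N.eq_zero_of_eq_one, ?_, ?_, ?_, ?_, ?_, ?_, ?_, ?_,
    ?_, ?_⟩⟩
  · intro i j; rw [← map_mul, N.mul_e]
  · intro i hi; rw [N.e_eq_zero i hi, map_zero]
  · rw [← map_mul, N.e_mul_y, map_zero]
  · rw [← map_mul, N.y_mul_e, map_smul]
  · rw [← map_mul, N.y_mul_y, map_smul]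
  · intro i j hi; simpa [hE'] using N.coord_e i j hi
  · intro i hi; simpa [hE'] using N.coord_y i hi
  · intro j; simpa [hE'] using N.coordY_e j
  · simpa [hE'] using N.coordY_y
  · intro x
    obtain ⟨x, rfl⟩ := hf.2 x
    conv_lhs => rw [N.expand x]
    simp [hE', map_add, map_sum, map_smul]

variable [IsScalarTower K A A]

/-- `y * e 0` is already a multiple of the top power, so one more factor `e i` kills it. -/
theorem y_mul_e_succ (N : NormalForm K A c q r) (i : ℕ) : N.y * N.e (i + 1) = 0 := by
  have h := N.mul_e 0 i
  rw [zero_add] at h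
  rw [← h, ← mul_assoc, N.y_mul_e, smul_mul_assoc, N.mul_e, N.e_eq_zero _ (by omega), smul_zero]

variable [SMulCommClass K A A] [IsScalarTower K B B] [SMulCommClass K B B]

theorem toLinear_mul (N : NormalForm K A c q r) (N' : NormalForm K B c q r) (x z : A) :
    N.toLinear N' (x * z) = N.toLinear N' x * N.toLinear N' z := by
  induction x using N.induction with
  | hadd x x' hx hx' => rw [add_mul, map_add, map_add, add_mul, hx, hx']
  | hsmul k x hx => rw [smul_mul_assoc, map_smul, map_smul, smul_mul_assoc, hx]
  | he i =>
    induction z using N.induction with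
    | hadd z z' hz hz' => rw [mul_add, map_add, map_add, mul_add, hz, hz']
    | hsmul k z hz => rw [mul_smul_comm, map_smul, map_smul, mul_smul_comm, hz]
    | he j => rw [N.mul_e, toLinear_e, toLinear_e, toLinear_e, N'.mul_e]
    | hy => rw [N.e_mul_y', toLinear_e, toLinear_y, N'.e_mul_y', map_zero]
  | hy =>
    induction z using N.induction with
    | hadd z z' hz hz' => rw [mul_add, map_add, map_add, mul_add, hz, hz']
    | hsmul k z hz => rw [mul_smul_comm, map_smul, map_smul, mul_smul_comm, hz]
    | he j =>
      rw [toLinear_e, toLinear_y]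
      cases j with
      | zero => rw [N.y_mul_e, N'.y_mul_e, map_smul, toLinear_e]
      | succ j => rw [N.y_mul_e_succ, N'.y_mul_e_succ, map_zero]
    | hy => rw [N.y_mul_y, map_smul, toLinear_e, toLinear_y, N'.y_mul_y]

/-- All products of basis vectors are determined by `c`, `q`, `r`, so matching the two bases
respects multiplication. All identifications of isomorphism types go through this. -/
theorem algIso (N : NormalForm K A c q r) (N' : NormalForm K B c q r) : AlgIso K A B :=
  ⟨{ toFun := N.toLinear N'
     map_smul' := map_smul _
     map_zero' := map_zero _
     map_add' := map_add _
     map_mul' := N.toLinear_mul N' },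
    Function.bijective_iff_has_inverse.2
      ⟨N'.toLinear N, N.toLinear_toLinear N', N'.toLinear_toLinear N⟩⟩

/-- Replacing `y` by a non-zero multiple. -/
def scale (N : NormalForm K A c q r) (t : K) (ht : t ≠ 0) :
    NormalForm K A c (t * q) (t ^ 2 * r) where
  e := N.e
  y := t • N.y
  coord := N.coord
  coordY := t⁻¹ • N.coordY
  one_le := N.one_le
  eq_zero_of_eq_one h := by
    obtain ⟨rfl, rfl⟩ := N.eq_zero_of_eq_one h
    simp
  mul_e := N.mul_e
  e_eq_zero := N.e_eq_zero
  e_mul_y := by rw [mul_smul_comm, N.e_mul_y, smul_zero]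
  y_mul_e := by rw [smul_mul_assoc, N.y_mul_e, smul_smul]
  y_mul_y := by rw [smul_mul_assoc, mul_smul_comm, N.y_mul_y, smul_smul, smul_smul]; ring_nf
  coord_e := N.coord_e
  coord_y i hi := by rw [map_smul, N.coord_y i hi, smul_zero]
  coordY_e j := by rw [LinearMap.smul_apply, N.coordY_e, smul_zero]
  coordY_y := by
    rw [LinearMap.smul_apply, map_smul, N.coordY_y, smul_eq_mul, smul_eq_mul, mul_one,
      inv_mul_cancel₀ ht]
  expand x := by
    rw [LinearMap.smul_apply, smul_smul, smul_eq_mul, mul_assoc, mul_comm (N.coordY x), ← mul_assoc,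
      inv_mul_cancel₀ ht, one_mul]
    exact N.expand x

end NormalForm

end NormalForms

/-! ### Dimension, powers and isomorphism invariants read off the normal form. -/

namespace NormalForm

universe u v w

variable {K : Type u} {A : Type v} [Field K] [NonUnitalRing A] [Module K A] {c : ℕ} {q r : K}

theorem finiteDimensional_and_finrank (N : NormalForm K A c q r) :
    FiniteDimensional K A ∧ Module.finrank K A = c + 1 := by
  let E : A →ₗ[K] (Fin c → K) × K := (LinearMap.pi fun i : Fin c => N.coord i).prod N.coordY
  have hE : Function.Bijective E := by
    constructor
    · intro x z h
      obtain ⟨h1, h2⟩ := Prod.mk.injEq .. ▸ h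
      exact N.ext_coord (fun i hi => congrFun h1 ⟨i, hi⟩) h2
    · rintro ⟨f, t⟩
      refine ⟨∑ j : Fin c, f j • N.e j + t • N.y, Prod.ext (funext fun i => ?_) ?_⟩
      · show N.coord i _ = f i
        rw [map_add, map_smul, N.coord_y i i.2, smul_zero, add_zero, map_sum,
          Finset.sum_eq_single i]
        · rw [map_smul, N.coord_e i i i.2, if_pos rfl, smul_eq_mul, mul_one]
        · intro j _ hj
          rw [map_smul, N.coord_e i j i.2, if_neg (fun h => hj (Fin.ext h.symm)), smul_zero]
        · simp
      · show N.coordY _ = t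
        rw [map_add, map_smul, N.coordY_y, map_sum, Finset.sum_eq_zero, zero_add, smul_eq_mul,
          mul_one]
        intro j _
        rw [map_smul, N.coordY_e, smul_zero]
  let F := LinearEquiv.ofBijective E hE
  exact ⟨Module.Finite.equiv F.symm, by rw [F.finrank_eq]; simp⟩

/-- The elements whose coordinates at `y` and at `e i`, `i + 1 < n`, vanish. -/
def tail (N : NormalForm K A c q r) (n : ℕ) : Submodule K A where
  carrier := {x | (∀ i, i < c → i + 1 < n → N.coord i x = 0) ∧ N.coordY x = 0}
  zero_mem' := ⟨fun _ _ _ => map_zero _, map_zero _⟩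
  add_mem' := by
    rintro x z ⟨hx, hx'⟩ ⟨hz, hz'⟩
    exact ⟨fun i h1 h2 => by rw [map_add, hx i h1 h2, hz i h1 h2, add_zero],
      by rw [map_add, hx', hz', add_zero]⟩
  smul_mem' := by
    rintro k x ⟨hx, hx'⟩
    exact ⟨fun i h1 h2 => by rw [map_smul, hx i h1 h2, smul_zero], by rw [map_smul, hx', smul_zero]⟩

theorem e_mem_tail (N : NormalForm K A c q r) {n i : ℕ} (h : n ≤ i + 1) : N.e i ∈ N.tail n :=
  ⟨fun j hj hjn => by rw [N.coord_e j i hj, if_neg (by omega)], N.coordY_e i⟩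

/-- The top power lies in the square only if `c ≥ 2`; for `c = 1` the coefficient has to vanish. -/
theorem smul_e_mem_tail_two (N : NormalForm K A c q r) {t : K} (h : c = 1 → t = 0) :
    t • N.e (c - 1) ∈ N.tail 2 := by
  have := N.one_le
  by_cases hc : c = 1
  · rw [h hc, zero_smul]; exact zero_mem _
  · exact Submodule.smul_mem _ _ (N.e_mem_tail (by omega))

variable [SMulCommClass K A A]

theorem e_mul_mem_tail (N : NormalForm K A c q r) (i : ℕ) (z : A) :
    N.e i * z ∈ N.tail (i + 2) := by
  induction z using N.induction with
  | hadd z z' hz hz' => rw [mul_add]; exact add_mem hz hz'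
  | hsmul k z hz => rw [mul_smul_comm]; exact Submodule.smul_mem _ _ hz
  | he j => rw [N.mul_e]; exact N.e_mem_tail (by omega)
  | hy => rw [N.e_mul_y']; exact zero_mem _

/-- Left multiplication by `e 0` shifts the powers by one place and kills `y`. Hence `e 0 * z`
determines every coordinate of `z` except the last one and the one at `y`. -/
theorem coord_e_mul (N : NormalForm K A c q r) (z : A) {i : ℕ} (hi : i + 1 < c) :
    N.coord (i + 1) (N.e 0 * z) = N.coord i z := by
  induction z using N.induction with
  | hadd z z' hz hz' => rw [mul_add, map_add, map_add, hz, hz']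
  | hsmul k z hz => rw [mul_smul_comm, map_smul, map_smul, hz]
  | he j =>
    rw [N.mul_e, N.coord_e _ _ hi, N.coord_e _ _ (by omega)]
    congr 1
    exact propext ⟨fun h => by omega, fun h => by omega⟩
  | hy => rw [N.e_mul_y, N.coord_y _ (by omega), map_zero]

variable [IsScalarTower K A A]

theorem mul_mem_tail_two (N : NormalForm K A c q r) (x z : A) : x * z ∈ N.tail 2 := by
  induction x using N.induction with
  | hadd x x' hx hx' => rw [add_mul]; exact add_mem hx hx'
  | hsmul k x hx => rw [smul_mul_assoc]; exact Submodule.smul_mem _ _ hx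
  | he i =>
    have h := N.e_mul_mem_tail i z
    exact ⟨fun j h1 h2 => h.1 j h1 (by omega), h.2⟩
  | hy =>
    induction z using N.induction with
    | hadd z z' hz hz' => rw [mul_add]; exact add_mem hz hz'
    | hsmul k z hz => rw [mul_smul_comm]; exact Submodule.smul_mem _ _ hz
    | he j =>
      cases j with
      | zero => rw [N.y_mul_e]; exact N.smul_e_mem_tail_two fun h => (N.eq_zero_of_eq_one h).1
      | succ j => rw [N.y_mul_e_succ]; exact zero_mem _
    | hy => rw [N.y_mul_y]; exact N.smul_e_mem_tail_two fun h => (N.eq_zero_of_eq_one h).2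

/-- Products have no `y`-component, and multiplying `e i` on the right by anything raises the index;
this bounds the power from above. Conversely `e i` is itself a product of `i + 1` factors. -/
theorem algPow_eq (N : NormalForm K A c q r) {n : ℕ} (hn : 2 ≤ n) : algPow K A n = N.tail n := by
  refine le_antisymm (algPow_le_of_mul_mem N.mul_mem_tail_two ?_ hn) ?_
  · rintro n hn x ⟨hx, hx'⟩ z
    rw [N.expand x, hx', zero_smul, add_zero, Finset.sum_mul]
    refine sum_mem fun i hi => ?_
    rw [smul_mul_assoc]
    have hi := Finset.mem_range.1 hi
    by_cases h : i + 1 < n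
    · rw [hx i hi h, zero_smul]; exact zero_mem _
    · have h' := N.e_mul_mem_tail i z
      exact Submodule.smul_mem _ _ ⟨fun j h1 h2 => h'.1 j h1 (by omega), h'.2⟩
  · rintro x ⟨hx, hx'⟩
    rw [N.expand x, hx', zero_smul, add_zero]
    refine sum_mem fun i hi => ?_
    have hi := Finset.mem_range.1 hi
    by_cases h : i + 1 < n
    · rw [hx i hi h, zero_smul]; exact zero_mem _
    · exact Submodule.smul_mem _ _
        (algPow_antitone (by omega : n ≤ i + 1) (mem_algPow_of_mul_eq N.mul_e i))

theorem algPow_eq_bot (N : NormalForm K A c q r) : algPow K A (c + 1) = ⊥ := by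
  have := N.one_le
  rw [N.algPow_eq (by omega), eq_bot_iff]
  rintro x ⟨hx, hx'⟩
  exact N.ext_coord (fun i hi => by rw [hx i hi (by omega), map_zero]) (by rw [hx', map_zero])

theorem algClass_eq (N : NormalForm K A c q r) : algClass K A = c := by
  have := N.one_le
  refine algClass_eq_of_algPow N.algPow_eq_bot fun h => ?_
  have h' := mem_algPow_of_mul_eq (K := K) N.mul_e (c - 1)
  rw [show c - 1 + 1 = c by omega, h] at h'
  exact N.e_ne_zero (by omega) h'

theorem hasAlgCoclass (N : NormalForm K A c q r) : HasAlgCoclass K A 1 :=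
  ⟨N.finiteDimensional_and_finrank.1, ⟨c, N.algPow_eq_bot⟩,
    by rw [N.finiteDimensional_and_finrank.2, N.algClass_eq]⟩

/-- The only basis vectors that may fail to commute are `y` and `e 0`, and their commutator is `q •
e (c - 1)`. -/
theorem q_eq_zero_iff (N : NormalForm K A c q r) : q = 0 ↔ ∀ x z : A, x * z = z * x := by
  have := N.one_le
  constructor
  · rintro rfl x z
    have hy : ∀ j, N.y * N.e j = 0 := by
      rintro (_ | j)
      · rw [N.y_mul_e, zero_smul]
      · exact N.y_mul_e_succ j
    induction x using N.induction with
    | hadd x x' hx hx' => rw [add_mul, mul_add, hx, hx']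
    | hsmul k x hx => rw [smul_mul_assoc, mul_smul_comm, hx]
    | he i =>
      induction z using N.induction with
      | hadd z z' hz hz' => rw [add_mul, mul_add, hz, hz']
      | hsmul k z hz => rw [smul_mul_assoc, mul_smul_comm, hz]
      | he j => rw [N.mul_e, N.mul_e, add_comm i j]
      | hy => rw [hy, N.e_mul_y']
    | hy =>
      induction z using N.induction with
      | hadd z z' hz hz' => rw [add_mul, mul_add, hz, hz']
      | hsmul k z hz => rw [smul_mul_assoc, mul_smul_comm, hz]
      | he j => rw [hy, N.e_mul_y']
      | hy => rfl
  · intro h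
    have h' := h N.y (N.e 0)
    rw [N.y_mul_e, N.e_mul_y] at h'
    exact (smul_eq_zero.1 h').resolve_right (N.e_ne_zero (by omega))

theorem coord_y_mul (N : NormalForm K A c q r) (z : A) :
    N.y * z = (q * N.coord 0 z + r * N.coordY z) • N.e (c - 1) := by
  have := N.one_le
  induction z using N.induction with
  | hadd z z' hz hz' => rw [mul_add, map_add, map_add, hz, hz', ← add_smul]; ring_nf
  | hsmul k z hz =>
    rw [mul_smul_comm, hz, smul_smul, map_smul, map_smul, smul_eq_mul, smul_eq_mul]; ring_nf
  | he j =>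
    rw [N.coordY_e, N.coord_e _ _ (by omega)]
    cases j with
    | zero => rw [N.y_mul_e]; simp
    | succ j => rw [N.y_mul_e_succ]; simp
  | hy => rw [N.coord_y _ (by omega), N.coordY_y, N.y_mul_y]; simp

/-- For `r = 0` the witness is `y`. Conversely, `e 0 * z = 0` leaves in `z` only the top power and a
multiple of `y`; then `y * z = 0` with `r ≠ 0` removes the latter, so `z` would lie in the square.
-/
theorem r_eq_zero_iff (N : NormalForm K A c q r) (hc : 2 ≤ c) :
    r = 0 ↔ ∃ z : A, z ∉ algPow K A 2 ∧ ∀ x, x * z = 0 := by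
  constructor
  · rintro rfl
    refine ⟨N.y, ?_, fun x => ?_⟩
    · rw [N.algPow_eq le_rfl]
      rintro ⟨-, h⟩
      rw [N.coordY_y] at h
      exact one_ne_zero h
    · induction x using N.induction with
      | hadd x x' hx hx' => rw [add_mul, hx, hx', add_zero]
      | hsmul k x hx => rw [smul_mul_assoc, hx, smul_zero]
      | he i => exact N.e_mul_y' i
      | hy => rw [N.y_mul_y, zero_smul]
  · rintro ⟨z, hz, h⟩
    by_contra hr
    have h0 : ∀ i, i + 1 < c → N.coord i z = 0 := by
      intro i hi
      rw [← N.coord_e_mul z hi, h, map_zero]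
    have h1 := h N.y
    rw [N.coord_y_mul, h0 0 (by omega), mul_zero, zero_add] at h1
    have h2 := (mul_eq_zero.1 ((smul_eq_zero.1 h1).resolve_right
      (N.e_ne_zero (by omega)))).resolve_left hr
    rw [N.algPow_eq le_rfl] at hz
    exact hz ⟨fun i _ hi => h0 i (by omega), h2⟩

/-- The square of an element `α • e (i) + …` of `A ^ m`, where `c = 2 * m`. -/
theorem mul_self_of_mem_tail (N : NormalForm K A c q r) {m : ℕ} (hm : 1 ≤ m) (hc : c = 2 * m)
    {u : A} (hu : u ∈ N.tail m) (hu' : N.coordY u = 0) :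
    u * u = N.coord (m - 1) u ^ 2 • N.e (c - 1) := by
  have key : ∀ z ∈ N.tail (m + 1), ∀ x ∈ N.tail m, x * z = 0 ∧ z * x = 0 := by
    have hee : ∀ i j, m ≤ i + 1 → m + 1 ≤ j + 1 → N.e i * N.e j = 0 ∧ N.e j * N.e i = 0 :=
      fun i j hi hj => by
        rw [N.mul_e, N.mul_e, N.e_eq_zero _ (by omega), N.e_eq_zero _ (by omega)]; simp
    have hx : ∀ n, ∀ x ∈ N.tail n,
        x ∈ Submodule.span K {w | ∃ i, n ≤ i + 1 ∧ w = N.e i} := by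
      rintro n x ⟨hx, hx'⟩
      rw [N.expand x, hx', zero_smul, add_zero]
      refine sum_mem fun i hi => ?_
      by_cases h : i + 1 < n
      · rw [hx i (Finset.mem_range.1 hi) h, zero_smul]; exact zero_mem _
      · exact Submodule.smul_mem _ _ (Submodule.subset_span ⟨i, by omega, rfl⟩)
    intro z hz x hx1
    replace hz := hx _ z hz
    replace hx1 := hx _ x hx1
    induction hz using Submodule.span_induction with
    | zero => simp
    | add z z' _ _ hz hz' => rw [mul_add, add_mul, hz.1, hz.2, hz'.1, hz'.2]; simp
    | smul k z _ hz => rw [mul_smul_comm, smul_mul_assoc, hz.1, hz.2]; simp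
    | mem z hz =>
      obtain ⟨j, hj, rfl⟩ := hz
      induction hx1 using Submodule.span_induction with
      | zero => simp
      | add z z' _ _ hz hz' => rw [mul_add, add_mul, hz.1, hz.2, hz'.1, hz'.2]; simp
      | smul k z _ hz => rw [mul_smul_comm, smul_mul_assoc, hz.1, hz.2]; simp
      | mem z hz =>
        obtain ⟨i, hi, rfl⟩ := hz
        exact hee i j hi hj
  obtain ⟨w, hw⟩ : ∃ w, w = u - N.coord (m - 1) u • N.e (m - 1) := ⟨_, rfl⟩
  have hw' : w ∈ N.tail (m + 1) := by
    rw [hw]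
    refine ⟨fun i hi hin => ?_, ?_⟩
    · rw [map_sub, map_smul, N.coord_e i _ hi]
      split_ifs with h
      · rw [h]; simp
      · rw [hu.1 i hi (by omega)]; simp
    · rw [map_sub, map_smul, N.coordY_e, hu']; simp
  have hu2 : u = N.coord (m - 1) u • N.e (m - 1) + w := by rw [hw]; abel
  have h1 := (key w hw' u hu).1
  have h2 := (key w hw' (N.e (m - 1)) (N.e_mem_tail (by omega))).2
  calc u * u = u * (N.coord (m - 1) u • N.e (m - 1)) + u * w := by rw [← mul_add, ← hu2]
    _ = (N.coord (m - 1) u • N.e (m - 1) + w) * (N.coord (m - 1) u • N.e (m - 1)) := by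
      rw [h1, add_zero, ← hu2]
    _ = _ := by
      rw [add_mul, mul_smul_comm _ w, h2, smul_zero, add_zero, smul_mul_assoc, mul_smul_comm,
        N.mul_e, smul_smul, show m - 1 + (m - 1) + 1 = c - 1 by omega, sq]

/-- In the first form the top power is both `y²` and the square of the middle power `u` in `A^m`.
Rewritten in the second form, `y` is `t` times the second `y`, with `t ≠ 0`, plus terms that do not
contribute to its square. So `y²` has coefficient `-t²` at the top power, whereas `u²` has
coefficient `α²`; hence `-1 = (α / t)²`. -/
theorem isSquare_neg_one (N : NormalForm K A c q 1) {q' : K} (N' : NormalForm K A c q' (-1))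
    {m : ℕ} (hm : 2 ≤ m) (hc : c = 2 * m) : IsSquare (-1 : K) := by
  have hyy : N.y * N.y = N.e (m - 1) * N.e (m - 1) := by
    rw [N.y_mul_y, one_smul, N.mul_e]; congr 1; omega
  have hy2 : N.y ∉ N'.tail 2 := by
    rw [← N'.algPow_eq le_rfl, N.algPow_eq le_rfl]
    rintro ⟨-, h⟩
    rw [N.coordY_y] at h
    exact one_ne_zero h
  have hye : N'.e 0 * N.y ∈ N'.tail c := by
    rw [← N'.algPow_eq (by omega), N.algPow_eq (by omega)]
    induction N'.e 0 using N.induction with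
    | hadd x x' hx hx' => rw [add_mul]; exact add_mem hx hx'
    | hsmul k x hx => rw [smul_mul_assoc]; exact Submodule.smul_mem _ _ hx
    | he i => rw [N.e_mul_y']; exact zero_mem _
    | hy => rw [N.y_mul_y]; exact Submodule.smul_mem _ _ (N.e_mem_tail (by omega))
  have hu : N.e (m - 1) ∈ N'.tail m := by
    rw [← N'.algPow_eq hm, N.algPow_eq hm]; exact N.e_mem_tail (by omega)
  generalize N.y = z at hyy hy2 hye
  generalize N.e (m - 1) = u at hyy hu
  rw [N'.mul_self_of_mem_tail (by omega) hc hu hu.2] at hyy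
  -- The first form gives `A * y ⊆ A^c`, a statement independent of the basis; applied to the second
  -- `e 0` it clears all coordinates of `z` below the last two powers.
  have h0 : ∀ i, i + 2 < c → N'.coord i z = 0 := by
    intro i hi
    rw [← N'.coord_e_mul z (by omega)]
    exact hye.1 _ (by omega) (by omega)
  have hY : N'.coordY z ≠ 0 := fun h => hy2 ⟨fun i _ hi => h0 i (by omega), h⟩
  have hw : ∃ w, z = w + N'.coordY z • N'.y ∧ w ∈ N'.tail (m + 1) := by
    refine ⟨_, N'.expand z, ?_⟩
    refine sum_mem fun i hi => ?_
    by_cases h : i + 2 < c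
    · rw [h0 i h, zero_smul]; exact zero_mem _
    · exact Submodule.smul_mem _ _ (N'.e_mem_tail (by omega))
  obtain ⟨w, hw, hw'⟩ := hw
  have hyw : N'.y * w = 0 := by
    rw [N'.coord_y_mul, hw'.1 0 (by omega) (by omega), hw'.2]; simp
  have hwy : w * N'.y = 0 := by
    rw [N'.expand w, hw'.2, zero_smul, add_zero, Finset.sum_mul, Finset.sum_eq_zero]
    intro i _
    rw [smul_mul_assoc, N'.e_mul_y', smul_zero]
  have hww : w * w = 0 := by
    have hwm : w ∈ N'.tail m := ⟨fun i h1 h2 => hw'.1 i h1 (by omega), hw'.2⟩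
    rw [N'.mul_self_of_mem_tail (by omega) hc hwm hw'.2, hw'.1 (m - 1) (by omega) (by omega)]
    simp
  have hzz : z * z = -(N'.coordY z ^ 2) • N'.e (c - 1) := by
    generalize N'.coordY z = t at hw
    rw [hw, add_mul, mul_add, mul_add, hww, mul_smul_comm, hwy, smul_mul_assoc, smul_mul_assoc, hyw,
      mul_smul_comm, N'.y_mul_y]
    simp only [smul_zero, zero_add, smul_smul]
    ring_nf
  rw [hzz] at hyy
  have h := smul_left_injective K (N'.e_ne_zero (by omega : c - 1 < c)) hyy
  refine ⟨N'.coord (m - 1) u / N'.coordY z, ?_⟩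
  field_simp
  exact h

end NormalForm

/-! ### Normal forms of quotients by powers. -/

section Quotients

universe u v

variable {K : Type u} {A : Type v} [Field K] [NonUnitalRing A] [Module K A]
  [SMulCommClass K A A]

/-- The table only has to hold modulo `A^(n+1)`, and the functionals only have to vanish there. One
criterion thus covers quotients of normal forms, of `M_{K,1}`, and of contracted algebras by their
square. -/
theorem nonempty_normalForm_powQuot {n : ℕ} (hn : 1 ≤ n) (e : ℕ → A) (y : A)
    (φ : ℕ → A →ₗ[K] K) (ψ : A →ₗ[K] K) (mul_e : ∀ i j, e i * e j = e (i + j + 1))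
    (hey : e 0 * y ∈ algPow K A (n + 1)) (hye : y * e 0 ∈ algPow K A (n + 1))
    (hyy : y * y ∈ algPow K A (n + 1))
    (hφe : ∀ i j, i < n → j < n → φ i (e j) = if i = j then 1 else 0)
    (hφy : ∀ i, i < n → φ i y = 0) (hψe : ∀ j, j < n → ψ (e j) = 0) (hψy : ψ y = 1)
    (hφ : ∀ i, i < n → ∀ x ∈ algPow K A (n + 1), φ i x = 0)
    (hψ : ∀ x ∈ algPow K A (n + 1), ψ x = 0)
    (hx : ∀ x, x - (∑ i ∈ Finset.range n, φ i x • e i + ψ x • y) ∈ algPow K A (n + 1)) :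
    Nonempty (NormalForm K (powQuot K A (n + 1)) n 0 0) := by
  let I := algPowIdeal K A (n + 1)
  have h0 : ∀ x, x ∈ algPow K A (n + 1) → I.proj x = 0 := fun x hx =>
    (Submodule.Quotient.mk_eq_zero I.toSubmodule).2 hx
  have he : ∀ i, n ≤ i → e i ∈ algPow K A (n + 1) := fun i hi =>
    algPow_antitone (by omega) (mem_algPow_of_mul_eq mul_e i)
  obtain ⟨φ', hφ'⟩ : ∃ φ' : ℕ → I.Quot →ₗ[K] K, ∀ i, i < n → ∀ x, φ' i (I.proj x) = φ i x := by
    have h : ∀ i, ∃ g : I.Quot →ₗ[K] K, i < n → ∀ x, g (I.proj x) = φ i x := fun i =>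
      if h : i < n then ⟨I.toSubmodule.liftQ (φ i) (hφ i h), fun _ _ => rfl⟩
      else ⟨0, fun h' => absurd h' h⟩
    choose φ' hφ' using h
    exact ⟨φ', hφ'⟩
  let ψ' : I.Quot →ₗ[K] K := I.toSubmodule.liftQ ψ hψ
  have hψ' : ∀ x, ψ' (I.proj x) = ψ x := fun _ => rfl
  refine ⟨⟨fun i => I.proj (e i), I.proj y, φ', ψ', hn, fun _ => ⟨rfl, rfl⟩, ?_, ?_, ?_, ?_, ?_,
    ?_, ?_, ?_, ?_, ?_⟩⟩
  · intro i j; rw [← AlgIdeal.proj_mul, mul_e]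
  · intro i hi; exact h0 _ (he i hi)
  · rw [← AlgIdeal.proj_mul, h0 _ hey]
  · rw [← AlgIdeal.proj_mul, h0 _ hye, zero_smul]
  · rw [← AlgIdeal.proj_mul, h0 _ hyy, zero_smul]
  · intro i j hi
    by_cases hj : j < n
    · rw [hφ' i hi, hφe i j hi hj]
    · rw [h0 _ (he j (by omega)), map_zero, if_neg (by omega)]
  · intro i hi; rw [hφ' i hi, hφy i hi]
  · intro j
    by_cases hj : j < n
    · rw [hψ', hψe j hj]
    · rw [h0 _ (he j (by omega)), map_zero]
  · rw [hψ', hψy]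
  · intro x
    obtain ⟨x, rfl⟩ := I.proj_surjective x
    have h := h0 _ (hx x)
    rw [map_sub, sub_eq_zero] at h
    have h' : I.proj x = ∑ i ∈ Finset.range n, φ i x • I.proj (e i) + ψ x • I.proj y := by
      simpa only [map_add, map_sum, map_smul] using h
    rw [hψ']
    refine h'.trans (congrArg (· + _) (Finset.sum_congr rfl fun i hi => ?_))
    rw [hφ' i (Finset.mem_range.1 hi)]

variable [IsScalarTower K A A]

/-- `q` and `r` are coefficients at the top vector `e c`, which spans `A^(c+1)`; dividing it out
makes both zero, whatever they were. -/
theorem NormalForm.powQuot_self {c : ℕ} {q r : K} (N : NormalForm K A (c + 1) q r) (hc : 1 ≤ c) :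
    Nonempty (NormalForm K (powQuot K A (c + 1)) c 0 0) := by
  have hA : algPow K A (c + 1) = N.tail (c + 1) := N.algPow_eq (by omega)
  refine nonempty_normalForm_powQuot hc N.e N.y N.coord N.coordY N.mul_e ?_ ?_ ?_
    (fun i j hi _ => N.coord_e i j (by omega)) (fun i hi => N.coord_y i (by omega))
    (fun j _ => N.coordY_e j) N.coordY_y ?_ ?_ ?_
  · rw [N.e_mul_y]; exact zero_mem _
  · rw [N.y_mul_e, hA]; exact Submodule.smul_mem _ _ (N.e_mem_tail (by omega))
  · rw [N.y_mul_y, hA]; exact Submodule.smul_mem _ _ (N.e_mem_tail (by omega))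
  · intro i hi x hx
    rw [hA] at hx
    exact hx.1 i (by omega) (by omega)
  · intro x hx
    rw [hA] at hx
    exact hx.2
  · intro x
    have h : x - (∑ i ∈ Finset.range c, N.coord i x • N.e i + N.coordY x • N.y) =
        N.coord c x • N.e c := by
      conv_lhs => enter [1]; rw [N.expand x, Finset.sum_range_succ]
      abel
    rw [h, hA]
    exact Submodule.smul_mem _ _ (N.e_mem_tail le_rfl)

end Quotients

/-! ### Contracted semigroup algebras: spanning set, coordinates, class. -/

section ContractedAlgebras

universe u v w

variable (K : Type u) {S : Type v} [Field K] [SemigroupWithZero S]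

/-- The image of `s` in the contracted semigroup algebra. -/
noncomputable def contrOf (s : S) : ContrAlg K S :=
  (zeroIdeal K S).proj (MonoidAlgebra.single s 1)

theorem contrOf_mul (s t : S) : contrOf K (s * t) = contrOf K s * contrOf K t := by
  unfold contrOf
  rw [← AlgIdeal.proj_mul, MonoidAlgebra.single_mul_single, mul_one]

theorem contrOf_zero : contrOf K (0 : S) = 0 :=
  (Submodule.Quotient.mk_eq_zero (zeroIdeal K S).toSubmodule).2
    (Submodule.mem_span_singleton_self _)

variable {K} in
theorem contrAlg_induction {p : ContrAlg K S → Prop} (hadd : ∀ x z, p x → p z → p (x + z))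
    (hsmul : ∀ (k : K) x, p x → p (k • x)) (hof : ∀ s, p (contrOf K s)) (x : ContrAlg K S) :
    p x := by
  obtain ⟨x, rfl⟩ := (zeroIdeal K S).proj_surjective x
  induction x using MonoidAlgebra.induction_linear with
  | zero => simpa using hsmul 0 _ (hof 0)
  | add f g hf hg => rw [map_add]; exact hadd _ _ hf hg
  | single m c =>
    have h : MonoidAlgebra.single m c = c • (MonoidAlgebra.single m 1 : MonoidAlgebra K S) := by
      rw [MonoidAlgebra.smul_single, smul_eq_mul, mul_one]
    rw [h, map_smul]
    exact hsmul _ _ (hof m)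

theorem exists_contrCoord [DecidableEq S] (s : S) (hs : s ≠ 0) :
    ∃ φ : ContrAlg K S →ₗ[K] K, ∀ t, φ (contrOf K t) = if s = t then 1 else 0 := by
  let g : MonoidAlgebra K S →ₗ[K] K :=
    { toFun := fun x => x.coeff s
      map_add' := fun x y => by simp
      map_smul' := fun k x => by simp }
  have hg : ∀ t, g (MonoidAlgebra.single t 1) = if s = t then 1 else 0 := by
    intro t
    show (MonoidAlgebra.single t 1 : MonoidAlgebra K S).coeff s = _
    rw [MonoidAlgebra.coeff_single, Finsupp.single_apply]
    simp only [eq_comm]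
  refine ⟨(zeroIdeal K S).toSubmodule.liftQ g ?_, fun t => hg t⟩
  refine Submodule.span_le.2 ?_
  rintro _ rfl
  exact (hg 0).trans (if_neg hs)

/-- The coefficient of the non-zero element `s` in the contracted semigroup algebra. -/
noncomputable def contrCoord (s : S) : ContrAlg K S →ₗ[K] K := by
  classical
  exact if hs : s = 0 then 0 else (exists_contrCoord K s hs).choose

theorem contrCoord_of [DecidableEq S] {s : S} (hs : s ≠ 0) (t : S) :
    contrCoord K s (contrOf K t) = if s = t then 1 else 0 := by
  classical
  rw [contrCoord, dif_neg hs]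
  convert (exists_contrCoord K s hs).choose_spec t

theorem contrOf_ne_zero {s : S} (hs : s ≠ 0) : contrOf K s ≠ 0 := by
  classical
  intro h
  have h' := contrCoord_of K hs s
  rw [h, map_zero, if_pos rfl] at h'
  exact zero_ne_one h'

theorem algPow_contrAlg (n : ℕ) :
    algPow K (ContrAlg K S) n = Submodule.span K (contrOf K '' sgpPow S n) := by
  have h1 : (⊤ : Submodule K (ContrAlg K S)) =
      Submodule.span K (contrOf K '' (Set.univ : Set S)) := by
    refine (eq_top_iff.2 fun x _ => ?_).symm
    induction x using contrAlg_induction with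
    | hadd x z hx hz => exact add_mem (hx trivial) (hz trivial)
    | hsmul k x hx => exact Submodule.smul_mem _ _ (hx trivial)
    | hof s => exact Submodule.subset_span ⟨s, trivial, rfl⟩
  induction n with
  | zero => exact h1
  | succ n ih =>
    cases n with
    | zero => exact h1
    | succ n =>
      refine le_antisymm (Submodule.span_le.2 ?_) (Submodule.span_le.2 ?_)
      · rintro _ ⟨x, hx, z, rfl⟩
        rw [ih] at hx
        induction hx using Submodule.span_induction with
        | zero => rw [zero_mul]; exact zero_mem _
        | add x x' _ _ hx hx' => rw [add_mul]; exact add_mem hx hx'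
        | smul k x _ hx => rw [smul_mul_assoc]; exact Submodule.smul_mem _ _ hx
        | mem x hx =>
          obtain ⟨s, hs, rfl⟩ := hx
          induction z using contrAlg_induction with
          | hadd z z' hz hz' => rw [mul_add]; exact add_mem hz hz'
          | hsmul k z hz => rw [mul_smul_comm]; exact Submodule.smul_mem _ _ hz
          | hof t =>
            rw [← contrOf_mul]
            exact Submodule.subset_span ⟨s * t, ⟨s, hs, t, rfl⟩, rfl⟩
      · rintro _ ⟨_, ⟨s, hs, t, rfl⟩, rfl⟩
        rw [contrOf_mul]
        exact Submodule.subset_span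
          ⟨contrOf K s, ih ▸ Submodule.subset_span ⟨s, hs, rfl⟩, contrOf K t, rfl⟩

theorem zero_mem_sgpPow (n : ℕ) : (0 : S) ∈ sgpPow S n := by
  match n with
  | 0 => trivial
  | 1 => trivial
  | n + 2 => exact ⟨0, zero_mem_sgpPow (n + 1), 0, (mul_zero _).symm⟩

/-- `A^n` is spanned by the images of `S^n`, and a non-zero element of `S` has a non-zero image. So
`S` and `KS` have the same class. -/
theorem algPow_contrAlg_eq_bot_iff (n : ℕ) :
    algPow K (ContrAlg K S) n = ⊥ ↔ sgpPow S n = {0} := by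
  rw [algPow_contrAlg, Submodule.span_eq_bot]
  constructor
  · intro h
    refine Set.eq_singleton_iff_unique_mem.2 ⟨zero_mem_sgpPow n, fun s hs => ?_⟩
    by_contra h0
    exact contrOf_ne_zero K h0 (h _ ⟨s, hs, rfl⟩)
  · rintro h _ ⟨s, hs, rfl⟩
    rw [h] at hs
    rw [Set.mem_singleton_iff.1 hs, contrOf_zero]

variable (S) in
theorem algClass_contrAlg : algClass K (ContrAlg K S) = sgpClass S := by
  unfold algClass sgpClass
  simp only [algPow_contrAlg_eq_bot_iff]


end ContractedAlgebras

/-! ### The semigroups with parameters `c`, `j`, `k`, `l` and their algebras. -/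

section TwoGeneratorSemigroups

universe u v w

/-- The parameters of a nilpotent semigroup of class `c` with generators `a`, `b` in which all
elements except `b` are powers of `a`: the products `a * b`, `b * a` and `b * b` are the powers of
`a` with exponents `j + 1`, `k + 1` and `l + 1`. The conditions express associativity. -/
@[ext] structure SgpParam where
  c : ℕ
  j : ℕ
  k : ℕ
  l : ℕ
  two_le : 2 ≤ c
  one_le_j : 1 ≤ j
  j_le : j ≤ c
  one_le_k : 1 ≤ k
  k_le : k ≤ c
  one_le_l : 1 ≤ l
  l_le : l ≤ c
  -- These encode `a(ba) = (ab)a`, `a(bb) = (ab)b` and `b(ba) = (bb)a`: the two indices agree, or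
  -- both are at least `c`, where powers of `a` vanish.
  jk : j = k ∨ (c ≤ j + 1 ∧ c ≤ k + 1)
  jl : l + 1 = 2 * j ∨ (c ≤ 2 * j ∧ c ≤ l + 1)
  kl : l + 1 = 2 * k ∨ (c ≤ 2 * k ∧ c ≤ l + 1)

/-- The semigroup with parameters `P`: `some i` is the power of `a` with exponent `i + 1` (which is
zero for `i = c`), and `none` is the generator `b`. -/
def ParamSgp (P : SgpParam) : Type := Option (Fin (P.c + 1))

namespace ParamSgp

variable {P : SgpParam}

/-- The power of `a` with exponent `i + 1`. -/
def pow (P : SgpParam) (i : ℕ) : ParamSgp P := some ⟨min i P.c, by omega⟩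

/-- The second generator. -/
def gen (P : SgpParam) : ParamSgp P := none

theorem cases_pow {p : ParamSgp P → Prop} (hpow : ∀ i, i ≤ P.c → p (pow P i)) (hgen : p (gen P))
    (x : ParamSgp P) : p x := by
  rcases x with _ | ⟨i, hi⟩
  · exact hgen
  · have h : pow P i = some ⟨i, hi⟩ := by
      unfold pow; congr 2; omega
    exact h ▸ hpow i (by omega)

theorem pow_eq_pow {i i' : ℕ} : pow P i = pow P i' ↔ min i P.c = min i' P.c := by
  constructor
  · intro h; simpa [pow] using Option.some.inj h
  · intro h; unfold pow; congr 2

theorem pow_ne_gen (i : ℕ) : pow P i ≠ gen P := Option.some_ne_none _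

instance : Finite (ParamSgp P) := inferInstanceAs (Finite (Option (Fin (P.c + 1))))

instance : Mul (ParamSgp P) where
  mul
    | some i, some i' => pow P (i + i' + 1)
    | some i, none => pow P (i + P.j)
    | none, some i => pow P (i + P.k)
    | none, none => pow P P.l

theorem pow_mul_pow (i i' : ℕ) : pow P i * pow P i' = pow P (i + i' + 1) := by
  show pow P _ = _
  rw [pow_eq_pow]; simp only; omega

theorem pow_mul_gen (i : ℕ) : pow P i * gen P = pow P (i + P.j) := by
  show pow P _ = _
  rw [pow_eq_pow]; simp only; omega

theorem gen_mul_pow (i : ℕ) : gen P * pow P i = pow P (i + P.k) := by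
  show pow P _ = _
  rw [pow_eq_pow]; simp only; omega

theorem gen_mul_gen : gen P * gen P = pow P P.l := rfl

instance : Semigroup (ParamSgp P) where
  mul_assoc x y z := by
    obtain ⟨c, j, k, l, hc, hj, hj', hk, hk', hl, hl', hjk, hjl, hkl⟩ := P
    induction x using cases_pow with
    | hpow i hi =>
      induction y using cases_pow with
      | hpow i' hi' =>
        induction z using cases_pow with
        | hpow i'' hi'' => simp only [pow_mul_pow, pow_eq_pow]; omega
        | hgen => simp only [pow_mul_pow, pow_mul_gen, pow_eq_pow]; omega
      | hgen =>
        induction z using cases_pow with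
        | hpow i'' hi'' => simp only [pow_mul_pow, pow_mul_gen, gen_mul_pow, pow_eq_pow]; omega
        | hgen => simp only [pow_mul_pow, pow_mul_gen, gen_mul_gen, pow_eq_pow]; omega
    | hgen =>
      induction y using cases_pow with
      | hpow i' hi' =>
        induction z using cases_pow with
        | hpow i'' hi'' => simp only [pow_mul_pow, gen_mul_pow, pow_eq_pow]; omega
        | hgen => simp only [gen_mul_pow, pow_mul_gen, pow_eq_pow]; omega
      | hgen =>
        induction z using cases_pow with
        | hpow i'' hi'' => simp only [gen_mul_gen, gen_mul_pow, pow_mul_pow, pow_eq_pow]; omega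
        | hgen => simp only [gen_mul_gen, pow_mul_gen, gen_mul_pow, pow_eq_pow]; omega

instance : SemigroupWithZero (ParamSgp P) where
  zero := pow P P.c
  zero_mul x := by
    show pow P P.c * x = pow P P.c
    induction x using cases_pow with
    | hpow i hi => rw [pow_mul_pow, pow_eq_pow]; omega
    | hgen => rw [pow_mul_gen, pow_eq_pow]; omega
  mul_zero x := by
    show x * pow P P.c = pow P P.c
    induction x using cases_pow with
    | hpow i hi => rw [pow_mul_pow, pow_eq_pow]; omega
    | hgen => rw [gen_mul_pow, pow_eq_pow]; omega

theorem pow_eq_zero {i : ℕ} : pow P i = 0 ↔ P.c ≤ i := by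
  show pow P i = pow P P.c ↔ _
  rw [pow_eq_pow]; omega

theorem gen_ne_zero : gen P ≠ 0 := fun h => pow_ne_gen P.c h.symm

theorem card_ne_zero : Nat.card {x : ParamSgp P // x ≠ 0} = P.c + 1 := by
  have h1 : Nat.card (ParamSgp P) = P.c + 2 := by
    show Nat.card (Option (Fin (P.c + 1))) = _
    rw [Nat.card_eq_fintype_card, Fintype.card_option, Fintype.card_fin]
  have h2 : Nat.card {x : ParamSgp P // x ≠ 0} = Nat.card (ParamSgp P) - 1 := by
    classical
    have := Fintype.ofFinite (ParamSgp P)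
    rw [Nat.card_eq_fintype_card, Nat.card_eq_fintype_card, Fintype.card_subtype_compl,
      Fintype.card_subtype_eq]
  omega

/-- An isomorphism of parametrized semigroups preserves the parameters, except that the generators
can be exchanged in class two. -/
theorem param_eq_of_mulEquiv {P' : SgpParam} (hc : P.c = P'.c) (f : ParamSgp P ≃* ParamSgp P') :
    P = P' ∨ (P.c = 2 ∧ P.j = P'.k) := by
  have hP := P.two_le
  have hlt : ∀ {Q : SgpParam} {i : ℕ}, i < Q.c → pow Q i ≠ 0 := fun h h' => by
    rw [pow_eq_zero] at h'; omega
  -- generators are not products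
  have hgen : ∀ {Q : SgpParam} (x y : ParamSgp Q), x * y ≠ gen Q ∧ x * y ≠ pow Q 0 := by
    intro Q x y
    have := Q.two_le
    have := Q.one_le_j
    have := Q.one_le_k
    have := Q.one_le_l
    induction x using cases_pow with
    | hpow i hi =>
      induction y using cases_pow with
      | hpow i' hi' => rw [pow_mul_pow, Ne, Ne, pow_eq_pow]; exact ⟨pow_ne_gen _, by omega⟩
      | hgen => rw [pow_mul_gen, Ne, Ne, pow_eq_pow]; exact ⟨pow_ne_gen _, by omega⟩
    | hgen =>
      induction y using cases_pow with
      | hpow i' hi' => rw [gen_mul_pow, Ne, Ne, pow_eq_pow]; exact ⟨pow_ne_gen _, by omega⟩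
      | hgen => rw [gen_mul_gen, Ne, Ne, pow_eq_pow]; exact ⟨pow_ne_gen _, by omega⟩
  -- An isomorphism preserves the set of elements that are not products, and only the two generators
  -- have this property.
  have himg : ∀ {Q Q' : SgpParam} (g : ParamSgp Q ≃* ParamSgp Q') (x : ParamSgp Q),
      (∀ y z, y * z ≠ x) → g x = pow Q' 0 ∨ g x = gen Q' := by
    intro Q Q' g x hx
    have hx' : ∀ y z, y * z ≠ g x := by
      intro y z h
      refine hx (g.symm y) (g.symm z) ?_
      rw [← map_mul, h, g.symm_apply_apply]
    generalize g x = w at hx'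
    induction w using cases_pow with
    | hpow i hi =>
      cases i with
      | zero => exact Or.inl rfl
      | succ i =>
        refine absurd ?_ (hx' (pow Q' i) (pow Q' 0))
        rw [pow_mul_pow, add_zero]
    | hgen => exact Or.inr rfl
  have ha := himg f (pow P 0) fun y z => (hgen y z).2
  have hb := himg f (gen P) fun y z => (hgen y z).1
  have hpowf : ∀ {Q Q' : SgpParam} (g : ParamSgp Q ≃* ParamSgp Q'), g (pow Q 0) = pow Q' 0 →
      ∀ i, g (pow Q i) = pow Q' i := by
    intro Q Q' g hg i
    induction i with
    | zero => exact hg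
    | succ i ih =>
      have h1 : pow Q (i + 1) = pow Q i * pow Q 0 := by rw [pow_mul_pow, add_zero]
      rw [h1, map_mul, ih, hg, pow_mul_pow, add_zero]
  rcases ha with ha | ha
  · left
    have hb : f (gen P) = gen P' := hb.resolve_left fun hb =>
      pow_ne_gen 0 (f.injective (ha.trans hb.symm))
    have hf := hpowf f ha
    have hj : P.j = P'.j := by
      have h := map_mul f (pow P 0) (gen P)
      rw [pow_mul_gen, hf, hf, hb, pow_mul_gen, pow_eq_pow] at h
      have := P.j_le
      have := P'.j_le
      omega
    have hk : P.k = P'.k := by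
      have h := map_mul f (gen P) (pow P 0)
      rw [gen_mul_pow, hf, hf, hb, gen_mul_pow, pow_eq_pow] at h
      have := P.k_le
      have := P'.k_le
      omega
    have hl : P.l = P'.l := by
      have h := map_mul f (gen P) (gen P)
      rw [gen_mul_gen, hf, hb, gen_mul_gen, pow_eq_pow] at h
      have := P.l_le
      have := P'.l_le
      omega
    exact SgpParam.ext hc hj hk hl
  · have hb : f (gen P) = pow P' 0 := hb.resolve_right fun hb =>
      pow_ne_gen 0 (f.injective (ha.trans hb.symm))
    -- the square of the second generator is not a product of three elements
    have hl1 : ∀ {Q Q' : SgpParam} (g : ParamSgp Q ≃* ParamSgp Q'), g (pow Q 0) = gen Q' →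
        g (gen Q) = pow Q' 0 → Q.l = 1 := by
      intro Q Q' g ha hb
      have hl := Q.one_le_l
      by_contra hne
      have hQ' := Q'.two_le
      have h := map_mul g (gen Q) (gen Q)
      have h1 : gen Q * gen Q = pow Q 0 * (pow Q 0 * pow Q (Q.l - 2)) := by
        rw [gen_mul_gen, pow_mul_pow, pow_mul_pow]; congr 1; omega
      rw [hb, h1, map_mul, map_mul, ha, pow_mul_pow] at h
      have := Q'.one_le_k
      have := Q'.one_le_l
      generalize g (pow Q (Q.l - 2)) = x at h
      induction x using cases_pow with
      | hpow i hi => rw [gen_mul_pow, gen_mul_pow, pow_eq_pow] at h; omega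
      | hgen => rw [gen_mul_gen, gen_mul_pow, pow_eq_pow] at h; omega
    have hl := hl1 f ha hb
    have ha' : f.symm (pow P' 0) = gen P := by rw [← hb, f.symm_apply_apply]
    have hb' : f.symm (gen P') = pow P 0 := by rw [← ha, f.symm_apply_apply]
    have hl' := hl1 f.symm ha' hb'
    by_cases h2 : P.c = 2
    · right
      refine ⟨h2, ?_⟩
      have h := map_mul f (pow P 0) (gen P)
      rw [ha, hb, pow_mul_gen, gen_mul_pow, zero_add, zero_add] at h
      have h1 : f (pow P 1) = pow P' 1 := by
        have h := map_mul f (gen P) (gen P)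
        rwa [gen_mul_gen, hb, pow_mul_pow, hl] at h
      have h3 : f (pow P 2) = pow P' 2 := by
        have e1 : pow P 2 = 0 := pow_eq_zero.2 (by omega)
        have e2 : pow P' 2 = 0 := pow_eq_zero.2 (by omega)
        rw [e1, e2]
        have h := map_mul f 0 (f.symm 0)
        rwa [zero_mul, f.apply_symm_apply, mul_zero] at h
      have := P.one_le_j
      have := P.j_le
      have := P'.one_le_k
      have := P'.k_le
      have hj : P.j = 1 ∨ P.j = 2 := by omega
      rcases hj with hj | hj <;> rw [hj] at h ⊢
      · rw [h1, pow_eq_pow] at h; omega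
      · rw [h3, pow_eq_pow] at h; omega
    -- With `l = 1` on both sides and `c ≥ 3`, the associativity conditions force `j = k = 1` on
    -- both sides.
    · left
      have e1 := P.jl
      have e2 := P.kl
      have e3 := P'.jl
      have e4 := P'.kl
      exact SgpParam.ext hc (by omega) (by omega) (by omega)

end ParamSgp

/-- The coefficient `q` of the normal form of the contracted algebra of a parametrized
semigroup. -/
def SgpParam.q (K : Type u) [Field K] (P : SgpParam) : K :=
  (if P.k = P.c - 1 then 1 else 0) - (if P.j = P.c - 1 then 1 else 0)

/-- The coefficient `r` of the normal form of the contracted algebra of a parametrized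
semigroup. -/
def SgpParam.r (K : Type u) [Field K] (P : SgpParam) : K :=
  (if P.l = P.c - 1 then 1 else 0) - (if P.j + P.k = P.c then 1 else 0)

/-- Take `y = b - a^j`, so that `ay = ab - a^(j+1) = 0`. Then `ya = a^(k+1) - a^(j+1)` and `y² =
a^(l+1) - a^(j+k)`. By the associativity conditions, in each difference the two powers cancel or
both have exponent at least `c`. -/
theorem ParamSgp.nonempty_normalForm (K : Type u) [Field K] {S : Type v} [SemigroupWithZero S]
    (P : SgpParam) (f : ParamSgp P ≃* S) :
    Nonempty (NormalForm K (ContrAlg K S) P.c (P.q K) (P.r K)) := by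
  classical
  have f0 : f 0 = 0 := by
    have h := map_mul f 0 (f.symm 0)
    rwa [zero_mul, f.apply_symm_apply, mul_zero] at h
  obtain ⟨e, he⟩ : ∃ e : ℕ → ContrAlg K S, ∀ i, e i = contrOf K (f (pow P i)) := ⟨_, fun _ => rfl⟩
  obtain ⟨b, hb⟩ : ∃ b : ContrAlg K S, b = contrOf K (f (gen P)) := ⟨_, rfl⟩
  have he0 : ∀ i, P.c ≤ i → e i = 0 := fun i hi => by
    rw [he, pow_eq_zero.2 hi, f0, contrOf_zero]
  have hee : ∀ i i', e i * e i' = e (i + i' + 1) := fun i i' => by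
    rw [he, he, he, ← contrOf_mul, ← map_mul, pow_mul_pow]
  have heb : ∀ i, e i * b = e (i + P.j) := fun i => by
    rw [he, hb, he, ← contrOf_mul, ← map_mul, pow_mul_gen]
  have hbe : ∀ i, b * e i = e (i + P.k) := fun i => by
    rw [he, hb, he, ← contrOf_mul, ← map_mul, gen_mul_pow]
  have hbb : b * b = e P.l := by rw [he, hb, ← contrOf_mul, ← map_mul, gen_mul_gen]
  have hfpow : ∀ i, i < P.c → f (pow P i) ≠ 0 := fun i hi h => by
    have := pow_eq_zero.1 (f.injective (h.trans f0.symm)); omega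
  have hfgen : f (gen P) ≠ 0 := fun h => gen_ne_zero (f.injective (h.trans f0.symm))
  obtain ⟨φ, hφe, hφb⟩ : ∃ φ : ℕ → ContrAlg K S →ₗ[K] K,
      (∀ i j, i < P.c → φ i (e j) = if i = j then 1 else 0) ∧ ∀ i, i < P.c → φ i b = 0 := by
    refine ⟨fun i => contrCoord K (f (pow P i)), fun i j hi => ?_, fun i hi => ?_⟩
    · rw [he, contrCoord_of K (hfpow i hi), f.injective.eq_iff, pow_eq_pow]
      congr 1
      exact propext ⟨fun h => by omega, fun h => by omega⟩
    · rw [hb, contrCoord_of K (hfpow i hi), if_neg fun h => pow_ne_gen i (f.injective h)]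
  obtain ⟨ψ, hψe, hψb⟩ : ∃ ψ : ContrAlg K S →ₗ[K] K, (∀ j, ψ (e j) = 0) ∧ ψ b = 1 := by
    refine ⟨contrCoord K (f (gen P)), fun j => ?_, ?_⟩
    · rw [he, contrCoord_of K hfgen, if_neg fun h => pow_ne_gen j (f.injective h.symm)]
    · rw [hb, contrCoord_of K hfgen, if_pos rfl]
  obtain ⟨c, j, k, l, hc, hj, hj', hk, hk', hl, hl', hjk, hjl, hkl⟩ := P
  simp only at *
  -- From index `c - 1` on, a power is either the top one or zero.
  have hlast : ∀ i, c ≤ i + 1 → e i = (if i = c - 1 then (1 : K) else 0) • e (c - 1) := by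
    intro i hi
    split_ifs with h
    · rw [h, one_smul]
    · rw [he0 i (by omega), zero_smul]
  -- Passing from `b` to `b - e (j - 1)` adds the coefficient `ψ` of `b` to the coordinate at `e (j
  -- - 1)` and changes no other coordinate.
  refine ⟨⟨e, b - e (j - 1), fun i => φ i + if i = j - 1 then ψ else 0, ψ, by omega,
    fun h => by omega, hee, he0, ?_, ?_, ?_, ?_, ?_, hψe, ?_, ?_⟩⟩
  · rw [mul_sub, heb, hee, sub_eq_zero]; congr 1; omega
  · rw [sub_mul, hbe, hee, SgpParam.q, sub_smul]
    simp only
    rw [zero_add, show j - 1 + 0 + 1 = j by omega]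
    rcases hjk with h | h
    · subst h; simp
    · rw [← hlast k h.2, ← hlast j h.1]
  · rw [sub_mul, mul_sub, mul_sub, hbb, hbe, heb, hee, SgpParam.r, sub_smul]
    simp only
    rw [show j - 1 + (j - 1) + 1 = j - 1 + j by omega, sub_self, sub_zero]
    have hif : (if j + k = c then (1 : K) else 0) = if j - 1 + k = c - 1 then 1 else 0 := by
      congr 1; exact propext ⟨fun h => by omega, fun h => by omega⟩
    rw [hif]
    -- Here the two powers in `y²` coincide; in the other case both have index at least `c - 1`.
    by_cases h : j = k ∧ l + 1 = 2 * j
    · rw [show j - 1 + k = l by omega]; simp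
    · rw [← hlast l (by omega), ← hlast (j - 1 + k) (by omega)]
  · intro i i' hi
    rw [LinearMap.add_apply, hφe i i' hi]
    split_ifs <;> simp [hψe]
  · intro i hi
    rw [LinearMap.add_apply, map_sub, hφb i hi, hφe i _ hi]
    split_ifs with h <;> simp [hψe, hψb]
  · rw [map_sub, hψe, hψb, sub_zero]
  · intro x
    induction x using contrAlg_induction with
    | hadd x z hx hz =>
      conv_lhs => rw [hx, hz]
      simp only [map_add, add_smul, Finset.sum_add_distrib]
      abel
    | hsmul t x hx =>
      conv_lhs => rw [hx]
      simp only [map_smul, smul_assoc, smul_add, Finset.smul_sum]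
    | hof s =>
      have hsum : ∀ i, ∑ m ∈ Finset.range c, (φ m + if m = j - 1 then ψ else 0) (e i) • e m =
          e i := by
        intro i
        have : ∀ m ∈ Finset.range c,
            (φ m + if m = j - 1 then ψ else 0) (e i) • e m = if m = i then e m else 0 := by
          intro m hm
          rw [LinearMap.add_apply, hφe m i (Finset.mem_range.1 hm)]
          split_ifs <;> simp [hψe]
        rw [Finset.sum_congr rfl this, Finset.sum_ite_eq']
        split_ifs with h
        · rfl
        · exact (he0 i (by simpa using h)).symm
      obtain ⟨s, rfl⟩ := f.surjective s
      induction s using cases_pow with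
      | hpow i hi => rw [← he, hsum, hψe, zero_smul, add_zero]
      | hgen =>
        rw [← hb, hψb, one_smul]
        have : ∀ m ∈ Finset.range c,
            (φ m + if m = j - 1 then ψ else 0) b • e m = if m = j - 1 then e m else 0 := by
          intro m hm
          rw [LinearMap.add_apply, hφb m (Finset.mem_range.1 hm)]
          split_ifs <;> simp [hψb]
        rw [Finset.sum_congr rfl this, Finset.sum_ite_eq', if_pos (Finset.mem_range.2 (by omega))]
        abel

end TwoGeneratorSemigroups

/-! ### Layers of nilpotent semigroups and the structure of coclass 1. -/

section Layers

universe v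

variable {S : Type v} [SemigroupWithZero S]

theorem sgpPow_succ_subset (n : ℕ) : sgpPow S (n + 1) ⊆ sgpPow S n := by
  induction n with
  | zero => exact subset_rfl
  | succ n ih =>
    cases n with
    | zero => exact Set.subset_univ _
    | succ n =>
      rintro z ⟨x, hx, y, rfl⟩
      exact ⟨x, ih hx, y, rfl⟩

theorem sgpPow_antitone : Antitone (sgpPow S) := antitone_nat_of_succ_le sgpPow_succ_subset

theorem mem_sgpPow_succ {n : ℕ} (hn : 1 ≤ n) {z : S} :
    z ∈ sgpPow S (n + 1) ↔ ∃ x ∈ sgpPow S n, ∃ y : S, z = x * y := by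
  obtain ⟨m, rfl⟩ := Nat.exists_eq_add_of_le' hn
  exact Iff.rfl

theorem mul_mem_sgpPow {m n : ℕ} (hm : 1 ≤ m) (hn : 1 ≤ n) {x y : S} (hx : x ∈ sgpPow S m)
    (hy : y ∈ sgpPow S n) : x * y ∈ sgpPow S (m + n) := by
  induction n, hn using Nat.le_induction generalizing y with
  | base => exact (mem_sgpPow_succ hm).2 ⟨x, hx, y, rfl⟩
  | succ n hn ih =>
    obtain ⟨u, hu, v, rfl⟩ := (mem_sgpPow_succ hn).1 hy
    rw [← mul_assoc]
    exact (mem_sgpPow_succ (n := m + n) (by omega)).2 ⟨x * u, ih hu, v, rfl⟩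

variable (S) in
/-- The elements of `S ^ n` that are not in `S ^ (n + 1)`. -/
def sgpLayer (n : ℕ) : Set S := {x | x ∈ sgpPow S n ∧ x ∉ sgpPow S (n + 1)}

/-- If either factor lay in the next deeper power, the product would lie in `S^(n+2)`. -/
theorem exists_mul_of_mem_sgpLayer {n : ℕ} (hn : 1 ≤ n) {z : S} (hz : z ∈ sgpLayer S (n + 1)) :
    ∃ x ∈ sgpLayer S n, ∃ y ∈ sgpLayer S 1, z = x * y := by
  obtain ⟨x, hx, y, rfl⟩ := (mem_sgpPow_succ hn).1 hz.1
  refine ⟨x, ⟨hx, fun h => hz.2 ?_⟩, y, ⟨trivial, fun h => hz.2 ?_⟩, rfl⟩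
  · exact mul_mem_sgpPow (n := 1) (by omega) le_rfl h trivial
  · exact mul_mem_sgpPow hn (by omega : 1 ≤ 2) hx h

theorem sgpPow_class (h : SgpNilpotent S) : sgpPow S (sgpClass S + 1) = {0} := Nat.sInf_mem h

/-- An empty layer means `S^n = S^(n+1)`; the powers are then constant from `n` on, hence `{0}`,
against the minimality of the class. -/
theorem sgpLayer_nonempty (h : SgpNilpotent S) {n : ℕ} (hn : 1 ≤ n) (hc : n ≤ sgpClass S) :
    (sgpLayer S n).Nonempty := by
  by_contra hne
  have heq : sgpPow S (n + 1) = sgpPow S n := by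
    refine (sgpPow_succ_subset n).antisymm fun x hx => ?_
    by_contra hx'
    exact hne ⟨x, hx, hx'⟩
  have hall : ∀ m, sgpPow S (n + m) = sgpPow S n := by
    intro m
    induction m with
    | zero => rfl
    | succ m ih =>
      refine Eq.trans ?_ heq
      ext z
      rw [← add_assoc, mem_sgpPow_succ (by omega), mem_sgpPow_succ hn, ih]
  have h0 := hall (sgpClass S + 1 - n)
  rw [show n + (sgpClass S + 1 - n) = sgpClass S + 1 by omega, sgpPow_class h] at h0
  have h1 : sgpClass S ≤ n - 1 := Nat.sInf_le (by
    show sgpPow S (n - 1 + 1) = {0}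
    rw [show n - 1 + 1 = n by omega, ← h0])
  omega

theorem exists_mem_sgpLayer (h : SgpNilpotent S) {x : S} (hx : x ≠ 0) :
    ∃ n, 1 ≤ n ∧ n ≤ sgpClass S ∧ x ∈ sgpLayer S n := by
  classical
  have hex : ∃ n, x ∉ sgpPow S (n + 1) :=
    ⟨sgpClass S, fun h' => hx (by rw [sgpPow_class h] at h'; exact h')⟩
  have hspec := Nat.find_spec hex
  have hmin := fun m => Nat.find_min (m := m) hex
  have hle : Nat.find hex ≤ sgpClass S :=
    Nat.find_min' hex fun h' => hx (by rw [sgpPow_class h] at h'; exact h')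
  generalize Nat.find hex = n at *
  have h1 : 1 ≤ n := by
    by_contra h0
    obtain rfl : n = 0 := by omega
    exact hspec trivial
  refine ⟨n, h1, hle, ?_, hspec⟩
  have h2 := not_not.1 (hmin (n - 1) (by omega))
  rwa [show n - 1 + 1 = n by omega] at h2

theorem sgpLayer_disjoint {m n : ℕ} {x : S} (hm : x ∈ sgpLayer S m) (hn : x ∈ sgpLayer S n) :
    m = n := by
  rcases lt_trichotomy m n with h | h | h
  · exact absurd (sgpPow_antitone (by omega : m + 1 ≤ n) hn.1) hm.2
  · exact h
  · exact absurd (sgpPow_antitone (by omega : n + 1 ≤ m) hm.1) hn.2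

theorem ne_zero_of_mem_sgpLayer {n : ℕ} {x : S} (hx : x ∈ sgpLayer S n) : x ≠ 0 := by
  rintro rfl
  exact hx.2 (zero_mem_sgpPow _)

/-- In a nilpotent semigroup of coclass one there are two generators, and all other layers are
singletons. -/
theorem ncard_sgpLayer [Finite S] (h : SgpNilpotent S)
    (hcard : Nat.card {x : S // x ≠ 0} = sgpClass S + 1) :
    1 ≤ sgpClass S ∧ (sgpLayer S 1).ncard = 2 ∧
      ∀ n, 2 ≤ n → n ≤ sgpClass S → (sgpLayer S n).ncard = 1 := by
  classical
  have := Fintype.ofFinite S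
  set c := sgpClass S with hc
  let L : ℕ → Finset S := fun n => Finset.univ.filter fun x => x ∈ sgpLayer S n
  have hmem : ∀ n x, x ∈ L n ↔ x ∈ sgpLayer S n := fun n x => by simp [L]
  have hL : ∀ n, (sgpLayer S n).ncard = (L n).card := fun n => by
    rw [← Set.ncard_coe_finset]; congr 1; ext x; simp [L]
  have hsum : ∑ n ∈ Finset.Icc 1 c, (L n).card = c + 1 := by
    rw [← Finset.card_biUnion, ← hcard, Nat.card_eq_fintype_card, Fintype.card_subtype]
    · congr 1
      ext x
      rw [Finset.mem_biUnion, Finset.mem_filter]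
      constructor
      · rintro ⟨n, -, hn⟩
        exact ⟨Finset.mem_univ _, ne_zero_of_mem_sgpLayer ((hmem n x).1 hn)⟩
      · rintro ⟨-, hx⟩
        obtain ⟨n, h1, h2, h3⟩ := exists_mem_sgpLayer h hx
        exact ⟨n, Finset.mem_Icc.2 ⟨h1, h2⟩, (hmem n x).2 h3⟩
    · intro m _ n _ hmn
      refine Finset.disjoint_left.2 fun x hx hx' => hmn ?_
      exact sgpLayer_disjoint ((hmem m x).1 hx) ((hmem n x).1 hx')
  have hc1 : 1 ≤ c := by
    by_contra h0
    rw [show c = 0 by omega] at hsum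
    simp at hsum
  have hpos : ∀ n, 1 ≤ n → n ≤ c → 1 ≤ (L n).card := fun n h1 h2 => by
    obtain ⟨x, hx⟩ := sgpLayer_nonempty h h1 h2
    exact Finset.card_pos.2 ⟨x, (hmem n x).2 hx⟩
  -- A single generator would leave at most one element in each layer, hence at most `c` non-zero
  -- elements instead of `c + 1`.
  have h2 : 2 ≤ (L 1).card := by
    by_contra hlt
    have hle : ∀ n, 1 ≤ n → (L n).card ≤ 1 := by
      intro n hn
      induction n, hn using Nat.le_induction with
      | base => omega
      | succ n hn ih =>
        rw [Finset.card_le_one] at ih ⊢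
        have hone := Finset.card_le_one.1 (show (L 1).card ≤ 1 by omega)
        intro x hx x' hx'
        obtain ⟨u, hu, v, hv, rfl⟩ := exists_mul_of_mem_sgpLayer hn ((hmem _ _).1 hx)
        obtain ⟨u', hu', v', hv', rfl⟩ := exists_mul_of_mem_sgpLayer hn ((hmem _ _).1 hx')
        rw [ih u ((hmem _ _).2 hu) u' ((hmem _ _).2 hu'),
          hone v ((hmem _ _).2 hv) v' ((hmem _ _).2 hv')]
    have := Finset.sum_le_sum (s := Finset.Icc 1 c) (f := fun n => (L n).card) (g := fun _ => 1)
      fun n hn => hle n (Finset.mem_Icc.1 hn).1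
    rw [hsum] at this
    simp at this
  have hg : ∑ n ∈ Finset.Icc 1 c, (if n = 1 then 2 else 1) = c + 1 := by
    have : ∀ n ∈ Finset.Icc 1 c, (if n = 1 then 2 else 1) = 1 + if n = 1 then 1 else 0 :=
      fun n _ => by split_ifs <;> rfl
    rw [Finset.sum_congr rfl this, Finset.sum_add_distrib, Finset.sum_ite_eq',
      if_pos (Finset.mem_Icc.2 ⟨le_rfl, hc1⟩)]
    simp
  -- The lower bounds `2, 1, …, 1` already add up to the number of non-zero elements, so each of
  -- them is attained.
  have heq := (Finset.sum_eq_sum_iff_of_le (s := Finset.Icc 1 c)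
    (f := fun n => if n = 1 then 2 else 1) (g := fun n => (L n).card) (fun n hn => by
      have hn := Finset.mem_Icc.1 hn
      split_ifs with h1
      · rw [h1]; exact h2
      · exact hpos n hn.1 hn.2)).1 (hg.trans hsum.symm)
  refine ⟨hc1, ?_, fun n hn hnc => ?_⟩
  · rw [hL, ← heq 1 (Finset.mem_Icc.2 ⟨le_rfl, hc1⟩), if_pos rfl]
  · rw [hL, ← heq n (Finset.mem_Icc.2 ⟨by omega, hnc⟩), if_neg (by omega)]

/-- Suppose that no square lies in the second layer. An element of the third layer is a product
`uvw` of generators whose neighbours differ, so `w = u`, and `uv = vu` since the second layer is a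
singleton. Then `uvu = (uu)v` lies in `S^4` because `uu` lies in `S^3`, a contradiction. -/
theorem exists_mul_self_mem_sgpLayer [Finite S] (h : SgpNilpotent S)
    (hcard : Nat.card {x : S // x ≠ 0} = sgpClass S + 1) (hc : 3 ≤ sgpClass S) :
    ∃ a : S, a * a ∈ sgpLayer S 2 := by
  obtain ⟨-, h1, h2⟩ := ncard_sgpLayer h hcard
  obtain ⟨t, ht⟩ := Set.ncard_eq_one.1 (h2 2 le_rfl (by omega))
  obtain ⟨g, g', -, hg⟩ := Set.ncard_eq_two.1 h1
  obtain ⟨z, hz⟩ := sgpLayer_nonempty h (by omega) hc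
  obtain ⟨x, hx, w, hw, rfl⟩ := exists_mul_of_mem_sgpLayer (by omega) hz
  obtain ⟨u, hu, v, hv, rfl⟩ := exists_mul_of_mem_sgpLayer le_rfl hx
  have hvw : v * w ∈ sgpLayer S 2 := by
    refine ⟨mul_mem_sgpPow (m := 1) (n := 1) le_rfl le_rfl trivial trivial, fun h' => hz.2 ?_⟩
    rw [mul_assoc]
    exact mul_mem_sgpPow (m := 1) (n := 3) le_rfl (by omega) trivial h'
  by_contra! hno
  have huv : u * v = t := by rw [ht] at hx; exact hx
  have hvw' : v * w = t := by rw [ht] at hvw; exact hvw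
  have hne : u ≠ v := by rintro rfl; exact hno _ hx
  have hne' : v ≠ w := by rintro rfl; exact hno _ hvw
  have huw : u = w := by
    rw [hg] at hu hv hw
    rcases hu with rfl | rfl <;> rcases hv with rfl | rfl <;> rcases hw with rfl | rfl <;>
      first | rfl | exact absurd rfl hne | exact absurd rfl hne'
  subst huw
  have huu : u * u ∈ sgpPow S 3 := by
    by_contra hn
    exact hno u ⟨mul_mem_sgpPow (m := 1) (n := 1) le_rfl le_rfl trivial trivial, hn⟩
  refine hz.2 ?_
  rw [mul_assoc, hvw', ← huv, ← mul_assoc]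
  exact mul_mem_sgpPow (n := 1) (by omega) le_rfl huu trivial

/-- A nilpotent semigroup of coclass one and class at least two in which the square of some element
is not a product of three elements is one of the parametrized semigroups. -/
theorem exists_paramSgp_mulEquiv [Finite S] (h : SgpNilpotent S)
    (hcard : Nat.card {x : S // x ≠ 0} = sgpClass S + 1) (hc : 2 ≤ sgpClass S) {a : S}
    (ha : a * a ∈ sgpLayer S 2) :
    ∃ P : SgpParam, P.c = sgpClass S ∧ Nonempty (ParamSgp P ≃* S) := by
  obtain ⟨-, h1, h2⟩ := ncard_sgpLayer h hcard
  obtain ⟨c, hcc⟩ : ∃ c, c = sgpClass S := ⟨_, rfl⟩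
  have hpc : sgpPow S (c + 1) = {0} := hcc ▸ sgpPow_class h
  rw [← hcc] at hc h2
  have ha1 : a ∈ sgpLayer S 1 := ⟨trivial, fun h' => ha.2
    (mul_mem_sgpPow (m := 2) (n := 1) (by omega) le_rfl h' trivial)⟩
  obtain ⟨b, hba, hL1⟩ : ∃ b, b ≠ a ∧ sgpLayer S 1 = {a, b} := by
    obtain ⟨g, g', hne, hg⟩ := Set.ncard_eq_two.1 h1
    rw [hg] at ha1
    rcases ha1 with rfl | rfl
    · exact ⟨g', hne.symm, hg⟩
    · exact ⟨g, hne, hg.trans (Set.pair_comm _ _)⟩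
  have hb1 : b ∈ sgpLayer S 1 := by rw [hL1]; exact Or.inr rfl
  obtain ⟨e, he0, hes⟩ : ∃ e : ℕ → S, e 0 = a ∧ ∀ i, e (i + 1) = e i * a :=
    ⟨fun i => Nat.rec a (fun _ x => x * a) i, rfl, fun _ => rfl⟩
  have hee : ∀ i j, e i * e j = e (i + j + 1) := by
    intro i j
    induction j with
    | zero => rw [he0, ← hes, add_zero]
    | succ j ih => rw [hes, ← mul_assoc, ih, ← hes]; congr 1
  have hepow : ∀ i, e i ∈ sgpPow S (i + 1) := by
    intro i
    induction i with
    | zero => trivial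
    | succ i ih => rw [hes]; exact mul_mem_sgpPow (n := 1) (by omega) le_rfl ih trivial
  have hsing : ∀ n x y, 2 ≤ n → n ≤ c → x ∈ sgpLayer S n → y ∈ sgpLayer S n → x = y := by
    intro n x y hn hn' hx hy
    obtain ⟨t, ht⟩ := Set.ncard_eq_one.1 (h2 n hn hn')
    rw [ht] at hx hy
    exact (Set.mem_singleton_iff.1 hx).trans (Set.mem_singleton_iff.1 hy).symm
  -- An element of the next layer is a power of `a` times `a` or `b`. In the second case `ab` lies
  -- in the second layer, hence equals `a²`, and the product is again a power of `a`.
  have hlayer : ∀ i, i < c → e i ∈ sgpLayer S (i + 1) := by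
    intro i
    induction i with
    | zero => intro _; rw [he0]; exact ha1
    | succ i ih =>
      intro hi
      cases i with
      | zero => rw [hes, he0]; exact ha
      | succ i =>
        have hi' := ih (by omega)
        obtain ⟨z, hz⟩ := sgpLayer_nonempty h (show 1 ≤ i + 1 + 1 + 1 by omega) (by omega)
        obtain ⟨x, hx, w, hw, rfl⟩ := exists_mul_of_mem_sgpLayer (by omega) hz
        obtain rfl : x = e (i + 1) := hsing _ _ _ (by omega) (by omega) hx hi'
        rw [hL1] at hw
        have hz' : e (i + 1) * w = e (i + 1 + 1) := by
          rcases hw with rfl | rfl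
          · exact (hes _).symm
          · have hab : a * w ∈ sgpLayer S 2 := by
              refine ⟨mul_mem_sgpPow (m := 1) (n := 1) le_rfl le_rfl trivial trivial,
                fun h' => hz.2 ?_⟩
              rw [hes, mul_assoc]
              exact mul_mem_sgpPow (m := i + 1) (n := 3) (by omega) (by omega) (hepow i) h'
            rw [hes, mul_assoc, hsing 2 _ _ le_rfl hc hab ha, hes, hes, mul_assoc]
        exact hz' ▸ hz
  have hez : ∀ i, c ≤ i → e i = 0 := by
    intro i hi
    have := sgpPow_antitone (by omega : c + 1 ≤ i + 1) (hepow i)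
    rw [hpc] at this
    exact this
  have hez' : e c = 0 := hez c le_rfl
  have hmin : ∀ i, e i = e (min i c) := by
    intro i
    rcases le_total i c with hi | hi
    · rw [min_eq_left hi]
    · rw [min_eq_right hi, hez i hi, hez']
  have hinj : ∀ i j, e i = e j → min i c = min j c := by
    intro i j hij
    by_cases hi : i < c <;> by_cases hj : j < c
    · have := sgpLayer_disjoint (hlayer i hi) (hij ▸ hlayer j hj)
      omega
    · exact absurd (hij.trans (hez j (by omega))) (ne_zero_of_mem_sgpLayer (hlayer i hi))
    · exact absurd (hij.symm.trans (hez i (by omega))) (ne_zero_of_mem_sgpLayer (hlayer j hj))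
    · omega
  have hall : ∀ x : S, x = b ∨ ∃ i, i ≤ c ∧ x = e i := by
    intro x
    by_cases hx : x = 0
    · exact Or.inr ⟨c, le_rfl, hx.trans hez'.symm⟩
    · obtain ⟨n, hn, hn', hxn⟩ := exists_mem_sgpLayer h hx
      rw [← hcc] at hn'
      by_cases h1 : n = 1
      · rw [h1, hL1] at hxn
        rcases hxn with rfl | rfl
        · exact Or.inr ⟨0, by omega, he0.symm⟩
        · exact Or.inl rfl
      · refine Or.inr ⟨n - 1, by omega, hsing n _ _ (by omega) hn' hxn ?_⟩
        have := hlayer (n - 1) (by omega)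
        rwa [show n - 1 + 1 = n by omega] at this
  have hbe : ∀ i, b ≠ e i := by
    intro i hi
    by_cases hic : i < c
    · have := sgpLayer_disjoint hb1 (hi ▸ hlayer i hic)
      obtain rfl : i = 0 := by omega
      exact hba (hi.trans he0)
    · exact ne_zero_of_mem_sgpLayer hb1 (hi.trans (hez i (by omega)))
  have hprod : ∀ x y : S, ∃ i, 1 ≤ i ∧ i ≤ c ∧ x * y = e i := by
    intro x y
    have hxy : x * y ∈ sgpPow S 2 :=
      mul_mem_sgpPow (m := 1) (n := 1) le_rfl le_rfl trivial trivial
    rcases hall (x * y) with h' | ⟨i, hi, h'⟩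
    · exact absurd (h' ▸ hxy) hb1.2
    · refine ⟨i, ?_, hi, h'⟩
      by_contra h0
      obtain rfl : i = 0 := by omega
      rw [he0] at h'
      exact ha1.2 (h' ▸ hxy)
  obtain ⟨j, hj, hj', hab⟩ := hprod a b
  obtain ⟨k, hk, hk', hba'⟩ := hprod b a
  obtain ⟨l, hl, hl', hbb⟩ := hprod b b
  have heb : ∀ i, e i * b = e (i + j) := by
    intro i
    cases i with
    | zero => rw [he0, hab, zero_add]
    | succ i => rw [hes, mul_assoc, hab, hee]; congr 1; omega
  have hbei : ∀ i, b * e i = e (i + k) := by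
    intro i
    induction i with
    | zero => rw [he0, hba', zero_add]
    | succ i ih => rw [hes, ← mul_assoc, ih, ← hes]; congr 1; omega
  -- Associativity compares indices only after truncation at `c`, since all higher powers are zero.
  have e1 : min (k + 1) c = min (j + 1) c := by
    refine hinj _ _ ?_
    have h' := mul_assoc a b a
    rw [hab, hba', ← he0, hee, hee] at h'
    rw [show k + 1 = 0 + k + 1 by omega, ← h', add_zero]
  have e2 : min (l + 1) c = min (2 * j) c := by
    refine hinj _ _ ?_
    have h' : a * (b * b) = a * b * b := (mul_assoc _ _ _).symm
    rw [hbb, hab, heb, ← he0, hee] at h'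
    rw [show 2 * j = j + j by omega, ← h']; congr 1; omega
  have e3 : min (l + 1) c = min (2 * k) c := by
    refine hinj _ _ ?_
    have h' : b * (b * a) = b * b * a := (mul_assoc _ _ _).symm
    rw [hbb, hba', hbei, ← hes] at h'
    rw [show 2 * k = k + k by omega, h']
  let P : SgpParam := ⟨c, j, k, l, hc, hj, hj', hk, hk', hl, hl', by omega, by omega, by omega⟩
  let F : ParamSgp P → S := fun x => Option.elim x b fun i => e i
  have Fpow : ∀ i, F (ParamSgp.pow P i) = e i := fun i => (hmin i).symm
  have Fgen : F (ParamSgp.gen P) = b := rfl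
  have Fmul : ∀ x y, F (x * y) = F x * F y := by
    intro x y
    induction x using ParamSgp.cases_pow with
    | hpow i hi =>
      induction y using ParamSgp.cases_pow with
      | hpow i' hi' => rw [ParamSgp.pow_mul_pow, Fpow, Fpow, Fpow, hee]
      | hgen => rw [ParamSgp.pow_mul_gen, Fpow, Fpow, Fgen, heb]
    | hgen =>
      induction y using ParamSgp.cases_pow with
      | hpow i' hi' => rw [ParamSgp.gen_mul_pow, Fpow, Fpow, Fgen, hbei]
      | hgen => rw [ParamSgp.gen_mul_gen, Fpow, Fgen, hbb]
  refine ⟨P, hcc, ⟨MulEquiv.ofBijective (⟨F, Fmul⟩ : ParamSgp P →ₙ* S)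
    ⟨fun x y hxy => ?_, fun x => ?_⟩⟩⟩
  · replace hxy : F x = F y := hxy
    induction x using ParamSgp.cases_pow with
    | hpow i hi =>
      induction y using ParamSgp.cases_pow with
      | hpow i' hi' =>
        rw [Fpow, Fpow] at hxy
        exact ParamSgp.pow_eq_pow.2 (hinj _ _ hxy)
      | hgen => rw [Fpow, Fgen] at hxy; exact absurd hxy.symm (hbe i)
    | hgen =>
      induction y using ParamSgp.cases_pow with
      | hpow i' hi' => rw [Fpow, Fgen] at hxy; exact absurd hxy (hbe i')
      | hgen => rfl
  · rcases hall x with rfl | ⟨i, -, rfl⟩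
    · exact ⟨ParamSgp.gen P, Fgen⟩
    · exact ⟨ParamSgp.pow P i, Fpow i⟩

end Layers

/-! ### The algebra `M_{K,1}` and its quotients. -/

section AlgebraM

universe u

variable (K : Type u) [Field K]

namespace AlgM

/-- The power of the indeterminate with exponent `i + 1`. -/
noncomputable def pow (i : ℕ) : AlgM K 1 :=
  (⟨X ^ (i + 1), show (X ^ (i + 1) : K[X]).coeff 0 = 0 by simp⟩, 0)

/-- The generator of the summand `L_K`. -/
noncomputable def gen : AlgM K 1 := (0, fun _ => (1 : K))

/-- The coefficient of the power of the indeterminate with exponent `i + 1`. -/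
noncomputable def coord (i : ℕ) : AlgM K 1 →ₗ[K] K where
  toFun x := x.1.1.coeff (i + 1)
  map_add' x y := coeff_add x.1.1 y.1.1 (i + 1)
  map_smul' k x := coeff_smul k x.1.1 (i + 1)

/-- The coordinate in the summand `L_K`. -/
noncomputable def coordY : AlgM K 1 →ₗ[K] K where
  toFun x := x.2 0
  map_add' _ _ := rfl
  map_smul' _ _ := rfl

variable {K}

theorem pow_mul_pow (i j : ℕ) : pow K i * pow K j = pow K (i + j + 1) := by
  refine Prod.ext (Subtype.ext ?_) (funext fun _ => rfl)
  show (X ^ (i + 1) * X ^ (j + 1) : K[X]) = X ^ (i + j + 1 + 1)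
  rw [← pow_add]; congr 1; omega

theorem mul_gen (x : AlgM K 1) : x * gen K = 0 :=
  Prod.ext (mul_zero x.1) (funext fun _ => rfl)

theorem gen_mul (x : AlgM K 1) : gen K * x = 0 :=
  Prod.ext (zero_mul x.1) (funext fun _ => rfl)

theorem coord_pow (i j : ℕ) : coord K i (pow K j) = if i = j then 1 else 0 := by
  show (X ^ (j + 1) : K[X]).coeff (i + 1) = _
  rw [coeff_X_pow]
  congr 1
  exact propext ⟨fun h => by omega, fun h => by omega⟩

theorem coord_gen (i : ℕ) : coord K i (gen K) = 0 := coeff_zero (i + 1)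

theorem coordY_pow (j : ℕ) : coordY K (pow K j) = 0 := rfl

theorem coordY_gen : coordY K (gen K) = 1 := rfl

theorem ext_coord {x y : AlgM K 1} (h : ∀ i, coord K i x = coord K i y)
    (h' : coordY K x = coordY K y) : x = y := by
  refine Prod.ext (Subtype.ext (Polynomial.ext fun i => ?_)) (funext fun i => ?_)
  · cases i with
    | zero => exact (show x.1.1.coeff 0 = 0 from x.1.2).trans (show y.1.1.coeff 0 = 0 from y.1.2).symm
    | succ i => exact h i
  · obtain rfl : i = 0 := Subsingleton.elim _ _
    exact h'

theorem expand {x : AlgM K 1} {n : ℕ} (hn : ∀ i, n ≤ i → coord K i x = 0) :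
    x = ∑ i ∈ Finset.range n, coord K i x • pow K i + coordY K x • gen K := by
  refine ext_coord (fun i => ?_) ?_
  · simp only [map_add, map_sum, map_smul, coord_pow, coord_gen, smul_eq_mul, mul_ite, mul_one,
      mul_zero, add_zero, Finset.sum_ite_eq, Finset.mem_range]
    split_ifs with h
    · rfl
    · exact hn i (by omega)
  · simp only [map_add, map_sum, map_smul, coordY_pow, coordY_gen, smul_eq_mul, mul_one, mul_zero,
      Finset.sum_const_zero, zero_add]

theorem exists_coord_eq_zero (x : AlgM K 1) : ∃ n, ∀ i, n ≤ i → coord K i x = 0 :=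
  ⟨x.1.1.natDegree, fun _ hi => coeff_eq_zero_of_natDegree_lt (Nat.lt_succ_of_le hi)⟩

variable (K) in
/-- The elements whose coordinates at the generator of `L_K` and at the powers of the
indeterminate with exponents less than `n` vanish. -/
def tail (n : ℕ) : Submodule K (AlgM K 1) where
  carrier := {x | (∀ i, i + 1 < n → coord K i x = 0) ∧ coordY K x = 0}
  zero_mem' := ⟨fun _ _ => map_zero _, map_zero _⟩
  add_mem' := by
    rintro x z ⟨hx, hx'⟩ ⟨hz, hz'⟩
    exact ⟨fun i h => by rw [map_add, hx i h, hz i h, add_zero], by rw [map_add, hx', hz', add_zero]⟩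
  smul_mem' := by
    rintro k x ⟨hx, hx'⟩
    exact ⟨fun i h => by rw [map_smul, hx i h, smul_zero], by rw [map_smul, hx', smul_zero]⟩

/-- The second factor has no constant term, so it raises the order by at least one, and products
have no component in `L_K`. -/
theorem mul_mem_tail {n : ℕ} {x : AlgM K 1} (hx : ∀ i, i + 1 < n → coord K i x = 0)
    (y : AlgM K 1) : x * y ∈ tail K (n + 1) := by
  refine ⟨fun i hi => ?_, rfl⟩
  show (x.1.1 * y.1.1).coeff (i + 1) = 0
  rw [coeff_mul]
  refine Finset.sum_eq_zero fun p hp => ?_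
  have hp := Finset.HasAntidiagonal.mem_antidiagonal.1 hp
  rcases hp1 : p.1 with _ | a
  · rw [show x.1.1.coeff 0 = 0 from x.1.2, zero_mul]
  · rcases hp2 : p.2 with _ | b
    · rw [show y.1.1.coeff 0 = 0 from y.1.2, mul_zero]
    · rw [show x.1.1.coeff (a + 1) = 0 from hx a (by omega), zero_mul]

theorem algPow_eq {n : ℕ} (hn : 2 ≤ n) : algPow K (AlgM K 1) n = tail K n := by
  refine le_antisymm (algPow_le_of_mul_mem (fun x y => ?_) (fun n _ x hx y => ?_) hn) ?_
  · exact mul_mem_tail (n := 1) (fun i hi => by omega) y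
  · exact mul_mem_tail hx.1 y
  · rintro x ⟨hx, hx'⟩
    obtain ⟨m, hm⟩ := exists_coord_eq_zero x
    rw [expand hm, hx', zero_smul, add_zero]
    refine sum_mem fun i _ => ?_
    by_cases h : i + 1 < n
    · rw [hx i h, zero_smul]; exact zero_mem _
    · exact Submodule.smul_mem _ _
        (algPow_antitone (by omega : n ≤ i + 1) (mem_algPow_of_mul_eq pow_mul_pow i))

/-- What survives is the table with `q = r = 0` in class `n`, which places these quotients on the
main path. -/
theorem nonempty_normalForm_powQuot {n : ℕ} (hn : 1 ≤ n) :
    Nonempty (NormalForm K (powQuot K (AlgM K 1) (n + 1)) n 0 0) := by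
  have hA : algPow K (AlgM K 1) (n + 1) = tail K (n + 1) := algPow_eq (by omega)
  refine _root_.nonempty_normalForm_powQuot hn (pow K) (gen K) (coord K) (coordY K) pow_mul_pow
    ?_ ?_ ?_ (fun i j _ _ => coord_pow i j) (fun i _ => coord_gen i) (fun j _ => coordY_pow j)
    coordY_gen ?_ ?_ ?_
  · rw [mul_gen]; exact zero_mem _
  · rw [gen_mul]; exact zero_mem _
  · rw [gen_mul]; exact zero_mem _
  · intro i hi x hx
    rw [hA] at hx
    exact hx.1 i (by omega)
  · intro x hx
    rw [hA] at hx
    exact hx.2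
  · intro x
    rw [hA]
    refine ⟨fun i hi => ?_, ?_⟩
    · have hi' : i < n := by omega
      simp [coord_pow, coord_gen, hi']
    · simp [coordY_pow, coordY_gen]

theorem hasInfCoclass : HasInfCoclass K (AlgM K 1) 1 where
  infinite h := by
    have hli : LinearIndependent K (pow K) := by
      rw [linearIndependent_iff']
      intro s g hg i hi
      have h' := congrArg (coord K i) hg
      simpa [coord_pow, hi] using h'
    have := hli.finite_of_isNoetherian
    exact not_finite ℕ
  fg := by
    classical
    refine ⟨{pow K 0, gen K}, eq_top_iff.2 fun x _ => ?_⟩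
    have h0 : pow K 0 ∈ NonUnitalAlgebra.adjoin K (({pow K 0, gen K} : Finset _) : Set (AlgM K 1)) :=
      NonUnitalAlgebra.subset_adjoin K (by simp)
    have hpow : ∀ i, pow K i ∈
        NonUnitalAlgebra.adjoin K (({pow K 0, gen K} : Finset _) : Set (AlgM K 1)) := by
      intro i
      induction i with
      | zero => exact h0
      | succ i ih =>
        have := mul_mem ih h0
        rwa [pow_mul_pow, add_zero] at this
    obtain ⟨n, hn⟩ := exists_coord_eq_zero x
    rw [expand hn]
    refine add_mem (sum_mem fun i _ => SMulMemClass.smul_mem _ (hpow i)) (SMulMemClass.smul_mem _ ?_)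
    exact NonUnitalAlgebra.subset_adjoin K (by simp)
  residuallyNilpotent := by
    refine eq_bot_iff.2 fun x hx => ?_
    rw [Submodule.mem_iInf] at hx
    have hx' : ∀ n, 2 ≤ n → x ∈ tail K n := fun n hn => algPow_eq (K := K) hn ▸ hx n
    exact ext_coord (fun i => by rw [(hx' (i + 2) (by omega)).1 i (by omega), map_zero])
      (by rw [(hx' 2 le_rfl).2, map_zero])
  coclass := by
    refine eventually_atTop.2 ⟨2, fun n hn => ?_⟩
    obtain ⟨m, rfl⟩ := Nat.exists_eq_add_of_le' (show 1 ≤ n by omega)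
    obtain ⟨N⟩ := nonempty_normalForm_powQuot (K := K) (show 1 ≤ m by omega)
    exact N.hasAlgCoclass

end AlgM

end AlgebraM

/-! ### The quotient by the square, needed for classes one and two. -/

section SmallClasses

universe u v

variable (K : Type u) [Field K]

theorem algIso_powQuot {A : Type v} [NonUnitalRing A] [Module K A] [IsScalarTower K A A]
    [SMulCommClass K A A] {n : ℕ} (h : algPow K A n = ⊥) : AlgIso K A (powQuot K A n) := by
  refine ⟨{ toFun := (algPowIdeal K A n).proj
            map_smul' := map_smul _
            map_zero' := map_zero _
            map_add' := map_add _
            map_mul' := (algPowIdeal K A n).proj_mul }, fun x y hxy => ?_,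
    (algPowIdeal K A n).proj_surjective⟩
  have h' : x - y ∈ algPow K A n := (algPowIdeal K A n).proj_eq_proj.1 hxy
  rw [h] at h'
  exact sub_eq_zero.1 h'

/-- The quotient of the contracted algebra by its square, for a semigroup of coclass one. -/
theorem nonempty_normalForm_powQuot_two {S : Type v} [SemigroupWithZero S] [Finite S]
    (h : SgpNilpotent S) (hcard : Nat.card {x : S // x ≠ 0} = sgpClass S + 1) :
    Nonempty (NormalForm K (powQuot K (ContrAlg K S) 2) 1 0 0) := by
  classical
  obtain ⟨-, h1, -⟩ := ncard_sgpLayer h hcard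
  obtain ⟨a, b, hab, hL⟩ := Set.ncard_eq_two.1 h1
  have ha : a ∈ sgpLayer S 1 := hL ▸ Or.inl rfl
  have hb : b ∈ sgpLayer S 1 := hL ▸ Or.inr rfl
  have ha0 := ne_zero_of_mem_sgpLayer ha
  have hb0 := ne_zero_of_mem_sgpLayer hb
  have hvan : ∀ s ∈ sgpLayer S 1, ∀ x ∈ algPow K (ContrAlg K S) 2, contrCoord K s x = 0 := by
    intro s hs x hx
    rw [algPow_contrAlg] at hx
    refine (Submodule.span_le (p := LinearMap.ker (contrCoord K s))).2 ?_ hx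
    rintro _ ⟨t, ht, rfl⟩
    refine (contrCoord_of K (ne_zero_of_mem_sgpLayer hs) t).trans (if_neg ?_)
    rintro rfl
    exact hs.2 ht
  obtain ⟨e, he0, hes⟩ : ∃ e : ℕ → ContrAlg K S,
      e 0 = contrOf K a ∧ ∀ i, e (i + 1) = e i * contrOf K a :=
    ⟨fun i => Nat.rec (contrOf K a) (fun _ x => x * contrOf K a) i, rfl, fun _ => rfl⟩
  have hee : ∀ i j, e i * e j = e (i + j + 1) := by
    intro i j
    induction j with
    | zero => rw [he0, ← hes, add_zero]
    | succ j ih => rw [hes, ← mul_assoc, ih, ← hes]; congr 1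
  refine nonempty_normalForm_powQuot (n := 1) le_rfl e (contrOf K b) (fun _ => contrCoord K a)
    (contrCoord K b) hee (mul_mem_algPow_two _ _) (mul_mem_algPow_two _ _)
    (mul_mem_algPow_two _ _) ?_ ?_ ?_ ?_ (fun _ _ => hvan a ha) (hvan b hb) ?_
  · intro i j hi hj
    obtain rfl : i = 0 := by omega
    obtain rfl : j = 0 := by omega
    rw [he0, contrCoord_of K ha0]; simp
  · intro i _
    rw [contrCoord_of K ha0, if_neg hab]
  · intro j hj
    obtain rfl : j = 0 := by omega
    rw [he0, contrCoord_of K hb0, if_neg hab.symm]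
  · rw [contrCoord_of K hb0, if_pos rfl]
  · intro x
    rw [Finset.sum_range_one, he0]
    induction x using contrAlg_induction with
    | hadd x z hx hz =>
      have := add_mem hx hz
      convert this using 1
      simp only [map_add, add_smul]
      abel
    | hsmul k x hx =>
      have := Submodule.smul_mem _ k hx
      convert this using 1
      simp only [map_smul, smul_sub, smul_add, smul_assoc]
    | hof s =>
      rw [contrCoord_of K ha0, contrCoord_of K hb0]
      by_cases hsa : a = s
      · rw [if_pos hsa, if_neg (fun h => hab (hsa.trans h.symm)), hsa]; simp
      · by_cases hsb : b = s
        · rw [if_neg hsa, if_pos hsb, hsb]; simp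
        · rw [if_neg hsa, if_neg hsb, zero_smul, zero_smul, add_zero, sub_zero, algPow_contrAlg]
          refine Submodule.subset_span ⟨s, ?_, rfl⟩
          by_contra hs
          have : s ∈ sgpLayer S 1 := ⟨trivial, hs⟩
          rw [hL] at this
          rcases this with h | h
          · exact hsa h.symm
          · exact hsb h.symm

end SmallClasses

/-! ### Vertices, their normal forms, and the edges. -/

section Vertices

universe u

/-- The parametrized semigroups have coclass one. -/
def SgpParam.nilSgp (P : SgpParam) : NilSgp 1 where
  carrier := ParamSgp P
  nilpotent := by
    -- Nilpotency and class do not involve a field, so they can be read off the algebra over any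
    -- field.
    obtain ⟨N⟩ := ParamSgp.nonempty_normalForm ℚ P (MulEquiv.refl _)
    exact ⟨P.c, (algPow_contrAlg_eq_bot_iff ℚ _).1 N.algPow_eq_bot⟩
  coclass := by
    obtain ⟨N⟩ := ParamSgp.nonempty_normalForm ℚ P (MulEquiv.refl _)
    rw [ParamSgp.card_ne_zero, ← algClass_contrAlg ℚ, N.algClass_eq]

/-- The zero semigroup with three elements, as a semigroup of coclass one. -/
def zeroNilSgp : NilSgp 1 where
  carrier := ZeroSgp 3
  finite := inferInstanceAs (Finite (Fin 3))
  nilpotent := ⟨1, Set.eq_singleton_iff_unique_mem.2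
    ⟨zero_mem_sgpPow 2, by rintro _ ⟨x, -, y, rfl⟩; rfl⟩⟩
  coclass := by
    have h2 : sgpPow (ZeroSgp 3) 2 = {0} := Set.eq_singleton_iff_unique_mem.2
      ⟨zero_mem_sgpPow 2, by rintro _ ⟨x, -, y, rfl⟩; rfl⟩
    have hc : sgpClass (ZeroSgp 3) = 1 := by
      refine le_antisymm (Nat.sInf_le h2) (le_csInf ⟨1, h2⟩ fun d hd => ?_)
      by_contra h0
      obtain rfl : d = 0 := by omega
      have h1 : (1 : Fin 3) = (0 : Fin 3) := (Set.eq_singleton_iff_unique_mem.1 hd).2 (1 : Fin 3) trivial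
      exact absurd h1 (by decide)
    rw [hc]
    show Nat.card {x : Fin 3 // x ≠ 0} = 2
    rw [Nat.card_eq_fintype_card]
    rfl

variable {K : Type u} [Field K]

theorem NilSgp.vertex_eq_iff {S T : NilSgp 1} :
    S.vertex K = T.vertex K ↔ AlgIso K (ContrAlg K S.carrier) (ContrAlg K T.carrier) :=
  ⟨fun h => Quotient.exact h, fun h => Quotient.sound h⟩

/-- The class of a vertex. -/
noncomputable def Vertex.cls (V : Vertex K 1) : ℕ :=
  Quotient.lift (fun S : NilSgp 1 => sgpClass S.carrier) (fun S T h => by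
    have h' : AlgIso K (ContrAlg K S.carrier) (ContrAlg K T.carrier) := h
    rw [← algClass_contrAlg K, ← algClass_contrAlg K, h'.algClass_eq]) V

theorem NilSgp.cls_vertex (S : NilSgp 1) : (S.vertex K).cls = sgpClass S.carrier := rfl

theorem Vertex.exists_rep (V : Vertex K 1) : ∃ S : NilSgp 1, S.vertex K = V := Quotient.exists_rep V

/-- The algebras of isomorphism type `V` have a normal form with parameters `c`, `q`, `r`. -/
def Vertex.HasNormalForm (V : Vertex K 1) (c : ℕ) (q r : K) : Prop :=
  ∃ S : NilSgp 1, S.vertex K = V ∧ Nonempty (NormalForm K (ContrAlg K S.carrier) c q r)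

theorem Vertex.HasNormalForm.of_vertex {S : NilSgp 1} {c : ℕ} {q r : K}
    (h : (S.vertex K).HasNormalForm c q r) :
    Nonempty (NormalForm K (ContrAlg K S.carrier) c q r) := by
  obtain ⟨T, hT, ⟨N⟩⟩ := h
  exact N.of_algIso (NilSgp.vertex_eq_iff.1 hT)

theorem Vertex.HasNormalForm.unique {V V' : Vertex K 1} {c : ℕ} {q r : K}
    (h : V.HasNormalForm c q r) (h' : V'.HasNormalForm c q r) : V = V' := by
  obtain ⟨S, rfl, ⟨N⟩⟩ := h
  obtain ⟨S', rfl, ⟨N'⟩⟩ := h'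
  exact NilSgp.vertex_eq_iff.2 (N.algIso N')

theorem Vertex.HasNormalForm.cls_eq {V : Vertex K 1} {c : ℕ} {q r : K}
    (h : V.HasNormalForm c q r) : V.cls = c := by
  obtain ⟨S, rfl, ⟨N⟩⟩ := h
  rw [NilSgp.cls_vertex, ← algClass_contrAlg K, N.algClass_eq]

theorem Vertex.HasNormalForm.isTypeOf {V : Vertex K 1} {c : ℕ} {q r : K}
    (h : V.HasNormalForm c q r) {A : Type*} [NonUnitalRing A] [Module K A] [IsScalarTower K A A]
    [SMulCommClass K A A] (N : NormalForm K A c q r) : V.IsTypeOf A := by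
  obtain ⟨S, hS, ⟨N'⟩⟩ := h
  exact ⟨S, hS, N.algIso N'⟩

theorem NilSgp.one_le_class (S : NilSgp 1) : 1 ≤ sgpClass S.carrier :=
  (ncard_sgpLayer S.nilpotent S.coclass).1

theorem NilSgp.exists_param {S : NilSgp 1} (h : 3 ≤ sgpClass S.carrier) :
    ∃ P : SgpParam, P.c = sgpClass S.carrier ∧ Nonempty (ParamSgp P ≃* S.carrier) := by
  obtain ⟨a, ha⟩ := exists_mul_self_mem_sgpLayer S.nilpotent S.coclass h
  exact exists_paramSgp_mulEquiv S.nilpotent S.coclass (by omega) ha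

/-- In class two a non-zero square need not exist, so the algebra has to supply it. With `q = r = 0`
the product `xz` is the product of the coordinates at `e 0` times `e 1`. If all squares in `S` were
zero, this coordinate would vanish on the spanning set `S`, although it is 1 at `e 0`. -/
theorem NilSgp.exists_param_of_normalForm {S : NilSgp 1}
    (N : NormalForm K (ContrAlg K S.carrier) 2 0 0) :
    ∃ P : SgpParam, P.c = sgpClass S.carrier ∧ Nonempty (ParamSgp P ≃* S.carrier) := by
  have hc : sgpClass S.carrier = 2 := by rw [← algClass_contrAlg K, N.algClass_eq]
  have hzero := sgpPow_class S.nilpotent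
  rw [hc] at hzero
  suffices ∃ a : S.carrier, a * a ≠ 0 by
    obtain ⟨a, ha⟩ := this
    refine exists_paramSgp_mulEquiv S.nilpotent S.coclass (by omega) (a := a)
      ⟨mul_mem_sgpPow (m := 1) (n := 1) le_rfl le_rfl trivial trivial, fun h => ha ?_⟩
    rw [hzero] at h
    exact h
  by_contra! hsq
  have hmul : ∀ x z, x * z = (N.coord 0 x * N.coord 0 z) • N.e 1 := by
    intro x z
    have hx : ∀ w, w = N.coord 0 w • N.e 0 + N.coord 1 w • N.e 1 + N.coordY w • N.y := by
      intro w
      conv_lhs => rw [N.expand w]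
      simp [Finset.sum_range_succ]
    have h2 : N.e 2 = 0 := N.e_eq_zero 2 le_rfl
    have h3 : N.e 3 = 0 := N.e_eq_zero 3 (by omega)
    have hyy := N.y_mul_y
    have hy0 := N.y_mul_e
    have hy1 := N.y_mul_e_succ 0
    have hb := N.e_mul_y'
    have hee := N.mul_e
    conv_lhs => rw [hx x, hx z]
    simp only [add_mul, mul_add, smul_mul_assoc, mul_smul_comm, hee, hb, hy0, hyy, h2, h3,
      zero_add, smul_zero, zero_smul, add_zero, smul_smul, hy1]
    rw [mul_comm]
  have h0 : ∀ s : S.carrier, N.coord 0 (contrOf K s) = 0 := by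
    intro s
    have h := hmul (contrOf K s) (contrOf K s)
    rw [← contrOf_mul, hsq, contrOf_zero] at h
    exact mul_self_eq_zero.1 ((smul_eq_zero.1 h.symm).resolve_right (N.e_ne_zero (by omega)))
  have h1 : ∀ x, N.coord 0 x = 0 := by
    intro x
    induction x using contrAlg_induction with
    | hadd x z hx hz => rw [map_add, hx, hz, add_zero]
    | hsmul k x hx => rw [map_smul, hx, smul_zero]
    | hof s => exact h0 s
  have h2 := h1 (N.e 0)
  rw [N.coord_e 0 0 (by omega), if_pos rfl] at h2
  exact one_ne_zero h2

/-- Class two is treated apart, since such a semigroup need not be a parametrized one; there the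
quotient by the square suffices. -/
theorem NilSgp.nonempty_normalForm_powQuot (S : NilSgp 1) (h : 2 ≤ sgpClass S.carrier) :
    Nonempty (NormalForm K (powQuot K (ContrAlg K S.carrier) (sgpClass S.carrier))
      (sgpClass S.carrier - 1) 0 0) := by
  by_cases h2 : sgpClass S.carrier = 2
  · rw [h2]
    exact nonempty_normalForm_powQuot_two K S.nilpotent S.coclass
  · obtain ⟨P, hP, ⟨f⟩⟩ := S.exists_param (by omega)
    obtain ⟨N⟩ := ParamSgp.nonempty_normalForm K P f
    obtain ⟨m, hm⟩ := Nat.exists_eq_add_of_le' (show 1 ≤ P.c by omega)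
    rw [← hP, hm]
    rw [hm] at N
    exact N.powQuot_self (by omega)

/-- The quotient by the last non-zero power always has `q = r = 0`, so the parent depends on the
class alone. -/
theorem edge_iff {B C : Vertex K 1} :
    Edge K 1 B C ↔ 2 ≤ C.cls ∧ B.HasNormalForm (C.cls - 1) 0 0 := by
  constructor
  · rintro ⟨S, rfl, -, T, rfl, hT⟩
    rw [NilSgp.cls_vertex]
    rw [algClass_contrAlg] at hT
    have h1 := S.one_le_class
    -- In class one the quotient is zero, and the zero algebra does not have coclass 1.
    have h2 : 2 ≤ sgpClass S.carrier := by
      by_contra hlt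
      obtain ⟨f, hf⟩ := hT
      obtain ⟨x, hx⟩ := sgpLayer_nonempty T.nilpotent le_rfl T.one_le_class
      refine contrOf_ne_zero K (ne_zero_of_mem_sgpLayer hx) ?_
      obtain ⟨y, hy⟩ := hf.2 (contrOf K x)
      rw [← hy, ← map_zero f]
      congr 1
      have hc : sgpClass S.carrier = 1 := by omega
      obtain ⟨y, rfl⟩ := AlgIdeal.proj_surjective _ y
      refine (Submodule.Quotient.mk_eq_zero _).2 ?_
      show y ∈ algPow K _ (sgpClass S.carrier)
      rw [hc]
      trivial
    obtain ⟨N⟩ := S.nonempty_normalForm_powQuot (K := K) h2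
    exact ⟨h2, T, rfl, N.of_algIso hT⟩
  · rintro ⟨h2, hB⟩
    obtain ⟨S, rfl⟩ := C.exists_rep
    rw [NilSgp.cls_vertex] at h2 hB
    refine ⟨S, rfl, ?_, ?_⟩
    · rw [algClass_contrAlg]; omega
    · rw [algClass_contrAlg]
      obtain ⟨N⟩ := S.nonempty_normalForm_powQuot (K := K) h2
      exact hB.isTypeOf N

end Vertices

/-! ### The five kinds of algebras, their distinctness, and the tree they form. -/

section Kinds

universe u

/-- The kinds of algebras of coclass one and given class at least three. -/
inductive AlgKind
  | main | sqr | negSqr | skew | skewSqr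
  deriving DecidableEq

/-- The coefficient `q` of the normal form of the algebras of a kind. -/
def AlgKind.q (K : Type u) [Field K] : AlgKind → K
  | skew => 1
  | skewSqr => 1
  | _ => 0

/-- The coefficient `r` of the normal form of the algebras of a kind. -/
def AlgKind.r (K : Type u) [Field K] : AlgKind → K
  | sqr => 1
  | negSqr => -1
  | skewSqr => 1
  | _ => 0

/-- The parameters of a semigroup of class `n + 2` whose contracted algebra has the given kind. -/
def SgpParam.ofKind (n : ℕ) : AlgKind → SgpParam
  | .main => ⟨n + 2, n + 2, n + 2, n + 2, by omega, by omega, by omega, by omega, by omega,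
      by omega, by omega, by omega, by omega, by omega⟩
  | .sqr => ⟨n + 2, n + 2, n + 2, n + 1, by omega, by omega, by omega, by omega, by omega,
      by omega, by omega, by omega, by omega, by omega⟩
  | .negSqr => ⟨n + 2, (n + 3) / 2, (n + 3) / 2, n + 2, by omega, by omega, by omega, by omega,
      by omega, by omega, by omega, by omega, by omega, by omega⟩
  | .skew => ⟨n + 2, n + 2, n + 1, n + 2, by omega, by omega, by omega, by omega, by omega,
      by omega, by omega, by omega, by omega, by omega⟩
  | .skewSqr => ⟨n + 2, n + 2, n + 1, n + 1, by omega, by omega, by omega, by omega, by omega,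
      by omega, by omega, by omega, by omega, by omega⟩

theorem SgpParam.ofKind_c (n : ℕ) (κ : AlgKind) : (SgpParam.ofKind n κ).c = n + 2 := by
  cases κ <;> rfl

/-- The kind of the contracted algebra of a parametrized semigroup. -/
noncomputable def SgpParam.kind (K : Type u) [Field K] (P : SgpParam) : AlgKind := by
  classical
  exact
    if P.j = P.k then
      -- For `j = k` this says that `a^(l+1)` and `a^(2j)` coincide, that is, `r = 0`.
      if P.l = min (2 * P.j - 1) P.c then .main
      -- Now either `l = c - 1` and `r = 1`, or `2j = c`, `l = c` and `r = -1`; in the latter case a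
      -- square root of `-1` rescales `r` to `1`.
      else if P.l = P.c - 1 ∨ IsSquare (-1 : K) then .sqr else .negSqr
    else if P.l = P.c then .skew else .skewSqr

variable (K : Type u) [Field K]

/-- The condition for a separate isomorphism type of algebras of kind `negSqr` and class `n + 2`. -/
def AlgKind.IsValid (n : ℕ) (κ : AlgKind) : Prop :=
  κ = .negSqr → Even n ∧ ¬ IsSquare (-1 : K)

theorem SgpParam.kind_isValid {P : SgpParam} {n : ℕ} (hc : P.c = n + 2) :
    (P.kind K).IsValid K n := by
  classical
  intro h
  unfold SgpParam.kind at h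
  obtain ⟨c, j, k, l, h1, h2, h3, h4, h5, h6, h7, hjk, hjl, hkl⟩ := P
  simp only at h hc
  split_ifs at h with e1 e2 e3
  rw [not_or] at e3
  refine ⟨?_, e3.2⟩
  have : n = 2 * (j - 1) := by omega
  exact ⟨j - 1, by omega⟩

/-- Only three scalings of `y` are needed: by `1`, by `-1` to turn `q = -1` into `1`, and by a
square root of `-1` to turn `r = -1` into `1`. -/
theorem SgpParam.nonempty_normalForm_kind {S : NilSgp 1} (P : SgpParam)
    (f : ParamSgp P ≃* S.carrier) :
    Nonempty (NormalForm K (ContrAlg K S.carrier) P.c ((P.kind K).q K) ((P.kind K).r K)) := by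
  classical
  obtain ⟨N⟩ := ParamSgp.nonempty_normalForm K P f
  have hscale : ∀ (κ : AlgKind) (t : K), t ≠ 0 → t * P.q K = κ.q K → t ^ 2 * P.r K = κ.r K →
      Nonempty (NormalForm K (ContrAlg K S.carrier) P.c (κ.q K) (κ.r K)) := by
    intro κ t ht hq hr
    rw [← hq, ← hr]
    exact ⟨N.scale t ht⟩
  clear N f
  unfold SgpParam.kind
  obtain ⟨c, j, k, l, h1, h2, h3, h4, h5, h6, h7, hjk, hjl, hkl⟩ := P
  simp only [SgpParam.q, SgpParam.r] at *
  by_cases hjk' : j = k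
  · subst hjk'
    by_cases hl : l = min (2 * j - 1) c
    · rw [if_pos rfl, if_pos hl]
      refine hscale _ 1 one_ne_zero (by simp [AlgKind.q]) ?_
      have : l = c - 1 ↔ j + j = c := by omega
      simp [AlgKind.r, this]
    · rw [if_pos rfl, if_neg hl]
      by_cases hlc : l = c - 1
      · rw [if_pos (Or.inl hlc)]
        refine hscale _ 1 one_ne_zero (by simp [AlgKind.q]) ?_
        have : ¬ j + j = c := by omega
        simp [AlgKind.r, this, hlc]
      · have hc : j + j = c := by omega
        by_cases hsq : IsSquare (-1 : K)
        · rw [if_pos (Or.inr hsq)]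
          obtain ⟨t, ht⟩ := hsq
          have ht0 : t ≠ 0 := by
            rintro rfl
            simp at ht
          refine hscale _ t ht0 (by simp [AlgKind.q]) ?_
          rw [if_neg hlc, if_pos hc, sq, ← ht]
          simp [AlgKind.r]
        · rw [if_neg (by rw [not_or]; exact ⟨hlc, hsq⟩)]
          refine hscale _ 1 one_ne_zero (by simp [AlgKind.q]) ?_
          rw [if_neg hlc, if_pos hc]
          simp [AlgKind.r]
  · rw [if_neg hjk']
    have hc : ¬ j + k = c := by omega
    have hq : ∃ t : K, t ≠ 0 ∧
        t * ((if k = c - 1 then 1 else 0) - if j = c - 1 then 1 else 0) = 1 ∧ t ^ 2 = 1 := by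
      by_cases hk : k = c - 1
      · have hj : ¬ j = c - 1 := by omega
        exact ⟨1, one_ne_zero, by simp [hk, hj], by simp⟩
      · have hj : j = c - 1 := by omega
        exact ⟨-1, by simp, by simp [hk, hj], by simp⟩
    obtain ⟨t, ht0, ht, ht2⟩ := hq
    by_cases hl : l = c
    · rw [if_pos hl]
      have : ¬ l = c - 1 := by omega
      exact hscale _ t ht0 ht (by simp [AlgKind.r, this, hc])
    · rw [if_neg hl]
      have : l = c - 1 := by omega
      exact hscale _ t ht0 ht (by rw [ht2, if_pos this, if_neg hc]; simp [AlgKind.r])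

variable {K}

theorem SgpParam.kind_eq_main {P : SgpParam} :
    P.kind K = .main ↔ P.j = P.k ∧ P.l = min (2 * P.j - 1) P.c := by
  unfold SgpParam.kind
  split_ifs <;> simp only [false_iff, true_iff] <;> omega

theorem SgpParam.kind_eq_skew {P : SgpParam} : P.kind K = .skew ↔ P.j ≠ P.k ∧ P.l = P.c := by
  unfold SgpParam.kind
  split_ifs <;> simp [*]

theorem SgpParam.kind_eq_skewSqr {P : SgpParam} :
    P.kind K = .skewSqr ↔ P.j ≠ P.k ∧ P.l + 1 = P.c := by
  have h1 := P.jl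
  have h2 := P.kl
  have h3 := P.jk
  have h4 := P.l_le
  have h5 := P.two_le
  unfold SgpParam.kind
  split_ifs <;> simp only [false_iff, true_iff] <;> omega

theorem SgpParam.kind_eq_negSqr {P : SgpParam} :
    P.kind K = .negSqr ↔ P.j = P.k ∧ 2 * P.j = P.c ∧ P.l = P.c ∧ ¬ IsSquare (-1 : K) := by
  have h1 := P.jl
  have h4 := P.l_le
  have h5 := P.two_le
  have h6 := P.one_le_j
  unfold SgpParam.kind
  split_ifs with e1 e2 e3 <;> simp only [false_iff, true_iff]
  · omega
  · rintro ⟨-, -, h, h'⟩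
    rcases e3 with e3 | e3
    · omega
    · exact h' e3
  · rw [not_or] at e3
    exact ⟨e1, by omega, by omega, e3.2⟩
  · tauto
  · tauto

theorem SgpParam.kind_eq_sqr {P : SgpParam} :
    P.kind K = .sqr ↔ (P.j = P.k ∧ P.l + 1 = P.c ∧ P.c < 2 * P.j) ∨
      (P.j = P.k ∧ 2 * P.j = P.c ∧ P.l = P.c ∧ IsSquare (-1 : K)) := by
  have h1 := P.jl
  have h4 := P.l_le
  have h5 := P.two_le
  have h6 := P.one_le_j
  unfold SgpParam.kind
  split_ifs with e1 e2 e3 <;> simp only [false_iff, true_iff]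
  · omega
  · by_cases h : P.l = P.c - 1
    · exact Or.inl ⟨e1, by omega, by omega⟩
    · exact Or.inr ⟨e1, by omega, by omega, e3.resolve_left h⟩
  · rw [not_or] at e3
    rintro (⟨-, h, -⟩ | ⟨-, -, -, h⟩)
    · omega
    · exact e3.2 h
  · tauto
  · tauto

theorem SgpParam.kind_ofKind {n : ℕ} {κ : AlgKind} (h : κ.IsValid K n) :
    (SgpParam.ofKind n κ).kind K = κ := by
  cases κ
  · refine SgpParam.kind_eq_main.2 ⟨rfl, ?_⟩
    show n + 2 = min (2 * (n + 2) - 1) (n + 2)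
    omega
  · refine SgpParam.kind_eq_sqr.2 (Or.inl ⟨rfl, rfl, ?_⟩)
    show n + 2 < 2 * (n + 2)
    omega
  · obtain ⟨⟨m, hm⟩, h2⟩ := h rfl
    refine SgpParam.kind_eq_negSqr.2 ⟨rfl, ?_, rfl, h2⟩
    show 2 * ((n + 3) / 2) = n + 2
    omega
  · refine SgpParam.kind_eq_skew.2 ⟨?_, rfl⟩
    show n + 2 ≠ n + 1
    omega
  · refine SgpParam.kind_eq_skewSqr.2 ⟨?_, rfl⟩
    show n + 2 ≠ n + 1
    omega

variable (K) in
/-- The vertex of class `n + 2` and the given kind. -/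
noncomputable def kindVertex (n : ℕ) (κ : AlgKind) : Vertex K 1 :=
  (SgpParam.ofKind n κ).nilSgp.vertex K

theorem kindVertex_hasNormalForm {n : ℕ} {κ : AlgKind} (h : κ.IsValid K n) :
    (kindVertex K n κ).HasNormalForm (n + 2) (κ.q K) (κ.r K) := by
  obtain N := (SgpParam.ofKind n κ).nonempty_normalForm_kind K
    (S := (SgpParam.ofKind n κ).nilSgp) (MulEquiv.refl _)
  rw [SgpParam.kind_ofKind h, SgpParam.ofKind_c] at N
  exact ⟨_, rfl, N⟩

theorem cls_kindVertex (n : ℕ) (κ : AlgKind) : (kindVertex K n κ).cls = n + 2 := by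
  obtain N := (SgpParam.ofKind n κ).nonempty_normalForm_kind K
    (S := (SgpParam.ofKind n κ).nilSgp) (MulEquiv.refl _)
  rw [SgpParam.ofKind_c] at N
  exact Vertex.HasNormalForm.cls_eq ⟨_, rfl, N⟩

theorem NilSgp.vertex_eq_kindVertex {S : NilSgp 1} {P : SgpParam} (f : ParamSgp P ≃* S.carrier)
    {n : ℕ} (hn : P.c = n + 2) : S.vertex K = kindVertex K n (P.kind K) := by
  have h := P.nonempty_normalForm_kind K f
  rw [hn] at h
  exact Vertex.HasNormalForm.unique ⟨S, rfl, h⟩ (kindVertex_hasNormalForm (P.kind_isValid K hn))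

theorem Vertex.exists_eq_kindVertex {V : Vertex K 1} {n : ℕ} (hn : 1 ≤ n) (hV : V.cls = n + 2) :
    ∃ κ : AlgKind, κ.IsValid K n ∧ V = kindVertex K n κ := by
  obtain ⟨S, rfl⟩ := V.exists_rep
  rw [NilSgp.cls_vertex] at hV
  obtain ⟨P, hP, ⟨f⟩⟩ := S.exists_param (by omega)
  exact ⟨P.kind K, P.kind_isValid K (hP.trans hV), NilSgp.vertex_eq_kindVertex f (hP.trans hV)⟩

/-- Class, commutativity and the annihilator condition determine `n` and the vanishing of `q` and
`r`. Only `sqr` and `negSqr` then remain to be separated, which uses class at least four. For `n =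
0` only comparisons with `main` are made, and these are settled by `q` and `r`. -/
theorem kindVertex_injective {n n' : ℕ} {κ κ' : AlgKind} (h : κ.IsValid K n) (h' : κ'.IsValid K n')
    (hn : κ = .main ∨ 1 ≤ n) (heq : kindVertex K n κ = kindVertex K n' κ') : n = n' ∧ κ = κ' := by
  have hcls := congrArg Vertex.cls heq
  rw [cls_kindVertex, cls_kindVertex] at hcls
  obtain rfl : n = n' := by omega
  refine ⟨rfl, ?_⟩
  have H := kindVertex_hasNormalForm h
  have H' := kindVertex_hasNormalForm h'
  rw [← heq] at H'
  obtain ⟨S, hS⟩ := (kindVertex K n κ).exists_rep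
  rw [← hS] at H H'
  obtain ⟨N⟩ := H.of_vertex
  obtain ⟨N'⟩ := H'.of_vertex
  have hq : κ.q K = 0 ↔ κ'.q K = 0 := N.q_eq_zero_iff.trans N'.q_eq_zero_iff.symm
  have hr : κ.r K = 0 ↔ κ'.r K = 0 :=
    (N.r_eq_zero_iff (by omega)).trans (N'.r_eq_zero_iff (by omega)).symm
  have hsq : ∀ {κ₁ κ₂ : AlgKind}, κ₂.IsValid K n → 1 ≤ n → κ₁ = .sqr → κ₂ = .negSqr →
      NormalForm K (ContrAlg K S.carrier) (n + 2) (κ₁.q K) (κ₁.r K) →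
      NormalForm K (ContrAlg K S.carrier) (n + 2) (κ₂.q K) (κ₂.r K) → False := by
    rintro _ _ hv hn rfl rfl M M'
    obtain ⟨⟨m, hm⟩, h2⟩ := hv rfl
    exact h2 (NormalForm.isSquare_neg_one M M' (m := m + 1) (by omega) (by omega))
  cases κ <;> cases κ' <;> first
    | rfl
    | (simp [AlgKind.q] at hq; done)
    | (simp [AlgKind.r] at hr; done)
    | exact (hsq h' (hn.resolve_left (by decide)) rfl rfl N N').elim
    | exact (hsq h (hn.resolve_left (by decide)) rfl rfl N' N).elim

/-- The vertices of the main path. -/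
noncomputable def mainVertex (K : Type u) [Field K] : ℕ → Vertex K 1
  | 0 => zeroNilSgp.vertex K
  | n + 1 => kindVertex K n .main

theorem AlgKind.isValid_main (n : ℕ) : AlgKind.main.IsValid K n := fun h => by cases h

theorem NilSgp.hasNormalForm_of_class_one {S : NilSgp 1} (h : sgpClass S.carrier = 1) :
    (S.vertex K).HasNormalForm 1 0 0 := by
  refine ⟨S, rfl, ?_⟩
  obtain ⟨N⟩ := nonempty_normalForm_powQuot_two K S.nilpotent S.coclass
  refine N.of_algIso (algIso_powQuot K ?_).symm
  rw [algPow_contrAlg_eq_bot_iff]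
  have := sgpPow_class S.nilpotent
  rwa [h] at this

theorem sgpClass_zeroNilSgp : sgpClass zeroNilSgp.carrier = 1 := by
  have h := zeroNilSgp.coclass
  have h2 : Nat.card {x : zeroNilSgp.carrier // x ≠ 0} = 2 := by
    show Nat.card {x : Fin 3 // x ≠ 0} = 2
    rw [Nat.card_eq_fintype_card]
    rfl
  omega

theorem mainVertex_hasNormalForm (n : ℕ) : (mainVertex K n).HasNormalForm (n + 1) 0 0 := by
  cases n with
  | zero => exact NilSgp.hasNormalForm_of_class_one sgpClass_zeroNilSgp
  | succ n => exact kindVertex_hasNormalForm (AlgKind.isValid_main n)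

theorem edge_iff_eq_mainVertex {B C : Vertex K 1} {n : ℕ} (hC : C.cls = n + 2) :
    Edge K 1 B C ↔ B = mainVertex K n := by
  rw [edge_iff, hC]
  constructor
  · rintro ⟨-, h⟩
    exact h.unique (mainVertex_hasNormalForm n)
  · rintro rfl
    exact ⟨by omega, mainVertex_hasNormalForm n⟩

theorem Edge.exists_cls_eq {B C : Vertex K 1} (h : Edge K 1 B C) : ∃ n, C.cls = n + 2 :=
  Nat.exists_eq_add_of_le' (edge_iff.1 h).1

theorem edge_kindVertex {B : Vertex K 1} {n : ℕ} {κ : AlgKind} :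
    Edge K 1 B (kindVertex K n κ) ↔ B = mainVertex K n :=
  edge_iff_eq_mainVertex (cls_kindVertex n κ)

theorem edge_mainVertex (n : ℕ) : Edge K 1 (mainVertex K n) (mainVertex K (n + 1)) :=
  edge_kindVertex.2 rfl

theorem cls_mainVertex (n : ℕ) : (mainVertex K n).cls = n + 1 :=
  (mainVertex_hasNormalForm n).cls_eq

theorem mainVertex_mem_treeAt {m n : ℕ} (h : m ≤ n) :
    mainVertex K n ∈ treeAt (Edge K 1) (mainVertex K m) := by
  induction n, h using Nat.le_induction with
  | base => exact Relation.ReflTransGen.refl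
  | succ n _ ih => exact Relation.ReflTransGen.tail ih (edge_mainVertex n)

theorem isRootedTree : IsRootedTree (Edge K 1) (mainVertex K 0) where
  root B h := by
    have := (edge_iff.1 h).1
    rw [cls_mainVertex] at this
    omega
  reach B := by
    obtain ⟨S, rfl⟩ := B.exists_rep
    have h1 := S.one_le_class
    by_cases hc : sgpClass S.carrier = 1
    · rw [(NilSgp.hasNormalForm_of_class_one hc).unique (mainVertex_hasNormalForm 0)]
      exact Relation.ReflTransGen.refl
    · obtain ⟨n, hn⟩ := Nat.exists_eq_add_of_le' (show 2 ≤ sgpClass S.carrier by omega)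
      exact Relation.ReflTransGen.tail (mainVertex_mem_treeAt (Nat.zero_le n))
        ((edge_iff_eq_mainVertex (C := S.vertex K) hn).2 rfl)
  parent_unique B C D hB hC := by
    obtain ⟨n, hn⟩ := hB.exists_cls_eq
    rw [edge_iff_eq_mainVertex hn] at hB hC
    rw [hB, hC]

/-- Each edge raises the class by one, and a vertex with a child is the main vertex of its class; so
every step of the path is forced. -/
theorem IsInfPathFrom.eq_mainVertex {p : ℕ → Vertex K 1}
    (hp : IsInfPathFrom (Edge K 1) (mainVertex K 0) p) : p = mainVertex K := by
  have hcls : ∀ i, (p i).cls = i + 1 := by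
    intro i
    induction i with
    | zero => rw [hp.1, cls_mainVertex]
    | succ i ih =>
      obtain ⟨n, hn⟩ := (hp.2 i).exists_cls_eq
      have h := (edge_iff_eq_mainVertex hn).1 (hp.2 i)
      rw [h, cls_mainVertex] at ih
      omega
  funext i
  exact (edge_iff_eq_mainVertex (hcls (i + 1))).1 (hp.2 i)

theorem isMaximalCoclassTree : IsMaximalCoclassTree (Edge K 1) (mainVertex K 0) :=
  ⟨⟨mainVertex K, ⟨rfl, edge_mainVertex⟩, fun _ hp => hp.eq_mainVertex⟩, Or.inl isRootedTree.root⟩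

theorem eq_of_isRootVertex {R : Vertex K 1} (hR : IsRootVertex (Edge K 1) R) :
    R = mainVertex K 0 := by
  rcases Relation.ReflTransGen.cases_tail (isRootedTree.reach R) with h | ⟨B, -, h⟩
  · exact h
  · exact absurd h (hR B)

/-- With one root and one infinite path from it, no vertex lies on two such paths, so only the root
can qualify. -/
theorem IsMaximalCoclassTree.eq_mainVertex {R : Vertex K 1}
    (hR : IsMaximalCoclassTree (Edge K 1) R) : R = mainVertex K 0 := by
  rcases hR.2 with h | ⟨P, -, p, q, hpq, hp, hq⟩
  · exact eq_of_isRootVertex h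
  · refine absurd ?_ hpq
    have hp' : IsInfPathFrom (Edge K 1) (mainVertex K 0) p := ⟨eq_of_isRootVertex hp.1, hp.2.1⟩
    have hq' : IsInfPathFrom (Edge K 1) (mainVertex K 0) q := ⟨eq_of_isRootVertex hq.1, hq.2.1⟩
    rw [hp'.eq_mainVertex, hq'.eq_mainVertex]

theorem describesPath : DescribesPath K 1 (mainVertex K) (AlgM K 1) := by
  refine ⟨AlgM.hasInfCoclass, zeroNilSgp, rfl, fun j => ?_⟩
  rw [algClass_contrAlg, sgpClass_zeroNilSgp]
  obtain ⟨N⟩ := AlgM.nonempty_normalForm_powQuot (K := K) (show 1 ≤ j + 1 by omega)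
  exact (mainVertex_hasNormalForm j).isTypeOf N

variable (K) in
/-- The codes of the vertices of the tree at the main vertex of class `n + 2`. -/
def IsTreeCode (n : ℕ) (x : ℕ × AlgKind) : Prop :=
  n ≤ x.1 ∧ (x.1 = n → x.2 = .main) ∧ x.2.IsValid K x.1

/-- Every vertex of class greater than `n + 2` has its parent on the main path, at class at least `n
+ 2`, and so belongs to the tree. In class `n + 2` itself only the starting vertex does. -/
theorem mem_treeAt_iff {n : ℕ} {V : Vertex K 1} :
    V ∈ treeAt (Edge K 1) (kindVertex K n .main) ↔
      ∃ x : ℕ × AlgKind, IsTreeCode K n x ∧ V = kindVertex K x.1 x.2 := by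
  constructor
  · intro h
    induction h with
    | refl => exact ⟨(n, .main), ⟨le_rfl, fun _ => rfl, AlgKind.isValid_main n⟩, rfl⟩
    | @tail B C _ hBC ih =>
      obtain ⟨⟨m, κ⟩, hx, rfl⟩ := ih
      obtain ⟨d, hd⟩ := hBC.exists_cls_eq
      have h := congrArg Vertex.cls ((edge_iff_eq_mainVertex hd).1 hBC)
      rw [cls_kindVertex, cls_mainVertex] at h
      obtain ⟨κ', hκ', rfl⟩ := Vertex.exists_eq_kindVertex (by omega) hd
      have hm : n ≤ m := hx.1
      exact ⟨(d, κ'), ⟨by show n ≤ d; omega, fun hdn => by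
        replace hdn : d = n := hdn
        omega, hκ'⟩, rfl⟩
  · rintro ⟨⟨m, κ⟩, ⟨hm, hmn, hκ⟩, rfl⟩
    simp only at hm hmn hκ
    by_cases h : m = n
    · rw [hmn h, h]; exact Relation.ReflTransGen.refl
    · obtain ⟨d, rfl⟩ := Nat.exists_eq_add_of_le' (show 1 ≤ m by omega)
      exact Relation.ReflTransGen.tail
        (mainVertex_mem_treeAt (show n + 1 ≤ d + 1 by omega)) (edge_kindVertex.2 rfl)

theorem IsTreeCode.eq_of_kindVertex_eq {n n' : ℕ} {x x' : ℕ × AlgKind} (h : IsTreeCode K n x)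
    (h' : IsTreeCode K n' x') (heq : kindVertex K x.1 x.2 = kindVertex K x'.1 x'.2) : x = x' := by
  obtain ⟨h1, h2⟩ := kindVertex_injective h.2.2 h'.2.2 (by
    by_cases h0 : x.1 = n
    · exact Or.inl (h.2.1 h0)
    · have := h.1
      exact Or.inr (by omega)) heq
  exact Prod.ext h1 h2

end Kinds

/-! ### Labels as numbers of parameter triples. -/

section Labels

universe u

variable {K : Type u} [Field K]

theorem NilSgp.exists_param_of_vertex {S : NilSgp 1} {n : ℕ} {κ : AlgKind} (hκ : κ = .main ∨ 1 ≤ n)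
    (hS : S.vertex K = kindVertex K n κ) :
    ∃ P : SgpParam, P.c = n + 2 ∧ Nonempty (ParamSgp P ≃* S.carrier) := by
  have hc : sgpClass S.carrier = n + 2 := by
    have := congrArg Vertex.cls hS
    rwa [cls_kindVertex, NilSgp.cls_vertex] at this
  rw [← hc]
  by_cases hn : 1 ≤ n
  · exact S.exists_param (by omega)
  · obtain rfl := hκ.resolve_right hn
    obtain rfl : n = 0 := by omega
    have h := kindVertex_hasNormalForm (K := K) (AlgKind.isValid_main 0)
    rw [← hS] at h
    obtain ⟨N⟩ := h.of_vertex
    exact NilSgp.exists_param_of_normalForm (K := K) N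

theorem SgpParam.vertex_eq_iff {P : SgpParam} {n : ℕ} (hc : P.c = n + 2) {κ : AlgKind}
    (hv : κ.IsValid K n) (hκ : κ = .main ∨ 1 ≤ n) :
    P.nilSgp.vertex K = kindVertex K n κ ↔ P.kind K = κ := by
  rw [NilSgp.vertex_eq_kindVertex (S := P.nilSgp) (MulEquiv.refl _) hc]
  constructor
  · intro h
    exact (kindVertex_injective hv (P.kind_isValid K hc) hκ h.symm).2.symm
  · rintro rfl
    rfl

/-- The label of a vertex counts the parameters of semigroups of the given kind. -/
theorem vertexLabel_kindVertex {n : ℕ} {κ : AlgKind} (hv : κ.IsValid K n)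
    (hκ : κ = .main ∨ 1 ≤ n) (F : Finset (ℕ × ℕ × ℕ))
    (hF : ∀ P : SgpParam, P.c = n + 2 → (P.kind K = κ ↔ (P.j, P.k, P.l) ∈ F))
    (hF' : ∀ t ∈ F, ∃ P : SgpParam, P.c = n + 2 ∧ (P.j, P.k, P.l) = t) :
    vertexLabel K 1 (kindVertex K n κ) = F.card := by
  let X : Set SgpParam := {P | P.c = n + 2 ∧ P.kind K = κ}
  have h1 : {s : Quotient (sgpSetoid 1) |
      ∃ S : NilSgp 1, Quotient.mk (sgpSetoid 1) S = s ∧ S.vertex K = kindVertex K n κ} =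
      (fun P : SgpParam => Quotient.mk (sgpSetoid 1) P.nilSgp) '' X := by
    ext s
    constructor
    · rintro ⟨S, rfl, hS⟩
      obtain ⟨P, hP, ⟨f⟩⟩ := NilSgp.exists_param_of_vertex hκ hS
      have hPS : Quotient.mk (sgpSetoid 1) P.nilSgp = Quotient.mk (sgpSetoid 1) S :=
        Quotient.sound ⟨f⟩
      refine ⟨P, ⟨hP, ?_⟩, hPS⟩
      have h := NilSgp.vertex_eq_kindVertex (K := K) f hP
      rw [hS] at h
      exact (kindVertex_injective hv (P.kind_isValid K hP) hκ h).2.symm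
    · rintro ⟨P, ⟨hP, hk⟩, rfl⟩
      exact ⟨P.nilSgp, rfl, (P.vertex_eq_iff hP hv hκ).2 hk⟩
  have h2 : Set.InjOn (fun P : SgpParam => Quotient.mk (sgpSetoid 1) P.nilSgp) X := by
    rintro P ⟨hP, hk⟩ P' ⟨hP', hk'⟩ h
    obtain ⟨f⟩ : Nonempty (ParamSgp P ≃* ParamSgp P') := Quotient.exact h
    rcases ParamSgp.param_eq_of_mulEquiv (hP.trans hP'.symm) f with h | ⟨hc, hj⟩
    · exact h
    -- Generators can be exchanged only in class two, where the kind is `main`. Then `j = k` and `l`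
    -- is a function of `j`, so the exchange changes no parameter.
    · obtain rfl := hκ.resolve_right (by omega)
      rw [SgpParam.kind_eq_main] at hk hk'
      exact SgpParam.ext (hP.trans hP'.symm) (by omega) (by omega) (by
        have : P.j = P'.j := by omega
        rw [hk.2, hk'.2, this, hP, hP'])
  have h3 : Set.InjOn (fun P : SgpParam => (P.j, P.k, P.l)) X := by
    rintro P ⟨hP, -⟩ P' ⟨hP', -⟩ h
    simp only [Prod.mk.injEq] at h
    exact SgpParam.ext (hP.trans hP'.symm) h.1 h.2.1 h.2.2
  have h4 : (fun P : SgpParam => (P.j, P.k, P.l)) '' X = (F : Set (ℕ × ℕ × ℕ)) := by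
    ext t
    constructor
    · rintro ⟨P, ⟨hP, hk⟩, rfl⟩
      exact (hF P hP).1 hk
    · intro ht
      obtain ⟨P, hP, rfl⟩ := hF' t ht
      exact ⟨P, ⟨hP, (hF P hP).2 ht⟩, rfl⟩
  rw [vertexLabel, h1, h2.encard_image, ← h3.encard_image, h4, Set.encard_coe_eq_coe_finsetCard]

/-- The number of semigroups of class `n + 2` whose contracted algebra has the given kind. -/
noncomputable def kindCount (K : Type u) [Field K] (n : ℕ) : AlgKind → ℕ := by
  classical
  exact fun
    | .main => n + 2
    -- One triple for each `j` with `c < 2j` and `j ≤ c`, and, if `-1` is a square, one more with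
    -- `2j = c` and `l = c`.
    | .sqr => (n + 2) - (n + 2) / 2 + if Even n ∧ IsSquare (-1 : K) then 1 else 0
    | .negSqr => 1
    | .skew => 2
    | .skewSqr => 2

theorem vertexLabel_eq_kindCount {n : ℕ} {κ : AlgKind} (hv : κ.IsValid K n)
    (hκ : κ = .main ∨ 1 ≤ n) : vertexLabel K 1 (kindVertex K n κ) = kindCount K n κ := by
  classical
  cases κ
  · rw [vertexLabel_kindVertex hv hκ
      ((Finset.Icc 1 (n + 2)).image fun j => (j, j, min (2 * j - 1) (n + 2)))]
    · rw [Finset.card_image_of_injective _ fun a b h => (Prod.mk.injEq .. ▸ h).1]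
      simp [kindCount]
    · intro P hP
      have h1 := P.one_le_j
      have h2 := P.j_le
      rw [SgpParam.kind_eq_main, Finset.mem_image, hP]
      constructor
      · rintro ⟨h3, h4⟩
        exact ⟨P.j, Finset.mem_Icc.2 ⟨h1, by omega⟩, by rw [← h4, ← h3]⟩
      · rintro ⟨j, -, h⟩
        simp only [Prod.mk.injEq] at h
        omega
    · intro t ht
      obtain ⟨j, hj, rfl⟩ := Finset.mem_image.1 ht
      rw [Finset.mem_Icc] at hj
      exact ⟨⟨n + 2, j, j, min (2 * j - 1) (n + 2), by omega, by omega, by omega, by omega,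
        by omega, by omega, by omega, by omega, by omega, by omega⟩, rfl, rfl⟩
  · rw [vertexLabel_kindVertex hv hκ
      (((Finset.Icc ((n + 2) / 2 + 1) (n + 2)).image fun j => (j, j, n + 1)) ∪
        if Even n ∧ IsSquare (-1 : K) then {(n / 2 + 1, n / 2 + 1, n + 2)} else ∅)]
    · rw [Finset.card_union_of_disjoint,
        Finset.card_image_of_injective _ fun a b h => (Prod.mk.injEq .. ▸ h).1, Nat.card_Icc,
        kindCount]
      · congr 1
        norm_cast
        split_ifs
        · rw [Finset.card_singleton]; omega
        · rw [Finset.card_empty]; omega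
      · refine Finset.disjoint_left.2 fun t ht ht' => ?_
        obtain ⟨j, -, rfl⟩ := Finset.mem_image.1 ht
        split_ifs at ht' with h
        · simp at ht'
        · simp at ht'
    · intro P hP
      have h2 := P.j_le
      rw [SgpParam.kind_eq_sqr, Finset.mem_union, Finset.mem_image, hP]
      refine or_congr ⟨?_, ?_⟩ ⟨?_, ?_⟩
      · rintro ⟨h3, h4, h5⟩
        exact ⟨P.j, Finset.mem_Icc.2 ⟨by omega, by omega⟩, by
          rw [← h3]; congr 2; omega⟩
      · rintro ⟨j, hj, h⟩
        simp only [Prod.mk.injEq] at h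
        rw [Finset.mem_Icc] at hj
        omega
      · rintro ⟨h3, h4, h5, h6⟩
        have he : Even n := ⟨P.j - 1, by omega⟩
        rw [if_pos ⟨he, h6⟩, Finset.mem_singleton, ← h3, h5]
        have : P.j = n / 2 + 1 := by omega
        rw [this]
      · intro h
        split_ifs at h with h'
        · rw [Finset.mem_singleton] at h
          simp only [Prod.mk.injEq] at h
          obtain ⟨⟨m, hm⟩, hs⟩ := h'
          exact ⟨by omega, by omega, by omega, hs⟩
        · simp at h
    · intro t ht
      rcases Finset.mem_union.1 ht with ht | ht
      · obtain ⟨j, hj, rfl⟩ := Finset.mem_image.1 ht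
        rw [Finset.mem_Icc] at hj
        exact ⟨⟨n + 2, j, j, n + 1, by omega, by omega, by omega, by omega,
          by omega, by omega, by omega, by omega, by omega, by omega⟩, rfl, rfl⟩
      · split_ifs at ht with h'
        · rw [Finset.mem_singleton] at ht
          obtain ⟨⟨m, hm⟩, -⟩ := h'
          exact ⟨⟨n + 2, n / 2 + 1, n / 2 + 1, n + 2, by omega, by omega, by omega, by omega,
            by omega, by omega, by omega, by omega, by omega, by omega⟩, rfl, ht.symm⟩
        · simp at ht
  · obtain ⟨⟨m, hm⟩, hs⟩ := hv rfl
    rw [vertexLabel_kindVertex hv hκ {(n / 2 + 1, n / 2 + 1, n + 2)}]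
    · rfl
    · intro P hP
      rw [SgpParam.kind_eq_negSqr, Finset.mem_singleton, hP]
      simp only [Prod.mk.injEq]
      constructor
      · rintro ⟨h1, h2, h3, -⟩
        omega
      · rintro ⟨h1, h2, h3⟩
        exact ⟨by omega, by omega, h3, hs⟩
    · intro t ht
      rw [Finset.mem_singleton] at ht
      exact ⟨⟨n + 2, n / 2 + 1, n / 2 + 1, n + 2, by omega, by omega, by omega, by omega,
        by omega, by omega, by omega, by omega, by omega, by omega⟩, rfl, ht.symm⟩
  · rw [vertexLabel_kindVertex hv hκ {(n + 1, n + 2, n + 2), (n + 2, n + 1, n + 2)}]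
    · rw [Finset.card_pair (by simp)]; rfl
    · intro P hP
      have h1 := P.jk
      have h2 := P.j_le
      have h3 := P.k_le
      rw [SgpParam.kind_eq_skew, Finset.mem_insert, Finset.mem_singleton, hP]
      simp only [Prod.mk.injEq]
      omega
    · intro t ht
      rw [Finset.mem_insert, Finset.mem_singleton] at ht
      rcases ht with ht | ht
      · exact ⟨⟨n + 2, n + 1, n + 2, n + 2, by omega, by omega, by omega, by omega,
          by omega, by omega, by omega, by omega, by omega, by omega⟩, rfl, ht.symm⟩
      · exact ⟨⟨n + 2, n + 2, n + 1, n + 2, by omega, by omega, by omega, by omega,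
          by omega, by omega, by omega, by omega, by omega, by omega⟩, rfl, ht.symm⟩
  · rw [vertexLabel_kindVertex hv hκ {(n + 1, n + 2, n + 1), (n + 2, n + 1, n + 1)}]
    · rw [Finset.card_pair (by simp)]; rfl
    · intro P hP
      have h1 := P.jk
      have h2 := P.j_le
      have h3 := P.k_le
      rw [SgpParam.kind_eq_skewSqr, Finset.mem_insert, Finset.mem_singleton, hP]
      simp only [Prod.mk.injEq]
      omega
    · intro t ht
      rw [Finset.mem_insert, Finset.mem_singleton] at ht
      rcases ht with ht | ht
      · exact ⟨⟨n + 2, n + 1, n + 2, n + 1, by omega, by omega, by omega, by omega,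
          by omega, by omega, by omega, by omega, by omega, by omega⟩, rfl, ht.symm⟩
      · exact ⟨⟨n + 2, n + 2, n + 1, n + 1, by omega, by omega, by omega, by omega,
          by omega, by omega, by omega, by omega, by omega, by omega⟩, rfl, ht.symm⟩

/-- The labels are linear along the orbits of the shift by two classes. -/
theorem kindCount_add (n : ℕ) (κ : AlgKind) : ∃ s : ℕ, ∀ i : ℕ,
    kindCount K (n + 2 * i) κ = kindCount K n κ + s * i := by
  classical
  have he : ∀ i, Even (n + 2 * i) ↔ Even n := fun i => by
    rw [Nat.even_add]; simp
  cases κ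
  · exact ⟨2, fun i => by show n + 2 * i + 2 = n + 2 + 2 * i; omega⟩
  -- Raising the class by two adds one to `c - c / 2` and keeps the parity.
  · refine ⟨1, fun i => ?_⟩
    simp only [kindCount, he]
    omega
  · exact ⟨0, fun i => by simp [kindCount]⟩
  · exact ⟨0, fun i => by simp [kindCount]⟩
  · exact ⟨0, fun i => by simp [kindCount]⟩

end Labels

/-! ### The shift by two classes as a graph isomorphism, and the label polynomials. -/

section Periodicity

universe u

variable (K : Type u) [Field K]

/-- The bijection between codes and vertices of the tree. -/
noncomputable def treeEquiv (n : ℕ) :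
    {x : ℕ × AlgKind // IsTreeCode K n x} ≃ treeAt (Edge K 1) (kindVertex K n .main) :=
  Equiv.ofBijective
    (fun x => ⟨kindVertex K x.1.1 x.1.2, mem_treeAt_iff.2 ⟨x.1, x.2, rfl⟩⟩)
    ⟨fun x x' h => Subtype.ext (x.2.eq_of_kindVertex_eq x'.2 (congrArg Subtype.val h)),
      fun V => by
        obtain ⟨x, hx, h⟩ := mem_treeAt_iff.1 V.2
        exact ⟨⟨x, hx⟩, Subtype.ext h.symm⟩⟩

/-- Validity involves the class only through its parity, since `negSqr` is confined to even classes.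
Hence the shift is by two and not by one. -/
theorem IsTreeCode.add_two_iff {n m : ℕ} {κ : AlgKind} :
    IsTreeCode K (n + 2) (m + 2, κ) ↔ IsTreeCode K n (m, κ) := by
  simp only [IsTreeCode, AlgKind.IsValid, add_le_add_iff_right, add_left_inj]
  rw [Nat.even_add]
  simp

/-- The shift of the codes by two classes. -/
def codeShift (n : ℕ) :
    {x : ℕ × AlgKind // IsTreeCode K n x} ≃ {x : ℕ × AlgKind // IsTreeCode K (n + 2) x} where
  toFun x := ⟨(x.1.1 + 2, x.1.2), (IsTreeCode.add_two_iff K).2 x.2⟩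
  invFun x := ⟨(x.1.1 - 2, x.1.2), (IsTreeCode.add_two_iff K).1 (by
    have := x.2.1
    rw [show x.1.1 - 2 + 2 = x.1.1 by omega]
    exact x.2)⟩
  left_inv x := rfl
  right_inv x := Subtype.ext (Prod.ext (by
    have := x.2.1
    show x.1.1 - 2 + 2 = x.1.1
    omega) rfl)

/-- In terms of codes an edge says that the source is the main vertex one class below, which the
shift respects. For `m' = 0` the comparison is made by class: the source would have too small a
class on either side. -/
theorem edge_kindVertex_add_two {m m' : ℕ} {κ κ' : AlgKind} (h : IsTreeCode K 0 (m, κ)) :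
    Edge K 1 (kindVertex K (m + 2) κ) (kindVertex K (m' + 2) κ') ↔
      Edge K 1 (kindVertex K m κ) (kindVertex K m' κ') := by
  have h2 := (IsTreeCode.add_two_iff K).2 h
  rw [edge_kindVertex, edge_kindVertex]
  cases m' with
  | zero =>
    constructor
    · intro h
      have := congrArg Vertex.cls h
      rw [cls_kindVertex, cls_mainVertex] at this
      omega
    · intro h
      have := congrArg Vertex.cls h
      rw [cls_kindVertex, cls_mainVertex] at this
      omega
  | succ m' =>
    have key : ∀ {n d : ℕ} {x : ℕ × AlgKind}, IsTreeCode K n x →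
        (kindVertex K x.1 x.2 = mainVertex K (d + 1) ↔ x = (d, .main)) := fun {n d x} hx =>
      ⟨fun h => hx.eq_of_kindVertex_eq (x' := (d, .main))
        (n' := d) ⟨le_rfl, fun _ => rfl, AlgKind.isValid_main d⟩ h, by rintro rfl; rfl⟩
    have e1 := key (d := m' + 2) h2
    have e2 := key (d := m') h
    simp only at e1 e2
    rw [show m' + 1 + 2 = m' + 2 + 1 by omega, e1, e2]
    simp

/-- The isomorphism between the trees of classes two and four. -/
noncomputable def treeShift :
    Subrel (Edge K 1) (· ∈ treeAt (Edge K 1) (mainVertex K 1)) ≃r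
      Subrel (Edge K 1) (· ∈ treeAt (Edge K 1) (mainVertex K 3)) where
  toEquiv := (treeEquiv K 0).symm.trans ((codeShift K 0).trans (treeEquiv K 2))
  map_rel_iff' := by
    intro V V'
    obtain ⟨x, rfl⟩ := (treeEquiv K 0).surjective V
    obtain ⟨x', rfl⟩ := (treeEquiv K 0).surjective V'
    show Edge K 1
        (treeEquiv K 2 (codeShift K 0 ((treeEquiv K 0).symm (treeEquiv K 0 x)))).1
        (treeEquiv K 2 (codeShift K 0 ((treeEquiv K 0).symm (treeEquiv K 0 x')))).1 ↔
      Edge K 1 (treeEquiv K 0 x).1 (treeEquiv K 0 x').1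
    rw [Equiv.symm_apply_apply, Equiv.symm_apply_apply]
    exact edge_kindVertex_add_two K x.2

theorem treeShift_kindVertex {m : ℕ} {κ : AlgKind} (h : IsTreeCode K 0 (m, κ))
    (V : treeAt (Edge K 1) (mainVertex K 1)) (hV : (V : Vertex K 1) = kindVertex K m κ) :
    (treeShift K V : Vertex K 1) = kindVertex K (m + 2) κ := by
  have hV' : V = treeEquiv K 0 ⟨(m, κ), h⟩ := Subtype.ext hV
  rw [hV']
  show ((treeEquiv K 2 (codeShift K 0 ((treeEquiv K 0).symm (treeEquiv K 0 ⟨(m, κ), h⟩)))) :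
    Vertex K 1) = _
  rw [Equiv.symm_apply_apply]
  rfl

theorem iterate_shift (hA : IsInfPath (Edge K 1) (mainVertex K)) {m : ℕ} {κ : AlgKind}
    (h : IsTreeCode K 0 (m, κ)) (V : treeAt (Edge K 1) (mainVertex K 1))
    (hV : (V : Vertex K 1) = kindVertex K m κ) (i : ℕ) :
    (((hA.shift 1 2 (treeShift K))^[i] V : treeAt (Edge K 1) (mainVertex K 1)) : Vertex K 1) =
      kindVertex K (m + 2 * i) κ := by
  induction i generalizing m V with
  | zero => exact hV
  | succ i ih =>
    have h2 := (IsTreeCode.add_two_iff K).2 h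
    rw [Function.iterate_succ_apply, ih (m := m + 2) ⟨Nat.zero_le _, fun h0 => by
      simp at h0, h2.2.2⟩ _ (treeShift_kindVertex K h V hV)]
    congr 1
    omega

theorem exists_label_polynomial (hA : IsInfPath (Edge K 1) (mainVertex K)) (V : Vertex K 1) :
    ∃ f : ℚ[X], f.natDegree ≤ 1 ∧ ∀ hV : V ∈ treeAt (Edge K 1) (mainVertex K 1), ∀ i : ℕ, ∃ m : ℕ,
      vertexLabel K 1 ((hA.shift 1 2 (treeShift K))^[i] ⟨V, hV⟩ :
        treeAt (Edge K 1) (mainVertex K 1)) = m ∧ f.eval (i : ℚ) = m := by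
  by_cases hV : V ∈ treeAt (Edge K 1) (mainVertex K 1)
  · obtain ⟨⟨m, κ⟩, hx, hVx⟩ := mem_treeAt_iff.1 hV
    simp only at hVx
    obtain ⟨s, hs⟩ := kindCount_add (K := K) m κ
    refine ⟨C (s : ℚ) * X + C (kindCount K m κ : ℚ), natDegree_linear_le, fun _ i => ?_⟩
    refine ⟨kindCount K (m + 2 * i) κ, ?_, ?_⟩
    · rw [iterate_shift K hA hx ⟨V, hV⟩ hVx i]
      refine vertexLabel_eq_kindCount (fun h => ?_) ?_
      · have := hx.2.2 h
        refine ⟨?_, this.2⟩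
        rw [Nat.even_add]
        simp [this.1]
      · by_cases h0 : m = 0
        · exact Or.inl (hx.2.1 h0)
        · exact Or.inr (by omega)
    · rw [hs]
      simp
      ring
  -- Outside the tree the polynomial plays no role; zero is a default.
  · exact ⟨0, by simp, fun h => absurd h hV⟩

end Periodicity

/-! ### The vertices of `𝒯(A_2)` outside `𝒯(A_4)`. -/

section Difference

variable {K : Type*} [Field K]

/-- A code `m` stands for class `m + 2`. The tree `𝒯(A_4)` contains everything of class above four
and, in class four, only its main vertex `A_4`. -/
theorem mem_treeAt_diff_iff {V : Vertex K 1} :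
    V ∈ treeAt (Edge K 1) (mainVertex K 1) \ treeAt (Edge K 1) (mainVertex K 3) ↔
      ∃ m κ, κ.IsValid K m ∧ (m = 0 ∧ κ = .main ∨ m = 1 ∨ m = 2 ∧ κ ≠ .main) ∧
        V = kindVertex K m κ := by
  constructor
  · rintro ⟨h1, h3⟩
    obtain ⟨⟨m, κ⟩, hx, rfl⟩ := mem_treeAt_iff.1 h1
    refine ⟨m, κ, hx.2.2, ?_, rfl⟩
    have hx0 : m = 0 → κ = .main := hx.2.1
    by_cases hm : m < 2
    · by_cases h0 : m = 0
      · exact Or.inl ⟨h0, hx0 h0⟩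
      · exact Or.inr (Or.inl (by omega))
    · refine Or.inr (Or.inr ?_)
      by_contra hcon
      refine h3 (mem_treeAt_iff.2 ⟨(m, κ), ⟨by show 2 ≤ m; omega, fun h2 => ?_, hx.2.2⟩, rfl⟩)
      by_contra hκ
      exact hcon ⟨h2, hκ⟩
  · rintro ⟨m, κ, hv, h, rfl⟩
    have hx : IsTreeCode K 0 (m, κ) := ⟨Nat.zero_le _, fun h0 => by
      replace h0 : m = 0 := h0
      rcases h with h | h | h
      · exact h.2
      · omega
      · omega, hv⟩
    refine ⟨mem_treeAt_iff.2 ⟨(m, κ), hx, rfl⟩, fun h3 => ?_⟩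
    obtain ⟨x, hx', heq⟩ := mem_treeAt_iff.1 h3
    obtain rfl : (m, κ) = x := hx.eq_of_kindVertex_eq hx' heq
    have h2 : 2 ≤ m := hx'.1
    have h2' : m = 2 → κ = .main := hx'.2.1
    rcases h with h | h | h
    · omega
    · omega
    · exact h.2 (h2' h.1)

theorem edge_mainVertex_succ_kindVertex {n m : ℕ} {κ : AlgKind} :
    Edge K 1 (mainVertex K (n + 1)) (kindVertex K m κ) ↔ m = n + 1 := by
  rw [edge_kindVertex]
  constructor
  · intro h
    have := congrArg Vertex.cls h
    rw [cls_mainVertex, cls_mainVertex] at this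
    omega
  · rintro rfl
    rfl

theorem ncard_kindVertex_image {n : ℕ} (hn : 1 ≤ n) (F : Finset AlgKind)
    (hF : ∀ κ ∈ F, κ.IsValid K n) : (kindVertex K n '' (F : Set AlgKind)).ncard = F.card := by
  have hinj : Set.InjOn (kindVertex K n) (F : Set AlgKind) := fun κ hκ κ' hκ' h =>
    (kindVertex_injective (hF κ hκ) (hF κ' hκ') (Or.inr hn) h).2
  rw [hinj.ncard_image, Set.ncard_coe_finset]

/-- Children of `A_2` have class three, which is odd, so `negSqr` is the one kind missing. -/
theorem setOf_edge_mainVertex_one :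
    {B ∈ treeAt (Edge K 1) (mainVertex K 1) \ treeAt (Edge K 1) (mainVertex K 3) |
      Edge K 1 (mainVertex K 1) B} =
      kindVertex K 1 '' (({.main, .sqr, .skew, .skewSqr} : Finset AlgKind) : Set AlgKind) := by
  ext V
  constructor
  · rintro ⟨hV, hE⟩
    obtain ⟨m, κ, hv, -, rfl⟩ := mem_treeAt_diff_iff.1 hV
    obtain rfl := edge_mainVertex_succ_kindVertex.1 hE
    refine ⟨κ, ?_, rfl⟩
    cases κ
    case negSqr => exact absurd (hv rfl).1 (by decide)
    all_goals simp
  · rintro ⟨κ, hκ, rfl⟩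
    refine ⟨mem_treeAt_diff_iff.2 ⟨1, κ, ?_, Or.inr (Or.inl rfl), rfl⟩,
      edge_mainVertex_succ_kindVertex.2 rfl⟩
    rintro rfl
    simp at hκ

/-- Children of `A_3` have class four. Of these `main` is `A_4` and is removed, while `negSqr` is
present exactly when `-1` is not a square; this is the difference between three and four. -/
theorem setOf_edge_mainVertex_two (F : Finset AlgKind)
    (hF : ∀ κ : AlgKind, κ ∈ F ↔ κ.IsValid K 2 ∧ κ ≠ .main) :
    {B ∈ treeAt (Edge K 1) (mainVertex K 1) \ treeAt (Edge K 1) (mainVertex K 3) |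
      Edge K 1 (mainVertex K 2) B} = kindVertex K 2 '' (F : Set AlgKind) := by
  ext V
  constructor
  · rintro ⟨hV, hE⟩
    obtain ⟨m, κ, hv, hm, rfl⟩ := mem_treeAt_diff_iff.1 hV
    obtain rfl := edge_mainVertex_succ_kindVertex.1 hE
    refine ⟨κ, (hF κ).2 ⟨hv, ?_⟩, rfl⟩
    rcases hm with h | h | h
    · omega
    · omega
    · exact h.2
  · rintro ⟨κ, hκ, rfl⟩
    obtain ⟨hv, hm⟩ := (hF κ).1 hκ
    exact ⟨mem_treeAt_diff_iff.2 ⟨2, κ, hv, Or.inr (Or.inr ⟨rfl, hm⟩), rfl⟩,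
      edge_mainVertex_succ_kindVertex.2 rfl⟩

end Difference

/-! ### The theorem. -/

theorem mainTheorem5 (K : Type*) [Field K] :
    -- the graph is a rooted tree whose root `R` is the isomorphism type of `K Z_3`, and `𝒯(R)` is
    -- its unique maximal coclass tree
    ∃ R : Vertex K 1, R.IsTypeOf (ContrAlg K (ZeroSgp 3)) ∧
      IsRootedTree (Edge K 1) R ∧
      IsMaximalCoclassTree (Edge K 1) R ∧
      (∀ R' : Vertex K 1, IsMaximalCoclassTree (Edge K 1) R' → R' = R) ∧
      -- its maximal infinite path `A_1 → A_2 → ⋯`, where `A_{i+1} = A i`, is described by `M_{K,1}`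
      ∃ (A : ℕ → Vertex K 1) (hA : IsInfPathFrom (Edge K 1) R A),
        DescribesPath K 1 A (AlgM K 1) ∧
        -- strong defect 2, strong period 2, and polynomials of degree at most 1
        (∃ (μ : Subrel (Edge K 1) (· ∈ treeAt (Edge K 1) (A (2 - 1))) ≃r
              Subrel (Edge K 1) (· ∈ treeAt (Edge K 1) (A (2 - 1 + 2))))
            (f : Vertex K 1 → ℚ[X]),
          IsStrongPeriodicity (vertexLabel K 1) hA.2 2 2 μ f ∧
          ∀ B ∈ treeAt (Edge K 1) (A 1) \ treeAt (Edge K 1) (A 3), (f B).natDegree ≤ 1) ∧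
        -- the vertices of `𝒯(A_2) ∖ 𝒯(A_4)`
        (∀ D : Set (Vertex K 1), D = treeAt (Edge K 1) (A 1) \ treeAt (Edge K 1) (A 3) →
          A 1 ∈ D ∧
          (∀ B ∈ D, B = A 1 ∨ Edge K 1 (A 1) B ∨ Edge K 1 (A 2) B) ∧
          {B ∈ D | Edge K 1 (A 1) B}.ncard = 4 ∧
          (IsSquare (-1 : K) → {B ∈ D | Edge K 1 (A 2) B}.ncard = 3) ∧
          (¬ IsSquare (-1 : K) → {B ∈ D | Edge K 1 (A 2) B}.ncard = 4)) := by
  have hA : IsInfPathFrom (Edge K 1) (mainVertex K 0) (mainVertex K) := ⟨rfl, edge_mainVertex⟩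
  refine ⟨mainVertex K 0, ⟨zeroNilSgp, rfl, NonUnitalAlgHom.id K _, Function.bijective_id⟩,
    isRootedTree, isMaximalCoclassTree, fun _ h => h.eq_mainVertex, mainVertex K, hA, describesPath,
    ?_, ?_⟩
  · choose f hf hlabel using exists_label_polynomial K hA.2
    exact ⟨treeShift K, f, ⟨by omega, by omega, fun B _ i => hlabel B B.2 i⟩, fun B _ => hf B⟩
  · rintro D rfl
    refine ⟨?_, ?_, ?_, ?_, ?_⟩
    · exact mem_treeAt_diff_iff.2 ⟨0, .main, AlgKind.isValid_main 0, Or.inl ⟨rfl, rfl⟩, rfl⟩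
    · intro B hB
      obtain ⟨m, κ, -, h, rfl⟩ := mem_treeAt_diff_iff.1 hB
      rcases h with ⟨rfl, rfl⟩ | rfl | ⟨rfl, -⟩
      · exact Or.inl rfl
      · exact Or.inr (Or.inl (edge_mainVertex_succ_kindVertex.2 rfl))
      · exact Or.inr (Or.inr (edge_mainVertex_succ_kindVertex.2 rfl))
    · rw [setOf_edge_mainVertex_one, ncard_kindVertex_image le_rfl]
      · rfl
      · rintro κ hκ rfl
        simp at hκ
    · intro hsq
      rw [setOf_edge_mainVertex_two {.sqr, .skew, .skewSqr}, ncard_kindVertex_image (by omega)]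
      · rfl
      · rintro κ hκ rfl
        simp at hκ
      · rintro (_ | _ | _ | _ | _) <;> simp [AlgKind.IsValid, hsq]
    · intro hsq
      rw [setOf_edge_mainVertex_two {.sqr, .negSqr, .skew, .skewSqr},
        ncard_kindVertex_image (by omega)]
      · rfl
      · exact fun κ _ _ => ⟨by decide, hsq⟩
      · rintro (_ | _ | _ | _ | _) <;> simp [AlgKind.IsValid, hsq]
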